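/- An instance of a biobjective combinatorial optimization (BOCO) problem is a pair $(\mathcal S, C)$ with $\mathcal S \subseteq \{0,1\}^n$ and $C \in \mathbb{Q}^{2\times n}$; it is feasible if $\mathcal S \ne \emptyset$. Its input size is $n + \langle C\rangle$, where $\langle\cdot\rangle$ is the binary encoding length. Put $\mathcal Y = \{Cx : x \in \mathcal S\}$. The set $\mathcal Y_X$ of nondominated extreme points is the set of extreme points of the upper image $\{Cx : x \in \operatorname{conv}\mathcal S\} + \mathbb{R}^2_{\ge}$. For $\ell \in \mathbb{Q}^2_{\ge}$ the weighted-sum scalarization $P_1(\ell)$ asks for a point $y = Cx$ of an optimal solution $x$ of $\min\{\ell^T C x : x \in \mathcal S\}$ (any optimal solution may be returned). The Dichotomic Approach (DA) without a lexicographic oracle works as follows. Compute optimal points $y^0, y^1$ of $P_1((1,0))$ and $P_1((0,1))$, put $A = \{y^0,y^1\}$, and, if $y^0 \neq y^1$, put the pair $(y^0,y^1)$ into an empty first-in-first-out queue. While the queue is nonempty, retrieve a pair $(y^2,y^3)$, set $\lambda = (|y^2_2-y^3_2|, |y^2_1-y^3_1|)$ and compute an optimal point $\bar y$ of $P_1(\lambda)$;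 unless $\lambda^T y^2 = \lambda^T\bar y = \lambda^T y^3$, add $\bar y$ to $A$ and the pairs $(\bar y,y^2)$, $(\bar y,y^3)$ to the queue. At the end, output those points of $A$ that are extreme points of $\operatorname{conv} A + \mathbb{R}^2_{\ge}$. **Theorem.** (1) There are a constant $c$ and a polynomial $q$ such that for every feasible BOCO instance and for all choices of the optimal points returned by the weighted-sum scalarizations, the DA terminates after solving at most $c\,|\mathcal Y_X|$ weighted-sum scalarizations, all weights and points that occur have encoding length at most $q(n+\langle C\rangle)$, and the output is exactly $\mathcal Y_X$. (2) The DA has an implementation as a single random access machine program that uses the weighted-sum solver as a subroutine, such that the following holds for every BOCO problem (a set of instances given by binary words of length $O(n+\langle C\rangle)$). If a random access machine solves the weighted-sum scalarizations $P_1(\ell)$, $\ell\in\mathbb{Q}^2_{\ge}$, of the feasible instances in time polynomial in $n+\langle C\rangle+\langle\ell\rangle$, then the implementation, with this machine as subroutine, outputs on every feasible instance every point of $\mathcal Y_X$ exactly once and nothing else, in time polynomial in $n+\langle C\rangle$ and $|\mathcal Y_X|$; that is, the DA is output-sensitive. (Machines have unit-cost instructions and memory cells that hold integers whose encoding length is at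 most a polynomial in the size of the input of the machine.) -/

import Mathlib

open scoped Pointwise

namespace BOCO

/-! ## Encoding lengths -/

/-- Encoding length of an integer: a sign bit and `⌈log₂ (|z| + 1)⌉` bits for the absolute value
(this gives `1` for `z = 0`). -/
def encInt (z : ℤ) : ℕ := 1 + Nat.clog 2 (z.natAbs + 1)

/-- Encoding length of a rational number, through its reduced fraction. -/
def encRat (q : ℚ) : ℕ := encInt q.num + encInt (q.den : ℤ)

/-- Encoding length of a rational vector. -/
def encVec {n : ℕ} (v : Fin n → ℚ) : ℕ := n + ∑ i, encRat (v i)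

/-- Encoding length of a rational matrix. -/
def encMat {m n : ℕ} (M : Matrix (Fin m) (Fin n) ℚ) : ℕ := m * n + ∑ i, encVec (M i)

/-! ## Biobjective combinatorial optimization -/

/-- Points of the (rational) objective space. -/
abbrev Pt : Type := Fin 2 → ℚ

/-- A rational vector, seen as a real vector. -/
def toReal {n : ℕ} (v : Fin n → ℚ) : Fin n → ℝ := fun i => (v i : ℝ)

/-- An instance of a biobjective combinatorial optimization problem: a set of 0/1-vectors and an
objective function matrix with two rows. -/
structure Instance where
  n : ℕ
  S : Set (Fin n → ℚ)
  binary : ∀ x ∈ S, ∀ i, x i = 0 ∨ x i = 1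
  C : Matrix (Fin 2) (Fin n) ℚ

namespace Instance

/-- The input size `n + ⟨C⟩`. -/
def size (P : Instance) : ℕ := P.n + encMat P.C

/-- The set of feasible points `{C x | x ∈ S}` in the objective space. -/
def Y (P : Instance) : Set Pt := (fun x => P.C.mulVec x) '' P.S

/-- The upper image `{C x | x ∈ conv S} + ℝ²_≥` of the convex relaxation. -/
def upperImage (P : Instance) : Set (Fin 2 → ℝ) :=
  (fun x => (P.C.map (fun q : ℚ => (q : ℝ))).mulVec x) '' convexHull ℝ (toReal '' P.S) + Set.Ici 0

/-- The nondominated extreme points: the extreme points of the upper image of the convex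
relaxation. -/
def YX (P : Instance) : Set (Fin 2 → ℝ) := P.upperImage.extremePoints ℝ

/-- `y` is the image of an optimal solution of the weighted-sum scalarization
`min {lᵀ C x | x ∈ S}`. -/
def IsWSOptimal (P : Instance) (l y : Pt) : Prop :=
  y ∈ P.Y ∧ ∀ y' ∈ P.Y, l ⬝ᵥ y ≤ l ⬝ᵥ y'

end Instance

/-! ## The Dichotomic Approach -/

/-- State of the Dichotomic Approach: the first-in-first-out queue of pairs, the set of points found
so far, and the chronological record of the weighted-sum scalarizations solved so far
(weight, computed optimal point). -/
structure DAState where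
  queue : List (Pt × Pt)
  found : Finset Pt
  log : List (Pt × Pt)

/-- The weight `(|y²₂ - y³₂|, |y²₁ - y³₁|)` for a pair `(y², y³)`. -/
def daWeight (y2 y3 : Pt) : Pt := ![|y2 1 - y3 1|, |y2 0 - y3 0|]

/-- The first step: solve the scalarizations with the weights `(1,0)` and `(0,1)`; if the two
points are equal the queue stays empty. The solver may return any optimal point. -/
inductive DAInit (P : Instance) : DAState → Prop
  | mk (y0 y1 : Pt) (h0 : P.IsWSOptimal ![1, 0] y0) (h1 : P.IsWSOptimal ![0, 1] y1) :
      DAInit P ⟨if y0 = y1 then [] else [(y0, y1)], {y0, y1}, [(![1, 0], y0), (![0, 1], y1)]⟩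

/-- One iteration: retrieve a pair from the queue and solve the scalarization with the weight
of this pair. The solver may return any optimal point. -/
inductive DAStep (P : Instance) : DAState → DAState → Prop
  | neglect (y2 y3 y : Pt) (Q : List (Pt × Pt)) (A : Finset Pt) (L : List (Pt × Pt))
      (hopt : P.IsWSOptimal (daWeight y2 y3) y)
      (hy : daWeight y2 y3 ⬝ᵥ y2 = daWeight y2 y3 ⬝ᵥ y ∧
        daWeight y2 y3 ⬝ᵥ y = daWeight y2 y3 ⬝ᵥ y3) :
      DAStep P ⟨(y2, y3) :: Q, A, L⟩ ⟨Q, A, L ++ [(daWeight y2 y3, y)]⟩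
  | discover (y2 y3 y : Pt) (Q : List (Pt × Pt)) (A : Finset Pt) (L : List (Pt × Pt))
      (hopt : P.IsWSOptimal (daWeight y2 y3) y)
      (hy : ¬ (daWeight y2 y3 ⬝ᵥ y2 = daWeight y2 y3 ⬝ᵥ y ∧
        daWeight y2 y3 ⬝ᵥ y = daWeight y2 y3 ⬝ᵥ y3)) :
      DAStep P ⟨(y2, y3) :: Q, A, L⟩
        ⟨Q ++ [(y, y2), (y, y3)], insert y A, L ++ [(daWeight y2 y3, y)]⟩

/-- States that occur in some execution of the Dichotomic Approach on `P`. -/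
def DAReach (P : Instance) (s : DAState) : Prop :=
  ∃ s0, DAInit P s0 ∧ Relation.ReflTransGen (DAStep P) s0 s

/-- The final cleaning: of the points found, those are output that are extreme points of
`conv A + ℝ²_≥`, where `A` is the set of the points found. -/
def daOutput (A : Finset Pt) : Set Pt :=
  {y | y ∈ A ∧
    toReal y ∈ (convexHull ℝ (toReal '' (A : Set Pt)) + Set.Ici 0).extremePoints ℝ}

/-! ## Random access machines

Programs are structured programs over an infinite integer memory with direct and indirect
addressing; every instruction has unit cost, and the cells may hold only integers whose encoding
length is at most a given word length. -/

/-- Arithmetic operations of the machine. -/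
inductive Op
  | add | sub | mul | div

/-- `div` is the floor division, with value `0` for the divisor `0`. -/
def Op.eval : Op → ℤ → ℤ → ℤ
  | .add, a, b => a + b
  | .sub, a, b => a - b
  | .mul, a, b => a * b
  | .div, a, b => a.fdiv b

/-- Right-hand sides of assignments: a constant, an operation on two cells, the cell whose
address is stored in cell `j`, the input symbol whose position is stored in cell `j`, the length
of the input. -/
inductive Rhs
  | const (c : ℤ)
  | op (o : Op) (j k : ℕ)
  | load (j : ℕ)
  | read (j : ℕ)
  | len

def Rhs.eval (inp : List ℤ) (m : ℕ → ℤ) : Rhs → ℤ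
  | .const c => c
  | .op o j k => o.eval (m j) (m k)
  | .load j => m (m j).toNat
  | .read j => inp.getD (m j).toNat 0
  | .len => inp.length

/-- Programs. `store i j` writes the content of cell `j` into the cell whose address is stored in
cell `i`; `out i` outputs the content of cell `i`; `call a k b` calls the subroutine with the `k`
arguments in the cells `a, …, a + k - 1` and writes its output into the cells `b, b + 1, …`;
tests are for positivity of a cell. -/
inductive Prog
  | skip
  | assign (i : ℕ) (r : Rhs)
  | store (i j : ℕ)
  | out (i : ℕ)
  | call (a k b : ℕ)
  | seq (p q : Prog)
  | ifPos (i : ℕ) (p q : Prog)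
  | whilePos (i : ℕ) (p : Prog)

/-- Memory, output written so far, and record of the subroutine calls (arguments, result). -/
structure RState where
  mem : ℕ → ℤ
  out : List ℤ
  log : List (List ℤ × List ℤ)

/-- The initial state: all cells are zero. -/
def RState.init : RState := ⟨fun _ => 0, [], []⟩

/-- The contents of the `k` cells from address `a` on. -/
def readBlock (m : ℕ → ℤ) (a k : ℕ) : List ℤ := (List.range k).map fun i => m (a + i)

/-- Writing a list into the cells from address `b` on. -/
def writeBlock (m : ℕ → ℤ) (b : ℕ) (l : List ℤ) : ℕ → ℤ :=
  fun i => if b ≤ i ∧ i < b + l.length then l.getD (i - b) 0 else m i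

/-- `Exec wl sub inp p s s' t`: with word length `wl` and read-only input `inp`, the program `p`
started in state `s` halts in state `s'` after `t` steps. `sub args res u` says that the subroutine
halts after `u` steps with output `res` when it is called with the arguments `args`; a call costs the
steps of the subroutine and the time to hand over its input (the arguments and `inp`) and its
output. -/
inductive Exec (wl : ℕ) (sub : List ℤ → List ℤ → ℕ → Prop) (inp : List ℤ) :
    Prog → RState → RState → ℕ → Prop
  | skip (s : RState) : Exec wl sub inp .skip s s 1
  | assign (s : RState) (i : ℕ) (r : Rhs) (h : encInt (r.eval inp s.mem) ≤ wl) :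
      Exec wl sub inp (.assign i r) s
        { s with mem := Function.update s.mem i (r.eval inp s.mem) } 1
  | store (s : RState) (i j : ℕ) :
      Exec wl sub inp (.store i j) s
        { s with mem := Function.update s.mem (s.mem i).toNat (s.mem j) } 1
  | out (s : RState) (i : ℕ) :
      Exec wl sub inp (.out i) s { s with out := s.out ++ [s.mem i] } 1
  | call (s : RState) (a k b : ℕ) (res : List ℤ) (u : ℕ)
      (hsub : sub (readBlock s.mem a k) res u) (hres : ∀ z ∈ res, encInt z ≤ wl) :
      Exec wl sub inp (.call a k b) s
        { s with
          mem := writeBlock s.mem b res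
          log := s.log ++ [(readBlock s.mem a k, res)] }
        (u + (k + inp.length) + res.length + 1)
  | seq (p q : Prog) (s s' s'' : RState) (t u : ℕ)
      (hp : Exec wl sub inp p s s' t) (hq : Exec wl sub inp q s' s'' u) :
      Exec wl sub inp (.seq p q) s s'' (t + u)
  | ifTrue (i : ℕ) (p q : Prog) (s s' : RState) (t : ℕ) (hi : 0 < s.mem i)
      (hp : Exec wl sub inp p s s' t) : Exec wl sub inp (.ifPos i p q) s s' (t + 1)
  | ifFalse (i : ℕ) (p q : Prog) (s s' : RState) (t : ℕ) (hi : ¬ 0 < s.mem i)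
      (hq : Exec wl sub inp q s s' t) : Exec wl sub inp (.ifPos i p q) s s' (t + 1)
  | whileTrue (i : ℕ) (p : Prog) (s s' s'' : RState) (t u : ℕ) (hi : 0 < s.mem i)
      (hp : Exec wl sub inp p s s' t) (hw : Exec wl sub inp (.whilePos i p) s' s'' u) :
      Exec wl sub inp (.whilePos i p) s s'' (t + u + 1)
  | whileFalse (i : ℕ) (p : Prog) (s : RState) (hi : ¬ 0 < s.mem i) :
      Exec wl sub inp (.whilePos i p) s s 1

/-- Without access to a subroutine and with word length `wl`, the program `W` halts on the input
`inp` with output `res` after `t` steps. -/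
def Runs (wl : ℕ) (W : Prog) (inp res : List ℤ) (t : ℕ) : Prop :=
  ∃ s : RState, Exec wl (fun _ _ _ => False) inp W .init s t ∧ s.out = res

/-! ## Problems and polynomial-time solvability -/

/-- A biobjective combinatorial optimization problem: a language of binary words, each of which
represents an instance, with representations of length `O(n + ⟨C⟩)`. The set of solutions is given
implicitly. -/
structure Problem where
  I : Set (List Bool)
  inst : List Bool → Instance
  length_le : ∃ a : ℕ, ∀ w ∈ I, w.length ≤ a * ((inst w).size + 1)

/-- A binary word as an input of the machine. -/
def wordCode (w : List Bool) : List ℤ := w.map fun b => if b then 1 else 0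

/-- A rational point is represented by the numerators and denominators of its components
(reduced fractions). -/
def ptCode (y : Pt) : List ℤ := [(y 0).num, ((y 0).den : ℤ), (y 1).num, ((y 1).den : ℤ)]

/-- `W` solves the weighted-sum scalarization of `P` in polynomial time: for every feasible instance
and every weight `l ≥ 0` it outputs the image of an optimal solution, in a number of steps, and with
a word length, that are polynomially bounded in the input size plus the encoding length of `l`. -/
def SolvesWSInPolyTime (P : Problem) (W : Prog) : Prop :=
  ∃ p : Polynomial ℕ, ∀ w ∈ P.I, (P.inst w).S.Nonempty → ∀ l : Pt, 0 ≤ l →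
    ∃ (y : Pt) (t : ℕ), (P.inst w).IsWSOptimal l y ∧
      Runs (p.eval ((P.inst w).size + encVec l)) W (ptCode l ++ wordCode w) (ptCode y) t ∧
      t ≤ p.eval ((P.inst w).size + encVec l)

/-- The execution of `D` on the instance word `w`, with word length `wl` and with the program `W` as
subroutine (called on the arguments followed by `w`): it halts in state `s` after `t` steps. -/
def RunsWith (wl : ℕ) (W D : Prog) (w : List Bool) (s : RState) (t : ℕ) : Prop :=
  Exec wl (fun args res u => Runs wl W (args ++ wordCode w) res u) (wordCode w) D .init s t

/-- The final machine state `s` is the result of a complete execution of the Dichotomic Approach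
on the instance `P` that outputs the points `ys`, in this order: the subroutine calls are exactly
the scalarizations solved in that execution, in the same order and with the same answers, and the
points that the execution outputs are written out, each of them once. -/
def RealizesDA (P : Instance) (s : RState) (ys : List Pt) : Prop :=
  ∃ d : DAState, DAReach P d ∧ d.queue = [] ∧
    s.log = d.log.map (fun e => (ptCode e.1, ptCode e.2)) ∧
    s.out = ys.flatMap ptCode ∧ ys.Nodup ∧ {y | y ∈ ys} = daOutput d.found

end BOCO

open BOCO

namespace BOCO

/-! ## Vertices of a finite planar set, combinatorially -/

/-! Geometry. The nondominated extreme points are described combinatorially by `IsVertex`: a vertex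
is minimal and is not weakly above a combination of a point to its left and a point below it.
Equivalently, it is the unique minimizer of a strictly positive weight. `extremePoints_upper`
matches this with the extreme points of the upper image of any finite set, so the rest of the
argument takes place among finitely many rational points of the plane.

A pair in the queue is, up to orientation, a chord whose end points are optimal for two weights
(`Chord`). Feasible points strictly below a chord lie in the box spanned by its ends (`Chord.box`).
A point `y` below the chord that is optimal for its weight splits it into two chords, and each
vertex below the old chord is `y` itself or lies below exactly one of the new ones (`Chord.cover`,
`Chord.not_below_both`). So no vertex is ever lost: when the queue is empty, all vertices of `P.Y`
have been found. As only feasible points are found, the set found then has the same vertices as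
`P.Y` (`isVertex_iff_of_subset`).

Counting. Without a lexicographic oracle `y` need not be a vertex. But then it lies inside an edge
parallel to the chord, and there are vertices strictly below both new chords
(`Chord.exists_vertices`). Let `k` vertices lie below the old chord and `k₁`, `k₂` below the new
ones. Either `k₁ + k₂ + 1 ≤ k`, or `k₁, k₂ ≥ 1` and `k₁ + k₂ ≤ k`. In both cases the potential `max
1 (4 k - 1)` of the old chord pays for the two new potentials and for one scalarization
(`Chord.potential_add`). The two initial scalarizations and an initial potential of at most `4 |YX|`
give at most `4 |YX| + 2 ≤ 6 |YX|` scalarizations. Encoding lengths stay polynomial because the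
height `|num| + den` is submultiplicative under addition and a feasible point is a subset sum of the
columns of `C`.

Machine. `daP` is an explicit program, verified by rules for total correctness with time bounds
(`Machine.Run`). Its queue is an array that is never overwritten, so it also records the points
found; `Sim` relates it to the abstract algorithm. Weights are reduced by Euclid's algorithm because
the subroutine expects reduced fractions. Finally each stored point is tested against all pairs of
stored points, in cubic time. Stored values, addresses included, stay below `2 ^ k` with `k` linear
in the input size, and intermediate values below a fixed power of this bound; hence a polynomial
word length suffices. -/

theorem dot_eq (l y : Pt) : l ⬝ᵥ y = l 0 * y 0 + l 1 * y 1 := by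
  simp [dotProduct, Fin.sum_univ_two]

theorem pt_le_iff (a b : Pt) : a ≤ b ↔ a 0 ≤ b 0 ∧ a 1 ≤ b 1 := by
  simp [Pi.le_def, Fin.forall_fin_two]

theorem pt_ext_iff (a b : Pt) : a = b ↔ a 0 = b 0 ∧ a 1 = b 1 := by
  simp [funext_iff, Fin.forall_fin_two]

/-- `y` is a point of `A` that is neither dominated by another point of `A` nor by a convex
combination of two other points of `A`. -/
def IsVertex (A : Set Pt) (y : Pt) : Prop :=
  y ∈ A ∧ (∀ g ∈ A, g ≤ y → g = y) ∧
    ∀ g ∈ A, ∀ h ∈ A, g 0 < y 0 → h 1 < y 1 →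
      (g 0 - y 0) * (h 1 - y 1) < (g 1 - y 1) * (h 0 - y 0)

/-- A vertex is the unique minimizer of some positive weight. -/
theorem IsVertex.exists_weight {A : Set Pt} (hA : A.Finite) {y : Pt} (hy : IsVertex A y) :
    ∃ l : Pt, 0 < l 0 ∧ 0 < l 1 ∧ ∀ g ∈ A, g ≠ y → l ⬝ᵥ y < l ⬝ᵥ g := by
  classical
  obtain ⟨_, hdom, hcomb⟩ := hy
  let F := hA.toFinset
  -- The weight `(r, 1)` prefers `y` to a point on its left iff `r` is below a slope in `hi`, and to
  -- a lower point iff `r` is above a slope in `lo`. The element `0` of `lo` makes `r` positive.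
  let hi : Finset ℚ := (F.filter fun g => g 0 < y 0).image fun g => (g 1 - y 1) / (y 0 - g 0)
  let lo : Finset ℚ :=
    insert 0 ((F.filter fun g => g 1 < y 1).image fun g => (y 1 - g 1) / (g 0 - y 0))
  have left : ∀ g ∈ A, g 0 < y 0 → y 1 < g 1 := by
    intro g hg h
    by_contra h'
    have := hdom g hg ((pt_le_iff _ _).2 ⟨h.le, not_lt.1 h'⟩)
    rw [this] at h
    exact lt_irrefl _ h
  have right : ∀ g ∈ A, g 1 < y 1 → y 0 < g 0 := by
    intro g hg h
    by_contra h'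
    have := hdom g hg ((pt_le_iff _ _).2 ⟨not_lt.1 h', h.le⟩)
    rw [this] at h
    exact lt_irrefl _ h
  obtain ⟨r, hr1, hr2⟩ := Order.exists_between_finsets lo hi (by
    intro x hx z hz
    simp only [hi, Finset.mem_image, Finset.mem_filter, F, Set.Finite.mem_toFinset] at hz
    obtain ⟨g, ⟨hg, hg0⟩, rfl⟩ := hz
    have hg1 := left g hg hg0
    simp only [lo, Finset.mem_insert, Finset.mem_image, Finset.mem_filter, F,
      Set.Finite.mem_toFinset] at hx
    rcases hx with rfl | ⟨h, ⟨hh, hh1⟩, rfl⟩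
    · exact div_pos (by linarith) (by linarith)
    · have hh0 := right h hh hh1
      have := hcomb g hg h hh hg0 hh1
      rw [div_lt_div_iff₀ (by linarith) (by linarith)]
      nlinarith)
  have r0 : 0 < r := hr1 0 (by simp [lo])
  refine ⟨![r, 1], by simpa using r0, by simp, ?_⟩
  intro g hg hne
  rw [dot_eq, dot_eq]
  simp only [Matrix.cons_val_zero, Matrix.cons_val_one]
  by_cases h0 : g 0 < y 0
  · have := hr2 _ (Finset.mem_image.2 ⟨g, by simp [F, hg, h0], rfl⟩)
    rw [lt_div_iff₀ (by linarith)] at this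
    linarith
  by_cases h1 : g 1 < y 1
  · have := hr1 _ (Finset.mem_insert_of_mem (Finset.mem_image.2 ⟨g, by simp [F, hg, h1], rfl⟩))
    rw [div_lt_iff₀ (by linarith [right g hg h1])] at this
    linarith
  push Not at h0 h1
  rcases h0.lt_or_eq with h | h
  · nlinarith
  · rcases h1.lt_or_eq with h' | h'
    · nlinarith
    · exact absurd ((pt_ext_iff _ _).2 ⟨h.symm, h'.symm⟩) hne

/-- A minimizer of a positive weight is a vertex unless it lies between two other minimizers. -/
theorem isVertex_or_between {A : Set Pt} {y l : Pt} (hy : y ∈ A) (l0 : 0 < l 0) (l1 : 0 < l 1)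
    (hmin : ∀ g ∈ A, l ⬝ᵥ y ≤ l ⬝ᵥ g) :
    IsVertex A y ∨ ∃ g ∈ A, ∃ h ∈ A, l ⬝ᵥ g = l ⬝ᵥ y ∧ l ⬝ᵥ h = l ⬝ᵥ y ∧ g 0 < y 0 ∧ y 0 < h 0 := by
  by_contra hcon
  push Not at hcon
  obtain ⟨hv, hb⟩ := hcon
  simp only [dot_eq] at hmin hb
  refine hv ⟨hy, ?_, ?_⟩
  · intro g hg hle
    rw [pt_le_iff] at hle
    rw [pt_ext_iff]
    have := hmin g hg
    constructor <;> by_contra hne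
    · have := lt_of_le_of_ne hle.1 hne
      nlinarith [mul_lt_mul_of_pos_left this l0, mul_le_mul_of_nonneg_left hle.2 l1.le]
    · have := lt_of_le_of_ne hle.2 hne
      nlinarith [mul_lt_mul_of_pos_left this l1, mul_le_mul_of_nonneg_left hle.1 l0.le]
  · intro g hg h hh g0 h1
    by_contra hle
    push Not at hle
    have mg := hmin g hg
    have mh := hmin h hh
    -- The failed inequality is `a2 * b1 ≤ a1 * b2`. Multiplying the optimality conditions `l 0 * a1
    -- ≤ l 1 * a2` and `l 1 * b2 ≤ l 0 * b1` gives its reverse, so all are equalities and `g`, `h`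
    -- are minimizers too.
    obtain ⟨a1, ha1⟩ : ∃ a, a = y 0 - g 0 := ⟨_, rfl⟩
    obtain ⟨a2, ha2⟩ : ∃ a, a = g 1 - y 1 := ⟨_, rfl⟩
    obtain ⟨b1, hb1⟩ : ∃ a, a = h 0 - y 0 := ⟨_, rfl⟩
    obtain ⟨b2, hb2⟩ : ∃ a, a = y 1 - h 1 := ⟨_, rfl⟩
    have e1 : a2 * b1 ≤ a1 * b2 := by rw [ha1, ha2, hb1, hb2]; linarith
    have p1 : 0 < a1 := by linarith
    have p2 : 0 < b2 := by linarith
    have ma : l 0 * a1 ≤ l 1 * a2 := by rw [ha1, ha2]; linarith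
    have mb : l 1 * b2 ≤ l 0 * b1 := by rw [hb1, hb2]; linarith
    have p3 : 0 < b1 := by
      by_contra hc
      nlinarith [mul_pos l1 p2, mul_nonneg l0.le (sub_nonneg.2 (not_lt.1 hc))]
    have p4 : 0 < a2 := by
      by_contra hc
      nlinarith [mul_pos l0 p1, mul_nonneg l1.le (sub_nonneg.2 (not_lt.1 hc))]
    have q1 : l 0 * a1 = l 1 * a2 := by
      apply le_antisymm ma
      by_contra hc
      push Not at hc
      have := mul_lt_mul_of_pos_right hc p2
      have := mul_le_mul_of_nonneg_left mb p4.le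
      have := mul_le_mul_of_nonneg_left e1 l0.le
      nlinarith
    have q2 : l 1 * b2 = l 0 * b1 := by
      apply le_antisymm mb
      by_contra hc
      push Not at hc
      have := mul_lt_mul_of_pos_left hc p1
      have := mul_le_mul_of_nonneg_left ma p3.le
      have := mul_le_mul_of_nonneg_left e1 l1.le
      nlinarith
    have := hb g hg h hh (by rw [ha1, ha2] at q1; linarith) (by rw [hb1, hb2] at q2; linarith) g0
    linarith

/-- The leftmost minimizer cannot lie between two other minimizers. -/
theorem exists_vertex_le {A : Set Pt} (hA : A.Finite) {z l : Pt} (hz : z ∈ A) (l0 : 0 < l 0)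
    (l1 : 0 < l 1) (hmin : ∀ g ∈ A, l ⬝ᵥ z ≤ l ⬝ᵥ g) :
    ∃ u, IsVertex A u ∧ l ⬝ᵥ u = l ⬝ᵥ z ∧ u 0 ≤ z 0 := by
  obtain ⟨u, ⟨hu, hul⟩, humin⟩ := Set.exists_min_image {g ∈ A | l ⬝ᵥ g = l ⬝ᵥ z} (fun g => g 0)
    (hA.subset (Set.sep_subset _ _)) ⟨z, hz, rfl⟩
  refine ⟨u, ?_, hul, humin z ⟨hz, rfl⟩⟩
  rcases isVertex_or_between hu l0 l1 (fun g hg => hul ▸ hmin g hg) with h | ⟨g, hg, h, hh, e1, e2, e3, e4⟩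
  · exact h
  · exact absurd (humin g ⟨hg, e1.trans hul⟩) (not_le.2 e3)

theorem exists_vertex_ge {A : Set Pt} (hA : A.Finite) {z l : Pt} (hz : z ∈ A) (l0 : 0 < l 0)
    (l1 : 0 < l 1) (hmin : ∀ g ∈ A, l ⬝ᵥ z ≤ l ⬝ᵥ g) :
    ∃ u, IsVertex A u ∧ l ⬝ᵥ u = l ⬝ᵥ z ∧ z 0 ≤ u 0 := by
  obtain ⟨u, ⟨hu, hul⟩, humax⟩ := Set.exists_max_image {g ∈ A | l ⬝ᵥ g = l ⬝ᵥ z} (fun g => g 0)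
    (hA.subset (Set.sep_subset _ _)) ⟨z, hz, rfl⟩
  refine ⟨u, ?_, hul, humax z ⟨hz, rfl⟩⟩
  rcases isVertex_or_between hu l0 l1 (fun g hg => hul ▸ hmin g hg) with h | ⟨g, hg, h, hh, e1, e2, e3, e4⟩
  · exact h
  · exact absurd (humax h ⟨hh, e2.trans hul⟩) (not_le.2 e4)

theorem exists_isVertex {A : Set Pt} (hA : A.Finite) (hne : A.Nonempty) {l : Pt} (l0 : 0 < l 0)
    (l1 : 0 < l 1) : ∃ u, IsVertex A u ∧ ∀ g ∈ A, l ⬝ᵥ u ≤ l ⬝ᵥ g := by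
  obtain ⟨z, hz, hmin⟩ := Set.exists_min_image A (fun g => l ⬝ᵥ g) hA hne
  obtain ⟨u, hu, hl, _⟩ := exists_vertex_le hA hz l0 l1 hmin
  exact ⟨u, hu, fun g hg => hl ▸ hmin g hg⟩

/-- A subset that contains all vertices has the same vertices. -/
theorem isVertex_iff_of_subset {A B : Set Pt} (hB : B.Finite) (hAB : A ⊆ B)
    (h : ∀ y, IsVertex B y → y ∈ A) (y : Pt) : IsVertex A y ↔ IsVertex B y := by
  constructor
  · intro hy
    -- A weight that singles out `y` in `A` attains its minimum over `B` at a vertex of `B`. That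
    -- vertex belongs to `A`, so it is `y`.
    obtain ⟨l, l0, l1, hl⟩ := hy.exists_weight (hB.subset hAB)
    obtain ⟨u, hu, hmin⟩ := exists_isVertex hB ⟨y, hAB hy.1⟩ l0 l1
    by_cases hyu : u = y
    · exact hyu ▸ hu
    · exact absurd (hl u (h u hu) hyu) (not_lt.2 (hmin y (hAB hy.1)))
  · intro hy
    exact ⟨h y hy, fun g hg => hy.2.1 g (hAB hg),
      fun g hg k hk => hy.2.2 g (hAB hg) k (hAB hk)⟩

/-! ## Extreme points -/

/-- The upper image of a set of points. -/
def upper (A : Set Pt) : Set (Fin 2 → ℝ) := convexHull ℝ (toReal '' A) + Set.Ici 0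

theorem toReal_injective {n : ℕ} : Function.Injective (toReal (n := n)) := by
  intro a b h
  funext i
  have := congrFun h i
  simpa [toReal] using this

theorem subset_upper (A : Set Pt) : convexHull ℝ (toReal '' A) ⊆ upper A := fun x hx =>
  ⟨x, hx, 0, Set.mem_Ici.2 le_rfl, add_zero x⟩

theorem upper_add {A : Set Pt} {x r : Fin 2 → ℝ} (hx : x ∈ upper A) (hr : 0 ≤ r) :
    x + r ∈ upper A := by
  obtain ⟨a, ha, s, hs, rfl⟩ := hx
  refine ⟨a, ha, s + r, ?_, (add_assoc _ _ _).symm⟩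
  exact Set.mem_Ici.2 (add_nonneg (Set.mem_Ici.1 hs) hr)

/-- Extreme points of the upper image are minimal. -/
theorem extreme_upper_minimal {A : Set Pt} {x y : Fin 2 → ℝ}
    (hy : y ∈ (upper A).extremePoints ℝ) (hx : x ∈ upper A) (hxy : x ≤ y) : x = y := by
  -- `y` is the midpoint of `x` and its reflection in `y`.
  have h2 : y + (y - x) ∈ upper A := upper_add hy.1 (sub_nonneg.2 hxy)
  have := hy.2 hx h2 ⟨1 / 2, 1 / 2, by norm_num, by norm_num, by norm_num, by
    ext i; simp; ring⟩
  exact this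

/-- The point `y` together with the open half-plane of larger weight is convex, so strict optimality
passes to the convex hull; a positive weight preserves it when a nonnegative vector is added. -/
theorem weight_lt_of_mem_upper {A : Set Pt} {y l : Pt} (l0 : 0 < l 0) (l1 : 0 < l 1)
    (hl : ∀ g ∈ A, g ≠ y → l ⬝ᵥ y < l ⬝ᵥ g) {x : Fin 2 → ℝ} (hx : x ∈ upper A)
    (hne : x ≠ toReal y) :
    (l 0 : ℝ) * y 0 + l 1 * y 1 < l 0 * x 0 + l 1 * x 1 := by
  have L0 : (0 : ℝ) < l 0 := by exact_mod_cast l0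
  have L1 : (0 : ℝ) < l 1 := by exact_mod_cast l1
  have key : convexHull ℝ (toReal '' A) ⊆
      {x | x = toReal y ∨ (l 0 : ℝ) * y 0 + l 1 * y 1 < l 0 * x 0 + l 1 * x 1} := by
    apply convexHull_min
    · rintro _ ⟨g, hg, rfl⟩
      by_cases h : g = y
      · left; rw [h]
      · right
        have := hl g hg h
        rw [dot_eq, dot_eq] at this
        simp only [toReal]
        exact_mod_cast this
    · rw [convex_iff_forall_pos]
      rintro a ha b hb s t hs ht hst
      have hs' : s = 1 - t := by linarith
      rcases ha with rfl | ha <;> rcases hb with rfl | hb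
      · left; rw [← add_smul, hst, one_smul]
      all_goals
        right
        simp only [toReal, Pi.add_apply, Pi.smul_apply, smul_eq_mul] at *
      · have := mul_lt_mul_of_pos_left hb ht
        subst hs'; nlinarith
      · have := mul_lt_mul_of_pos_left ha hs
        subst hs'; nlinarith
      · have h1 := mul_lt_mul_of_pos_left ha hs
        have h2 := mul_lt_mul_of_pos_left hb ht
        subst hs'; nlinarith
  obtain ⟨a, ha, r, hr, rfl⟩ := hx
  have hr0 : 0 ≤ r 0 := Set.mem_Ici.1 hr 0
  have hr1 : 0 ≤ r 1 := Set.mem_Ici.1 hr 1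
  have p0 := mul_nonneg L0.le hr0
  have p1 := mul_nonneg L1.le hr1
  rcases key ha with rfl | h
  · have : r 0 ≠ 0 ∨ r 1 ≠ 0 := by
      by_contra hc
      push Not at hc
      apply hne
      funext i
      fin_cases i <;> simp [hc.1, hc.2]
    simp only [Pi.add_apply, toReal]
    rcases this with h | h
    · have := mul_pos L0 (lt_of_le_of_ne hr0 h.symm)
      nlinarith
    · have := mul_pos L1 (lt_of_le_of_ne hr1 h.symm)
      nlinarith
  · simp only [Pi.add_apply]
    linarith

/-- The extreme points of the upper image of a finite set are its vertices. -/
theorem extremePoints_upper {A : Set Pt} (hA : A.Finite) :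
    (upper A).extremePoints ℝ = toReal '' {y | IsVertex A y} := by
  apply Set.Subset.antisymm
  · intro x hx
    -- By minimality the summand from the cone vanishes. Hence `x` is extreme in the convex hull
    -- itself and comes from a point of `A`.
    obtain ⟨a, ha, r, hr, hax⟩ := hx.1
    have hle : a ≤ x := by
      rw [← hax]; exact le_add_of_nonneg_right (Set.mem_Ici.1 hr)
    have hxa := extreme_upper_minimal hx (subset_upper A ha) hle
    rw [hxa] at ha
    have hext : x ∈ (convexHull ℝ (toReal '' A)).extremePoints ℝ :=
      ⟨ha, fun p hp q hq => hx.2 (subset_upper A hp) (subset_upper A hq)⟩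
    obtain ⟨y, hyA, rfl⟩ := extremePoints_convexHull_subset hext
    have mem : ∀ g ∈ A, toReal g ∈ convexHull ℝ (toReal '' A) := fun g hg =>
      subset_convexHull ℝ _ ⟨g, hg, rfl⟩
    refine ⟨y, ⟨hyA, ?_, ?_⟩, rfl⟩
    · intro g hg hgy
      apply toReal_injective
      apply extreme_upper_minimal hx (subset_upper A (mem g hg))
      intro i
      have := hgy i
      simp only [toReal]
      exact_mod_cast this
    · intro g hg h hh g0 h1
      by_contra hcon
      push Not at hcon
      -- convex combination with the first coordinate of `y`, or `h` itself dominates `y`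
      by_cases hh0 : h 0 ≤ y 0
      · have : toReal h = toReal y := extreme_upper_minimal hx (subset_upper A (mem h hh)) (by
          intro i
          simp only [toReal]
          have : h i ≤ y i := by fin_cases i <;> simp [hh0, h1.le]
          exact_mod_cast this)
        rw [toReal_injective this] at h1
        exact lt_irrefl _ h1
      push Not at hh0
      -- `t` selects the point of the segment from `g` to `h` with abscissa `y 0`. By `hcon` it is
      -- not above `y`, so minimality makes it equal to `y`, inside a segment.
      obtain ⟨t, ht⟩ : ∃ t : ℚ, t = (y 0 - g 0) / (h 0 - g 0) := ⟨_, rfl⟩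
      have hd : 0 < h 0 - g 0 := by linarith
      have t0 : 0 < t := ht ▸ div_pos (by linarith) hd
      have t1 : t < 1 := by rw [ht, div_lt_one hd]; linarith
      have e : t * (h 0 - g 0) = y 0 - g 0 := by rw [ht]; field_simp
      have c0 : (1 - t) * g 0 + t * h 0 = y 0 := by linarith
      have c1 : (1 - t) * g 1 + t * h 1 ≤ y 1 := by
        rw [← sub_nonneg]
        have : 0 ≤ (y 1 - ((1 - t) * g 1 + t * h 1)) * (h 0 - g 0) := by
          have : (y 1 - ((1 - t) * g 1 + t * h 1)) * (h 0 - g 0)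
            = (y 1 - g 1) * (h 0 - g 0) - (t * (h 0 - g 0)) * (h 1 - g 1) := by ring
          rw [this, e]
          nlinarith
        exact nonneg_of_mul_nonneg_left this hd
      have T0 : (0 : ℝ) < t := by exact_mod_cast t0
      have T1 : (0 : ℝ) < 1 - t := by rw [sub_pos]; exact_mod_cast t1
      have hz : (1 - (t : ℝ)) • toReal g + (t : ℝ) • toReal h ∈ convexHull ℝ (toReal '' A) :=
        (convex_convexHull ℝ _) (mem g hg) (mem h hh) T1.le T0.le (by ring)
      have hzy := extreme_upper_minimal hx (subset_upper A hz) (by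
        intro i
        simp only [toReal, Pi.add_apply, Pi.smul_apply, smul_eq_mul]
        have : (1 - t) * g i + t * h i ≤ y i := by
          fin_cases i
          · exact c0.le
          · exact c1
        exact_mod_cast this)
      have := hx.2 (subset_upper A (mem g hg)) (subset_upper A (mem h hh))
        ⟨1 - t, t, T1, T0, by ring, hzy⟩
      rw [toReal_injective this] at g0
      exact lt_irrefl _ g0
  · rintro _ ⟨y, hy, rfl⟩
    obtain ⟨l, l0, l1, hl⟩ := hy.exists_weight hA
    refine ⟨subset_upper A (subset_convexHull ℝ _ ⟨y, hy.1, rfl⟩), ?_⟩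
    intro p hp q hq hpq
    by_contra hne
    have h1 := weight_lt_of_mem_upper l0 l1 hl hp hne
    have h2 : (l 0 : ℝ) * y 0 + l 1 * y 1 ≤ l 0 * q 0 + l 1 * q 1 := by
      by_cases hq' : q = toReal y
      · rw [hq']; exact le_rfl
      · exact (weight_lt_of_mem_upper l0 l1 hl hq hq').le
    obtain ⟨s, t, hs, ht, hst, h⟩ := hpq
    have e0 := congrFun h 0
    have e1 := congrFun h 1
    simp only [toReal, Pi.add_apply, Pi.smul_apply, smul_eq_mul] at e0 e1
    have hs' : s = 1 - t := by linarith
    have := mul_lt_mul_of_pos_left h1 hs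
    have := mul_le_mul_of_nonneg_left h2 ht.le
    rw [← e0, ← e1] at *
    subst hs'
    nlinarith

theorem daOutput_eq (A : Finset Pt) : daOutput A = {y | IsVertex (A : Set Pt) y} := by
  have h := extremePoints_upper A.finite_toSet
  ext y
  simp only [daOutput, Set.mem_ofPred_eq]
  change y ∈ A ∧ toReal y ∈ (upper (A : Set Pt)).extremePoints ℝ ↔ _
  rw [h, toReal_injective.mem_set_image]
  exact ⟨fun h => h.2, fun h => ⟨h.1, h⟩⟩

/-! ### Feasible points of an instance and their vertices -/

namespace Instance

theorem finite_S (P : Instance) : P.S.Finite := by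
  refine (Set.Finite.pi' (t := fun _ : Fin P.n => ({0, 1} : Set ℚ)) fun _ => by simp).subset ?_
  intro x hx i
  simpa using P.binary x hx i

theorem finite_Y (P : Instance) : P.Y.Finite := P.finite_S.image _

/-- Linear maps commute with convex hulls, which moves the problem from the solution space to the
plane. -/
theorem upperImage_eq (P : Instance) : P.upperImage = upper P.Y := by
  unfold upperImage upper Y
  congr 1
  have := (Matrix.mulVecLin (P.C.map (fun q : ℚ => (q : ℝ)))).image_convexHull (toReal '' P.S)
  rw [show (fun x => (P.C.map (fun q : ℚ => (q : ℝ))).mulVec x) '' convexHull ℝ (toReal '' P.S)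
    = _ from this, Set.image_image, Set.image_image]
  congr 1
  apply Set.image_congr
  intro x _
  funext i
  simp [Matrix.mulVec, dotProduct, toReal]

theorem YX_eq (P : Instance) : P.YX = toReal '' {y | IsVertex P.Y y} := by
  rw [YX, upperImage_eq, extremePoints_upper P.finite_Y]

open Classical in
/-- The vertices of the set of feasible points. -/
noncomputable def vertices (P : Instance) : Finset Pt := P.finite_Y.toFinset.filter (IsVertex P.Y)

theorem mem_vertices (P : Instance) (y : Pt) : y ∈ P.vertices ↔ IsVertex P.Y y := by
  simp only [vertices, Finset.mem_filter, Set.Finite.mem_toFinset, and_iff_right_iff_imp]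
  exact fun h => h.1

theorem ncard_YX (P : Instance) : P.YX.ncard = P.vertices.card := by
  rw [YX_eq, Set.ncard_image_of_injective _ toReal_injective, ← Set.ncard_coe_finset]
  congr 1
  ext y
  simp [mem_vertices]

theorem vertices_card_pos (P : Instance) (h : P.S.Nonempty) : 0 < P.vertices.card := by
  obtain ⟨u, hu, _⟩ := exists_isVertex P.finite_Y (h.image _) (l := ![1, 1]) (by simp) (by simp)
  exact Finset.card_pos.2 ⟨u, (P.mem_vertices u).2 hu⟩

end Instance

/-! ## Chords of the nondominated frontier -/

/-- `z` lies strictly below the line through `a` and `b`, where `a` is the upper left point. -/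
def Below (a b z : Pt) : Prop :=
  (a 1 - b 1) * (z 0 - a 0) + (b 0 - a 0) * (z 1 - a 1) < 0

/-- `a` and `b` are optimal for the weights `la` and `lb`, and `a` is the upper left one. -/
structure Chord (P : Instance) (a b la lb : Pt) : Prop where
  opt_left : P.IsWSOptimal la a
  opt_right : P.IsWSOptimal lb b
  left0 : 0 ≤ la 0
  left1 : 0 ≤ la 1
  left_pos : 0 < la 0 + la 1
  right0 : 0 ≤ lb 0
  right1 : 0 ≤ lb 1
  right_pos : 0 < lb 0 + lb 1
  le0 : a 0 ≤ b 0
  le1 : b 1 ≤ a 1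

theorem daWeight_comm (a b : Pt) : daWeight a b = daWeight b a := by
  simp [daWeight, abs_sub_comm]

theorem daWeight_nonneg (a b : Pt) : 0 ≤ daWeight a b := by
  intro i
  fin_cases i <;> simp [daWeight]

namespace Chord

variable {P : Instance} {a b la lb : Pt}

theorem weight (h : Chord P a b la lb) : daWeight a b = ![a 1 - b 1, b 0 - a 0] := by
  rw [daWeight, abs_of_nonneg (sub_nonneg.2 h.le1), abs_sub_comm,
    abs_of_nonneg (sub_nonneg.2 h.le0)]

theorem weight_dot_eq (h : Chord P a b la lb) : daWeight a b ⬝ᵥ a = daWeight a b ⬝ᵥ b := by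
  rw [h.weight, dot_eq, dot_eq]
  simp only [Matrix.cons_val_zero, Matrix.cons_val_one]
  ring

theorem below_iff (h : Chord P a b la lb) (z : Pt) :
    daWeight a b ⬝ᵥ z < daWeight a b ⬝ᵥ a ↔ Below a b z := by
  rw [h.weight, dot_eq, dot_eq, Below, ← sub_neg]
  simp only [Matrix.cons_val_zero, Matrix.cons_val_one]
  rw [show (a 1 - b 1) * z 0 + (b 0 - a 0) * z 1 - ((a 1 - b 1) * a 0 + (b 0 - a 0) * a 1)
    = (a 1 - b 1) * (z 0 - a 0) + (b 0 - a 0) * (z 1 - a 1) by ring]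

/-- At `a`, the half-plane where `la` is at least its value at `a` and the open half-plane below the
chord intersect in a cone to the right of and below `a`. Likewise at `b`, to the left and above. -/
theorem box (h : Chord P a b la lb) {z : Pt} (hz : z ∈ P.Y) (hb : Below a b z) :
    a 0 ≤ z 0 ∧ z 0 ≤ b 0 ∧ b 1 ≤ z 1 ∧ z 1 ≤ a 1 ∧ 0 < a 1 - b 1 ∧ 0 < b 0 - a 0 := by
  have ha1 := h.opt_left.2 z hz
  have ha2 := h.opt_left.2 b h.opt_right.1
  have hb1 := h.opt_right.2 z hz
  have hb2 := h.opt_right.2 a h.opt_left.1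
  have h1 := h.left0
  have h2 := h.left1
  have h3 := h.left_pos
  have h4 := h.right0
  have h5 := h.right1
  have h6 := h.right_pos
  have hL := sub_nonneg.2 h.le1
  have hM := sub_nonneg.2 h.le0
  rw [dot_eq, dot_eq] at ha1 ha2 hb1 hb2
  unfold Below at hb
  have hb' : (a 1 - b 1) * (z 0 - b 0) + (b 0 - a 0) * (z 1 - b 1) < 0 := by linarith
  obtain ⟨p, hp⟩ : ∃ p, p = la 0 := ⟨_, rfl⟩
  obtain ⟨q, hq⟩ : ∃ p, p = la 1 := ⟨_, rfl⟩
  obtain ⟨r, hr⟩ : ∃ p, p = lb 0 := ⟨_, rfl⟩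
  obtain ⟨s, hs⟩ : ∃ p, p = lb 1 := ⟨_, rfl⟩
  obtain ⟨L, hL'⟩ : ∃ p, p = a 1 - b 1 := ⟨_, rfl⟩
  obtain ⟨M, hM'⟩ : ∃ p, p = b 0 - a 0 := ⟨_, rfl⟩
  rw [← hp] at h1 h3 ha1 ha2
  rw [← hq] at h2 h3 ha1 ha2
  rw [← hr] at h4 h6 hb1 hb2
  rw [← hs] at h5 h6 hb1 hb2
  rw [← hL', ← hM'] at hb hb' ⊢
  rw [← hL'] at hL
  rw [← hM'] at hM
  have da : 0 ≤ p * (z 0 - a 0) + q * (z 1 - a 1) := by linarith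
  have db : 0 ≤ r * (z 0 - b 0) + s * (z 1 - b 1) := by linarith
  have ca : 0 ≤ p * M - q * L := by rw [hM', hL']; linarith
  have cb : 0 ≤ s * L - r * M := by rw [hM', hL']; linarith
  -- Cramer's rule: the displacement of `z` from an end is expressed through the weight at that end
  -- and the weight of the chord. The determinant `p * M - q * L` is the excess of `b` over `a` in
  -- the weight `la`.
  have i1 : (z 0 - a 0) * (p * M - q * L)
      = M * (p * (z 0 - a 0) + q * (z 1 - a 1)) + q * -(L * (z 0 - a 0) + M * (z 1 - a 1)) := by
    ring
  have i2 : (a 1 - z 1) * (p * M - q * L)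
      = L * (p * (z 0 - a 0) + q * (z 1 - a 1)) + p * -(L * (z 0 - a 0) + M * (z 1 - a 1)) := by
    ring
  have i3 : (z 1 - b 1) * (s * L - r * M)
      = L * (r * (z 0 - b 0) + s * (z 1 - b 1)) + r * -(L * (z 0 - b 0) + M * (z 1 - b 1)) := by
    ring
  have i4 : (b 0 - z 0) * (s * L - r * M)
      = M * (r * (z 0 - b 0) + s * (z 1 - b 1)) + s * -(L * (z 0 - b 0) + M * (z 1 - b 1)) := by
    ring
  have na := neg_pos.2 hb
  have nb := neg_pos.2 hb'
  -- A vanishing determinant would make the sum of the right sides of `i1` and `i2` zero, although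
  -- it is at least `(p + q)` times the positive depth below the chord.
  have ca' : 0 < p * M - q * L := by
    refine lt_of_le_of_ne ca fun h0 => ?_
    rw [← h0, mul_zero] at i1 i2
    have := mul_pos h3 na
    nlinarith [mul_nonneg hM da, mul_nonneg hL da]
  have cb' : 0 < s * L - r * M := by
    refine lt_of_le_of_ne cb fun h0 => ?_
    rw [← h0, mul_zero] at i3 i4
    have := mul_pos h6 nb
    nlinarith [mul_nonneg hM db, mul_nonneg hL db]
  refine ⟨?_, ?_, ?_, ?_, ?_, ?_⟩
  · exact sub_nonneg.1 (nonneg_of_mul_nonneg_left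
      (i1 ▸ add_nonneg (mul_nonneg hM da) (mul_nonneg h2 na.le)) ca')
  · exact sub_nonneg.1 (nonneg_of_mul_nonneg_left
      (i4 ▸ add_nonneg (mul_nonneg hM db) (mul_nonneg h5 nb.le)) cb')
  · exact sub_nonneg.1 (nonneg_of_mul_nonneg_left
      (i3 ▸ add_nonneg (mul_nonneg hL db) (mul_nonneg h4 nb.le)) cb')
  · exact sub_nonneg.1 (nonneg_of_mul_nonneg_left
      (i2 ▸ add_nonneg (mul_nonneg hL da) (mul_nonneg h1 na.le)) ca')
  · refine lt_of_le_of_ne hL fun h0 => ?_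
    rw [← h0] at cb'
    nlinarith [mul_nonneg h4 hM]
  · refine lt_of_le_of_ne hM fun h0 => ?_
    rw [← h0] at ca'
    nlinarith [mul_nonneg h2 hL]

variable {y : Pt}

/-- The weight of the old chord, positive by `box`, supports the new point in both halves. -/
theorem split (h : Chord P a b la lb) (hy : P.IsWSOptimal (daWeight a b) y) (hb : Below a b y) :
    Chord P a y la (daWeight a b) ∧ Chord P y b (daWeight a b) lb := by
  obtain ⟨x1, x2, x3, x4, x5, x6⟩ := h.box hy.1 hb
  have w := h.weight
  have w0 : daWeight a b 0 = a 1 - b 1 := by rw [w]; rfl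
  have w1 : daWeight a b 1 = b 0 - a 0 := by rw [w]; rfl
  exact ⟨⟨h.opt_left, hy, h.left0, h.left1, h.left_pos, w0 ▸ x5.le, w1 ▸ x6.le,
      by rw [w0, w1]; exact add_pos x5 x6, x1, x4⟩,
    ⟨hy, h.opt_right, w0 ▸ x5.le, w1 ▸ x6.le, by rw [w0, w1]; exact add_pos x5 x6,
      h.right0, h.right1, h.right_pos, x2, x3⟩⟩

theorem weight_le (h : Chord P a b la lb) (hy : P.IsWSOptimal (daWeight a b) y) {e : Pt}
    (he : e ∈ P.Y) : 0 ≤ (a 1 - b 1) * (e 0 - y 0) + (b 0 - a 0) * (e 1 - y 1) := by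
  have := hy.2 e he
  rw [h.weight, dot_eq, dot_eq] at this
  simp only [Matrix.cons_val_zero, Matrix.cons_val_one] at this
  linarith

/-- Compare slopes at `a`: since `y` is below the chord from `a` to `b`, a point in the box of `a`
and `y` that is below the chord from `a` to `y` is even further down. -/
theorem below_of_left (h : Chord P a b la lb) (hy : P.IsWSOptimal (daWeight a b) y)
    (hb : Below a b y) {e : Pt} (he : e ∈ P.Y) (hae : Below a y e) : Below a b e := by
  obtain ⟨x1, x2, x3, x4, x5, x6⟩ := h.box hy.1 hb
  obtain ⟨z1, z2, z3, z4, z5, z6⟩ := (h.split hy hb).1.box he hae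
  by_contra hcon
  unfold Below at *
  have key : (b 0 - a 0) * ((y 0 - a 0) * (a 1 - e 1)) ≤
      (b 0 - a 0) * ((a 1 - y 1) * (e 0 - a 0)) := by
    nlinarith [mul_le_mul_of_nonneg_right (not_lt.1 hcon) z6.le,
      mul_le_mul_of_nonneg_right hb.le (sub_nonneg.2 z1)]
  have := le_of_mul_le_mul_left key x6
  linarith

theorem below_of_right (h : Chord P a b la lb) (hy : P.IsWSOptimal (daWeight a b) y)
    (hb : Below a b y) {e : Pt} (he : e ∈ P.Y) (hae : Below y b e) : Below a b e := by
  obtain ⟨x1, x2, x3, x4, x5, x6⟩ := h.box hy.1 hb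
  obtain ⟨z1, z2, z3, z4, z5, z6⟩ := (h.split hy hb).2.box he hae
  by_contra hcon
  unfold Below at *
  have c1 : 0 ≤ (a 1 - b 1) * (e 0 - b 0) + (b 0 - a 0) * (e 1 - b 1) := by linarith
  have c2 : (a 1 - b 1) * (y 0 - b 0) + (b 0 - a 0) * (y 1 - b 1) ≤ 0 := by linarith
  have key : (a 1 - b 1) * ((y 1 - b 1) * (b 0 - e 0)) ≤
      (a 1 - b 1) * ((b 0 - y 0) * (e 1 - b 1)) := by
    nlinarith [mul_le_mul_of_nonneg_right c1 z5.le,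
      mul_le_mul_of_nonneg_right c2 (sub_nonneg.2 z3)]
  have := le_of_mul_le_mul_left key x5
  linarith

end Chord

/-- Minimality gives equality if `a` or `b` dominates `e`. Otherwise `e` is strictly lower than `a`
and strictly left of `b`, and the last clause of `IsVertex` says that it is below the line, apart
from the easy cases of a shared coordinate. -/
theorem IsVertex.eq_or_eq_or_below {A : Set Pt} {a b e : Pt} (he : IsVertex A e) (ha : a ∈ A)
    (hb : b ∈ A) (h0 : a 0 ≤ e 0) (h1 : b 1 ≤ e 1) : e = a ∨ e = b ∨ Below a b e := by
  by_cases hea : a 1 ≤ e 1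
  · exact Or.inl (he.2.1 a ha ((pt_le_iff _ _).2 ⟨h0, hea⟩)).symm
  by_cases heb : b 0 ≤ e 0
  · exact Or.inr (Or.inl (he.2.1 b hb ((pt_le_iff _ _).2 ⟨heb, h1⟩)).symm)
  push Not at hea heb
  refine Or.inr (Or.inr ?_)
  unfold Below
  rcases h0.lt_or_eq with h0 | h0
  · rcases h1.lt_or_eq with h1 | h1
    · have := he.2.2 a ha b hb h0 h1
      linarith
    · have := mul_pos (sub_pos.2 hea) (sub_pos.2 heb)
      rw [h1]
      linarith
  · have := mul_pos (sub_pos.2 hea) (sub_pos.2 heb)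
    rw [h0]
    linarith

namespace Chord

variable {P : Instance} {a b la lb y : Pt}

/-- Optimality of `y` for the positive chord weight excludes that `e` is strictly to the left of and
below `y`. So `e` lies in the quadrant of one of the new chords, where `IsVertex.eq_or_eq_or_below`
applies. -/
theorem cover (h : Chord P a b la lb) (hy : P.IsWSOptimal (daWeight a b) y) (hb : Below a b y)
    {e : Pt} (he : IsVertex P.Y e) (hbe : Below a b e) : e = y ∨ Below a y e ∨ Below y b e := by
  obtain ⟨x1, x2, x3, x4, x5, x6⟩ := h.box he.1 hbe
  have hle := h.weight_le hy he.1
  have hna : e ≠ a := by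
    rintro rfl
    simp [Below] at hbe
  have hnb : e ≠ b := by
    rintro rfl
    unfold Below at hbe
    linarith
  by_cases h1 : y 1 ≤ e 1
  · rcases he.eq_or_eq_or_below h.opt_left.1 hy.1 x1 h1 with h | h | h
    · exact absurd h hna
    · exact Or.inl h
    · exact Or.inr (Or.inl h)
  · have h0 : y 0 ≤ e 0 := by
      by_contra h0
      push Not at h0 h1
      nlinarith [mul_pos x5 (sub_pos.2 h0), mul_pos x6 (sub_pos.2 h1)]
    rcases he.eq_or_eq_or_below hy.1 h.opt_right.1 h0 x3 with h | h | h
    · exact Or.inl h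
    · exact absurd h hnb
    · exact Or.inr (Or.inr h)

/-- The boxes of the two new chords meet only in `y`, which lies on both chords. -/
theorem not_below_both (h : Chord P a b la lb) (hy : P.IsWSOptimal (daWeight a b) y)
    (hb : Below a b y) {e : Pt} (he : e ∈ P.Y) (h1 : Below a y e) (h2 : Below y b e) : False := by
  obtain ⟨x1, x2, x3, x4, x5, x6⟩ := (h.split hy hb).1.box he h1
  obtain ⟨z1, z2, z3, z4, z5, z6⟩ := (h.split hy hb).2.box he h2
  have e0 : e 0 = y 0 := le_antisymm x2 z1
  have e1 : e 1 = y 1 := le_antisymm z4 x3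
  unfold Below at h2
  rw [e0, e1] at h2
  simp at h2

/-- A new point is a vertex, or there are vertices below both new chords. -/
theorem exists_vertices (h : Chord P a b la lb) (hy : P.IsWSOptimal (daWeight a b) y)
    (hb : Below a b y) : IsVertex P.Y y ∨
      (∃ u, IsVertex P.Y u ∧ Below a y u) ∧ ∃ v, IsVertex P.Y v ∧ Below y b v := by
  obtain ⟨x1, x2, x3, x4, x5, x6⟩ := h.box hy.1 hb
  by_cases hv : IsVertex P.Y y
  · exact Or.inl hv
  right
  have w0 : daWeight a b 0 = a 1 - b 1 := by rw [h.weight]; rfl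
  have w1 : daWeight a b 1 = b 0 - a 0 := by rw [h.weight]; rfl
  have p0 : 0 < daWeight a b 0 := w0 ▸ x5
  have p1 : 0 < daWeight a b 1 := w1 ▸ x6
  -- `u` and `v` are vertices on the line through `y` parallel to the chord. As `y` is no vertex,
  -- they lie strictly on either side of it, hence strictly below the new chords.
  obtain ⟨u, hu, hul, hu0⟩ := exists_vertex_le P.finite_Y hy.1 p0 p1 hy.2
  obtain ⟨v, hv', hvl, hv0⟩ := exists_vertex_ge P.finite_Y hy.1 p0 p1 hy.2
  rw [dot_eq, dot_eq, w0, w1] at hul hvl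
  have ne0 : ∀ z, IsVertex P.Y z → (a 1 - b 1) * z 0 + (b 0 - a 0) * z 1
      = (a 1 - b 1) * y 0 + (b 0 - a 0) * y 1 → z 0 ≠ y 0 := by
    intro z hz hzl h0
    rw [h0] at hzl
    have h1 : z 1 = y 1 := mul_left_cancel₀ x6.ne' (by linarith)
    exact hv ((pt_ext_iff z y).2 ⟨h0, h1⟩ ▸ hz)
  have hu0' := lt_of_le_of_ne hu0 (ne0 u hu hul)
  have hv0' := lt_of_le_of_ne hv0 (ne0 v hv' hvl).symm
  unfold Below at hb
  refine ⟨⟨u, hu, ?_⟩, ⟨v, hv', ?_⟩⟩ <;> unfold Below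
  · have : (b 0 - a 0) * ((a 1 - y 1) * (u 0 - a 0) + (y 0 - a 0) * (u 1 - a 1)) =
        (y 0 - u 0) * ((a 1 - b 1) * (y 0 - a 0) + (b 0 - a 0) * (y 1 - a 1)) := by
      linear_combination (y 0 - a 0) * hul
    have : (b 0 - a 0) * ((a 1 - y 1) * (u 0 - a 0) + (y 0 - a 0) * (u 1 - a 1)) < 0 :=
      this ▸ mul_neg_of_pos_of_neg (sub_pos.2 hu0') hb
    exact neg_of_mul_neg_right this x6.le
  · have : (b 0 - a 0) * ((y 1 - b 1) * (v 0 - y 0) + (b 0 - y 0) * (v 1 - y 1)) =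
        (v 0 - y 0) * ((a 1 - b 1) * (y 0 - a 0) + (b 0 - a 0) * (y 1 - a 1)) := by
      linear_combination (b 0 - y 0) * hvl
    have : (b 0 - a 0) * ((y 1 - b 1) * (v 0 - y 0) + (b 0 - y 0) * (v 1 - y 1)) < 0 :=
      this ▸ mul_neg_of_pos_of_neg (sub_pos.2 hv0') hb
    exact neg_of_mul_neg_right this x6.le

end Chord

/-! ## Invariants of the Dichotomic Approach -/

open Classical in
/-- The vertices strictly below the line through a pair of points. -/
noncomputable def belowSet (P : Instance) (p : Pt × Pt) : Finset Pt :=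
  P.vertices.filter fun e => daWeight p.1 p.2 ⬝ᵥ e < daWeight p.1 p.2 ⬝ᵥ p.1

/-- A bound for the number of iterations that are caused by a pair in the queue. -/
noncomputable def potential (P : Instance) (p : Pt × Pt) : ℕ :=
  max 1 (4 * (belowSet P p).card - 1)

/-- The pairs in the queue, up to their orientation. -/
def IsPair (P : Instance) (p : Pt × Pt) : Prop :=
  ∃ la lb, Chord P p.1 p.2 la lb ∨ Chord P p.2 p.1 la lb

theorem Chord.mem_belowSet {P : Instance} {a b la lb : Pt} (h : Chord P a b la lb) (e : Pt) :
    e ∈ belowSet P (a, b) ↔ IsVertex P.Y e ∧ Below a b e := by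
  rw [belowSet, Finset.mem_filter, P.mem_vertices, h.below_iff]

theorem Chord.belowSet_swap {P : Instance} {a b la lb : Pt} (h : Chord P a b la lb) :
    belowSet P (b, a) = belowSet P (a, b) := by
  unfold belowSet
  simp only [daWeight_comm b a, h.weight_dot_eq]

theorem Chord.potential_swap {P : Instance} {a b la lb : Pt} (h : Chord P a b la lb) :
    potential P (b, a) = potential P (a, b) := by
  rw [potential, h.belowSet_swap, potential]

/-- The constants are forced. A chord with nothing below still costs one scalarization, hence the
maximum with `1`. If `y` is the only vertex below, `1 + 1 + 1 ≤ 4 * 1 - 1` is needed. If `y` is no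
vertex, `(4 k₁ - 1) + (4 k₂ - 1) + 1 = 4 (k₁ + k₂) - 1` can be attained. -/
theorem Chord.potential_add {P : Instance} {a b la lb y : Pt} (h : Chord P a b la lb)
    (hy : P.IsWSOptimal (daWeight a b) y) (hb : Below a b y) :
    potential P (a, y) + potential P (y, b) + 1 ≤ potential P (a, b) := by
  classical
  obtain ⟨hl, hr⟩ := h.split hy hb
  have sub1 : belowSet P (a, y) ⊆ belowSet P (a, b) := fun e he => by
    rw [hl.mem_belowSet] at he
    exact (h.mem_belowSet e).2 ⟨he.1, h.below_of_left hy hb he.1.1 he.2⟩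
  have sub2 : belowSet P (y, b) ⊆ belowSet P (a, b) := fun e he => by
    rw [hr.mem_belowSet] at he
    exact (h.mem_belowSet e).2 ⟨he.1, h.below_of_right hy hb he.1.1 he.2⟩
  have disj : Disjoint (belowSet P (a, y)) (belowSet P (y, b)) := by
    rw [Finset.disjoint_left]
    intro e h1 h2
    rw [hl.mem_belowSet] at h1
    rw [hr.mem_belowSet] at h2
    exact h.not_below_both hy hb h1.1.1 h1.2 h2.2
  unfold potential
  rcases h.exists_vertices hy hb with hv | ⟨⟨u, hu, hu'⟩, ⟨v, hv, hv'⟩⟩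
  · have hsub : insert y (belowSet P (a, y) ∪ belowSet P (y, b)) ⊆ belowSet P (a, b) :=
      Finset.insert_subset ((h.mem_belowSet y).2 ⟨hv, hb⟩) (Finset.union_subset sub1 sub2)
    have hy' : y ∉ belowSet P (a, y) ∪ belowSet P (y, b) := by
      rw [Finset.mem_union, hl.mem_belowSet, hr.mem_belowSet]
      rintro (⟨_, h⟩ | ⟨_, h⟩)
      · unfold Below at h
        linarith
      · simp [Below] at h
    have := Finset.card_le_card hsub
    rw [Finset.card_insert_of_notMem hy', Finset.card_union_of_disjoint disj] at this
    omega
  · have := Finset.card_le_card (Finset.union_subset sub1 sub2)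
    rw [Finset.card_union_of_disjoint disj] at this
    have c1 := Finset.card_pos.2 ⟨u, (hl.mem_belowSet u).2 ⟨hu, hu'⟩⟩
    have c2 := Finset.card_pos.2 ⟨v, (hr.mem_belowSet v).2 ⟨hv, hv'⟩⟩
    omega

theorem IsPair.dot_eq {P : Instance} {p : Pt × Pt} (h : IsPair P p) :
    daWeight p.1 p.2 ⬝ᵥ p.1 = daWeight p.1 p.2 ⬝ᵥ p.2 := by
  obtain ⟨la, lb, h | h⟩ := h
  · exact h.weight_dot_eq
  · rw [daWeight_comm]; exact h.weight_dot_eq.symm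

theorem IsPair.mem {P : Instance} {p : Pt × Pt} (h : IsPair P p) : p.1 ∈ P.Y ∧ p.2 ∈ P.Y := by
  obtain ⟨la, lb, h | h⟩ := h
  · exact ⟨h.opt_left.1, h.opt_right.1⟩
  · exact ⟨h.opt_right.1, h.opt_left.1⟩

/-- Both new pairs are queued with `y` first, so one of them is always reversed as a chord. The
conclusions are the chord lemmas up to this swap. -/
theorem IsPair.discover {P : Instance} {p : Pt × Pt} (h : IsPair P p) {y : Pt}
    (hy : P.IsWSOptimal (daWeight p.1 p.2) y)
    (hlt : daWeight p.1 p.2 ⬝ᵥ y < daWeight p.1 p.2 ⬝ᵥ p.1) :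
    IsPair P (y, p.1) ∧ IsPair P (y, p.2) ∧
      potential P (y, p.1) + potential P (y, p.2) + 1 ≤ potential P p ∧
      ∀ e ∈ belowSet P p, e = y ∨ e ∈ belowSet P (y, p.1) ∨ e ∈ belowSet P (y, p.2) := by
  obtain ⟨a, b⟩ := p
  obtain ⟨la, lb, h | h⟩ := h
  · simp only at h hy hlt ⊢
    have hb := (h.below_iff y).1 hlt
    obtain ⟨hl, hr⟩ := h.split hy hb
    refine ⟨⟨_, _, Or.inr hl⟩, ⟨_, _, Or.inl hr⟩, ?_, ?_⟩
    · rw [hl.potential_swap]; exact h.potential_add hy hb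
    · intro e he
      rw [h.mem_belowSet] at he
      rw [hl.belowSet_swap, hl.mem_belowSet, hr.mem_belowSet]
      rcases h.cover hy hb he.1 he.2 with h | h | h
      · exact Or.inl h
      · exact Or.inr (Or.inl ⟨he.1, h⟩)
      · exact Or.inr (Or.inr ⟨he.1, h⟩)
  · simp only at h hy hlt ⊢
    rw [daWeight_comm] at hy hlt
    rw [← h.weight_dot_eq] at hlt
    have hb := (h.below_iff y).1 hlt
    obtain ⟨hl, hr⟩ := h.split hy hb
    refine ⟨⟨_, _, Or.inl hr⟩, ⟨_, _, Or.inr hl⟩, ?_, ?_⟩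
    · rw [hl.potential_swap, h.potential_swap, add_comm (potential P (y, a))]
      exact h.potential_add hy hb
    · intro e he
      rw [h.belowSet_swap, h.mem_belowSet] at he
      rw [hl.belowSet_swap, hl.mem_belowSet, hr.mem_belowSet]
      rcases h.cover hy hb he.1 he.2 with h | h | h
      · exact Or.inl h
      · exact Or.inr (Or.inr ⟨he.1, h⟩)
      · exact Or.inr (Or.inl ⟨he.1, h⟩)

/-- The invariant of the Dichotomic Approach. -/
structure DAInv (P : Instance) (s : DAState) : Prop where
  found_mem : ∀ y ∈ s.found, y ∈ P.Y
  pairs : ∀ p ∈ s.queue, IsPair P p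
  cover : ∀ e, IsVertex P.Y e → e ∈ s.found ∨ ∃ p ∈ s.queue, e ∈ belowSet P p
  -- Each scalarization after the first two is paid for by a drop of the total potential; the first
  -- two account for the summand `2`.
  bound : s.log.length + (s.queue.map (potential P)).sum ≤ 4 * P.vertices.card + 2
  log_mem : ∀ e ∈ s.log, e.2 ∈ P.Y ∧
    (e.1 = ![1, 0] ∨ e.1 = ![0, 1] ∨ ∃ a ∈ P.Y, ∃ b ∈ P.Y, e.1 = daWeight a b)

/-! ### Preservation of the invariant and its consequences -/

theorem potential_le (P : Instance) (p : Pt × Pt) (h : 0 < P.vertices.card) :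
    potential P p ≤ 4 * P.vertices.card := by
  have : (belowSet P p).card ≤ P.vertices.card := by
    unfold belowSet
    exact Finset.card_filter_le _ _
  unfold potential
  omega

theorem unit_zero_dot (y : Pt) : (![1, 0] : Pt) ⬝ᵥ y = y 0 := by
  rw [dot_eq]; simp

theorem unit_one_dot (y : Pt) : (![0, 1] : Pt) ⬝ᵥ y = y 1 := by
  rw [dot_eq]; simp

theorem chord_init {P : Instance} {a b : Pt} (h0 : P.IsWSOptimal ![1, 0] a)
    (h1 : P.IsWSOptimal ![0, 1] b) : Chord P a b ![1, 0] ![0, 1] := by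
  refine ⟨h0, h1, by simp, by simp, by simp, by simp, by simp, by simp, ?_, ?_⟩
  · simpa only [unit_zero_dot] using h0.2 b h1.1
  · simpa only [unit_one_dot] using h1.2 a h0.1

theorem DAInit.inv {P : Instance} {s : DAState} (h : DAInit P s) : DAInv P s := by
  obtain ⟨a, b, h0, h1⟩ := h
  have hc := chord_init h0 h1
  have hpos : 0 < P.vertices.card := by
    obtain ⟨x, hx, _⟩ := h0.1
    exact P.vertices_card_pos ⟨x, hx⟩
  constructor
  · intro y hy
    simp only [Finset.mem_insert, Finset.mem_singleton] at hy
    rcases hy with rfl | rfl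
    · exact h0.1
    · exact h1.1
  · intro p hp
    dsimp only at hp
    split_ifs at hp
    · simp at hp
    · simp only [List.mem_singleton] at hp
      subst hp
      exact ⟨_, _, Or.inl hc⟩
  · intro e he
    have e0 : a 0 ≤ e 0 := by simpa only [unit_zero_dot] using h0.2 e he.1
    have e1 : b 1 ≤ e 1 := by simpa only [unit_one_dot] using h1.2 e he.1
    dsimp only
    rcases he.eq_or_eq_or_below h0.1 h1.1 e0 e1 with h | h | h
    · left; simp [h]
    · left; simp [h]
    · right
      have hab : a ≠ b := by
        rintro rfl
        simp [Below] at h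
      rw [if_neg hab]
      exact ⟨_, List.mem_singleton.2 rfl, (hc.mem_belowSet e).2 ⟨he, h⟩⟩
  · dsimp only
    split_ifs
    · simp
    · have := potential_le P (a, b) hpos
      simp
      omega
  · intro e he
    simp only [List.mem_cons, List.not_mem_nil, or_false] at he
    rcases he with rfl | rfl
    · exact ⟨h0.1, Or.inl rfl⟩
    · exact ⟨h1.1, Or.inr (Or.inl rfl)⟩

/-- The test of the Dichotomic Approach amounts to a strict inequality. -/
theorem IsPair.test_iff {P : Instance} {p : Pt × Pt} (h : IsPair P p) {y : Pt}
    (hy : P.IsWSOptimal (daWeight p.1 p.2) y) :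
    ¬ (daWeight p.1 p.2 ⬝ᵥ p.1 = daWeight p.1 p.2 ⬝ᵥ y ∧
        daWeight p.1 p.2 ⬝ᵥ y = daWeight p.1 p.2 ⬝ᵥ p.2) ↔
      daWeight p.1 p.2 ⬝ᵥ y < daWeight p.1 p.2 ⬝ᵥ p.1 := by
  rw [← h.dot_eq, (hy.2 p.1 h.mem.1).lt_iff_ne]
  exact ⟨fun hn he => hn ⟨he.symm, he⟩, fun hn he => hn he.2⟩

theorem DAStep.inv {P : Instance} {s s' : DAState} (h : DAStep P s s') (hs : DAInv P s) :
    DAInv P s' := by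
  obtain ⟨a, b, y, Q, A, L, hopt, hy⟩ | ⟨a, b, y, Q, A, L, hopt, hy⟩ := h
  · have hp := hs.pairs (a, b) (by simp)
    -- The optimal value is already attained on the chord, so nothing lies below it and dropping the
    -- pair loses no vertex.
    have hempty : belowSet P (a, b) = ∅ := by
      rw [Finset.eq_empty_iff_forall_notMem]
      intro e he
      rw [belowSet, Finset.mem_filter, P.mem_vertices] at he
      dsimp only at he
      have := hopt.2 e he.1.1
      rw [← hy.1] at this
      exact absurd he.2 (not_lt.2 this)
    refine ⟨hs.found_mem, fun p hp => hs.pairs p (List.mem_cons_of_mem _ hp), ?_, ?_, ?_⟩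
    · intro e he
      rcases hs.cover e he with h | ⟨p, hp, h⟩
      · exact Or.inl h
      · rcases List.mem_cons.1 hp with rfl | hp
        · rw [hempty] at h
          simp at h
        · exact Or.inr ⟨p, hp, h⟩
    · have := hs.bound
      have h1 : 1 ≤ potential P (a, b) := le_max_left _ _
      simp only [List.map_cons, List.sum_cons, List.length_append, List.length_singleton] at this ⊢
      omega
    · intro e he
      rcases List.mem_append.1 he with he | he
      · exact hs.log_mem e he
      · simp only [List.mem_singleton] at he
        subst he
        exact ⟨hopt.1, Or.inr (Or.inr ⟨a, hp.mem.1, b, hp.mem.2, rfl⟩)⟩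
  · have hp := hs.pairs (a, b) (by simp)
    have hlt := (hp.test_iff hopt).1 hy
    obtain ⟨p1, p2, hpot, hcov⟩ := hp.discover hopt hlt
    refine ⟨?_, ?_, ?_, ?_, ?_⟩
    · intro z hz
      rcases Finset.mem_insert.1 hz with rfl | hz
      · exact hopt.1
      · exact hs.found_mem z hz
    · intro p hq
      rcases List.mem_append.1 hq with hq | hq
      · exact hs.pairs p (List.mem_cons_of_mem _ hq)
      · simp only [List.mem_cons, List.not_mem_nil, or_false] at hq
        rcases hq with rfl | rfl
        · exact p1
        · exact p2
    · intro e he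
      dsimp only
      rcases hs.cover e he with h | ⟨p, hq, h⟩
      · exact Or.inl (Finset.mem_insert_of_mem h)
      · rcases List.mem_cons.1 hq with rfl | hq
        · rcases hcov e h with rfl | h | h
          · exact Or.inl (Finset.mem_insert_self _ _)
          · exact Or.inr ⟨_, by simp, h⟩
          · exact Or.inr ⟨(y, b), by simp, h⟩
        · exact Or.inr ⟨p, by simp [hq], h⟩
    · have := hs.bound
      simp only [List.map_cons, List.sum_cons, List.length_append, List.length_singleton,
        List.map_append, List.sum_append, List.map_nil, List.sum_nil] at this hpot ⊢
      omega
    · intro e he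
      rcases List.mem_append.1 he with he | he
      · exact hs.log_mem e he
      · simp only [List.mem_singleton] at he
        subst he
        exact ⟨hopt.1, Or.inr (Or.inr ⟨a, hp.mem.1, b, hp.mem.2, rfl⟩)⟩

theorem DAReach.inv {P : Instance} {s : DAState} (h : DAReach P s) : DAInv P s := by
  obtain ⟨s0, h0, hs⟩ := h
  induction hs with
  | refl => exact h0.inv
  | tail _ hstep ih => exact hstep.inv ih

theorem DAReach.step {P : Instance} {s s' : DAState} (h : DAReach P s) (h' : DAStep P s s') :
    DAReach P s' := by
  obtain ⟨s0, h0, hs⟩ := h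
  exact ⟨s0, h0, hs.tail h'⟩

/-- A feasible instance has at least one vertex, which absorbs the additive `2`. -/
theorem DAInv.log_length_le {P : Instance} {s : DAState} (h : DAInv P s) (hP : P.S.Nonempty) :
    s.log.length ≤ 6 * P.YX.ncard := by
  have := h.bound
  have := P.vertices_card_pos hP
  rw [P.ncard_YX]
  omega

theorem Instance.exists_isWSOptimal (P : Instance) (hP : P.S.Nonempty) (l : Pt) :
    ∃ y, P.IsWSOptimal l y := by
  obtain ⟨y, hy, h⟩ := Set.exists_min_image P.Y (fun y => l ⬝ᵥ y) P.finite_Y (hP.image _)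
  exact ⟨y, hy, h⟩

/-- With an empty queue the covering clause leaves every vertex among the points found, and a
feasible subset containing all vertices has the same vertices. -/
theorem DAInv.output_eq {P : Instance} {s : DAState} (h : DAInv P s) (hq : s.queue = []) :
    toReal '' daOutput s.found = P.YX := by
  rw [daOutput_eq, P.YX_eq]
  congr 1
  ext y
  refine isVertex_iff_of_subset P.finite_Y h.found_mem (fun e he => ?_) y
  rcases h.cover e he with h | ⟨p, hp, _⟩
  · exact h
  · rw [hq] at hp
    simp at hp

theorem exists_daStep {P : Instance} (hP : P.S.Nonempty) {s : DAState} (hs : s.queue ≠ []) :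
    ∃ s', DAStep P s s' := by
  obtain ⟨Q, A, L⟩ := s
  match Q, hs with
  | (a, b) :: Q, _ =>
    obtain ⟨y, hy⟩ := P.exists_isWSOptimal hP (daWeight a b)
    by_cases ht : daWeight a b ⬝ᵥ a = daWeight a b ⬝ᵥ y ∧ daWeight a b ⬝ᵥ y = daWeight a b ⬝ᵥ b
    · exact ⟨_, .neglect a b y Q A L hy ht⟩
    · exact ⟨_, .discover a b y Q A L hy ht⟩

/-! ## Encoding lengths -/

theorem encInt_le_iff (z : ℤ) (k : ℕ) : encInt z ≤ k + 1 ↔ z.natAbs < 2 ^ k := by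
  rw [encInt, add_comm, Nat.add_le_add_iff_right, Nat.clog_le_iff_le_pow (by norm_num)]
  rfl

/-- The sum of the numerator and the denominator. -/
def ratHeight (q : ℚ) : ℕ := q.num.natAbs + q.den

theorem ratHeight_pos (q : ℚ) : 0 < ratHeight q := Nat.add_pos_right _ q.pos

theorem ratHeight_le_pow (q : ℚ) : ratHeight q ≤ 2 ^ encRat q := by
  have h1 := (encInt_le_iff q.num (Nat.clog 2 (q.num.natAbs + 1))).1 (by rw [encInt, add_comm])
  have h2 := (encInt_le_iff (q.den : ℤ) (Nat.clog 2 (q.den + 1))).1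
    (by rw [encInt, add_comm]; simp)
  rw [Int.natAbs_natCast] at h2
  have h3 : 2 ^ Nat.clog 2 (q.num.natAbs + 1) * 2 ^ Nat.clog 2 (q.den + 1) ≤ 2 ^ encRat q := by
    rw [← pow_add]
    apply Nat.pow_le_pow_right (by norm_num)
    simp only [encRat, encInt, Int.natAbs_natCast]
    omega
  have h4 : (q.num.natAbs + 1) * (q.den + 1) ≤ _ :=
    Nat.mul_le_mul (Nat.succ_le_of_lt h1) (Nat.succ_le_of_lt h2)
  have h5 := h4.trans h3
  have h6 := Nat.zero_le (q.num.natAbs * q.den)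
  unfold ratHeight
  linarith

theorem encRat_le {q : ℚ} {k : ℕ} (h : ratHeight q ≤ 2 ^ k) : encRat q ≤ 2 * k + 3 := by
  unfold ratHeight at h
  have hd := q.pos
  have h1 := (encInt_le_iff q.num k).2 (by omega)
  have h2 := (encInt_le_iff (q.den : ℤ) (k + 1)).2 (by
    rw [Int.natAbs_natCast, pow_succ]; omega)
  unfold encRat
  omega

theorem ratHeight_div_le (a : ℤ) (b : ℤ) (hb : b ≠ 0) :
    ratHeight ((a : ℚ) / b) ≤ a.natAbs + b.natAbs := by
  rw [← Rat.divInt_eq_div]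
  by_cases ha : a = 0
  · subst ha
    simp only [Rat.zero_divInt, ratHeight, Rat.num_zero, Rat.den_zero]
    have := Int.natAbs_pos.2 hb
    simp
    omega
  · apply Nat.add_le_add
    · exact Nat.le_of_dvd (Int.natAbs_pos.2 ha) (Int.natAbs_dvd_natAbs.2 (Rat.num_dvd a hb))
    · have := Int.natAbs_dvd_natAbs.2 (Rat.den_dvd a b)
      rw [Int.natAbs_natCast] at this
      exact Nat.le_of_dvd (Int.natAbs_pos.2 hb) this

/-- Over the common denominator, numerator and denominator are bounded by three of the four terms of
the expanded product. Reduction of the fraction only decreases the height. -/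
theorem ratHeight_add_le (p q : ℚ) : ratHeight (p + q) ≤ ratHeight p * ratHeight q := by
  have h : p + q = ((p.num * q.den + q.num * p.den : ℤ) : ℚ) / ((p.den * q.den : ℤ) : ℚ) := by
    conv_lhs => rw [← Rat.num_div_den p, ← Rat.num_div_den q]
    have := p.den_nz
    have := q.den_nz
    push_cast
    field_simp
  have := p.pos
  have := q.pos
  rw [h]
  refine (ratHeight_div_le _ _ (by positivity)).trans ?_
  have h1 := Int.natAbs_add_le (p.num * q.den) (q.num * p.den)
  simp only [Int.natAbs_mul, Int.natAbs_natCast] at h1 ⊢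
  unfold ratHeight
  have := Nat.zero_le (p.num.natAbs * q.num.natAbs)
  nlinarith

theorem ratHeight_neg (q : ℚ) : ratHeight (-q) = ratHeight q := by
  simp [ratHeight]

theorem ratHeight_abs (q : ℚ) : ratHeight |q| = ratHeight q := by
  rcases abs_choice q with h | h <;> rw [h]
  exact ratHeight_neg q

theorem ratHeight_sum_le {ι : Type*} (s : Finset ι) (f : ι → ℚ) :
    ratHeight (∑ i ∈ s, f i) ≤ ∏ i ∈ s, ratHeight (f i) := by
  classical
  induction s using Finset.induction_on with
  | empty => simp [ratHeight]
  | insert a s ha ih =>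
    rw [Finset.sum_insert ha, Finset.prod_insert ha]
    exact (ratHeight_add_le _ _).trans (Nat.mul_le_mul le_rfl ih)

/-- A 0/1-vector selects entries of a row of `C`. Heights multiply while encoding lengths add, and
an omitted entry contributes height `1`. -/
theorem ratHeight_of_mem_Y {P : Instance} {y : Pt} (hy : y ∈ P.Y) (i : Fin 2) :
    ratHeight (y i) ≤ 2 ^ P.size := by
  obtain ⟨x, hx, rfl⟩ := hy
  simp only [Matrix.mulVec, dotProduct]
  refine (ratHeight_sum_le _ _).trans ?_
  calc ∏ j, ratHeight (P.C i j * x j) ≤ ∏ j, 2 ^ encRat (P.C i j) := by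
        apply Finset.prod_le_prod' fun j _ => ?_
        refine le_trans ?_ (ratHeight_le_pow _)
        rcases P.binary x hx j with h | h
        · rw [h, mul_zero]
          exact Nat.succ_le_of_lt (ratHeight_pos _)
        · rw [h, mul_one]
    _ = 2 ^ ∑ j, encRat (P.C i j) := Finset.prod_pow_eq_pow_sum _ _ _
    _ ≤ 2 ^ P.size := by
        apply Nat.pow_le_pow_right (by norm_num)
        have h1 : encVec (P.C i) ≤ ∑ i, encVec (P.C i) :=
          Finset.single_le_sum (f := fun i => encVec (P.C i)) (fun _ _ => Nat.zero_le _)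
            (Finset.mem_univ i)
        have h2 : ∑ j, encRat (P.C i j) ≤ encVec (P.C i) := Nat.le_add_left _ _
        unfold Instance.size encMat
        omega

theorem ratHeight_daWeight {P : Instance} {a b : Pt} (ha : a ∈ P.Y) (hb : b ∈ P.Y) (i : Fin 2) :
    ratHeight (daWeight a b i) ≤ 2 ^ (2 * P.size) := by
  have key : ∀ j, ratHeight (|a j - b j|) ≤ 2 ^ (2 * P.size) := by
    intro j
    rw [ratHeight_abs, sub_eq_add_neg, two_mul, pow_add]
    refine (ratHeight_add_le _ _).trans (Nat.mul_le_mul (ratHeight_of_mem_Y ha j) ?_)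
    rw [ratHeight_neg]
    exact ratHeight_of_mem_Y hb j
  fin_cases i
  · exact key 1
  · exact key 0

theorem encVec_le {l : Pt} {k : ℕ} (h : ∀ i, ratHeight (l i) ≤ 2 ^ k) : encVec l ≤ 4 * k + 8 := by
  have h0 := encRat_le (h 0)
  have h1 := encRat_le (h 1)
  simp only [encVec, Fin.sum_univ_two]
  omega

theorem DAInv.ratHeight_weight_le {P : Instance} {s : DAState} (h : DAInv P s) {e : Pt × Pt}
    (he : e ∈ s.log) (i : Fin 2) : ratHeight (e.1 i) ≤ 2 ^ (2 * P.size + 1) := by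
  -- The unit weights have an entry of height `2`; the extra `1` in the exponent covers them even
  -- for size `0`.
  have h2 : 2 ≤ 2 ^ (2 * P.size + 1) := by
    rw [pow_succ]
    have := Nat.one_le_two_pow (n := 2 * P.size)
    omega
  rcases (h.log_mem e he).2 with h | h | ⟨a, ha, b, hb, h⟩
  · rw [h]
    fin_cases i <;> simpa [ratHeight] using by omega
  · rw [h]
    fin_cases i <;> simpa [ratHeight] using by omega
  · rw [h]
    refine (ratHeight_daWeight ha hb i).trans (Nat.pow_le_pow_right (by norm_num) (by omega))

theorem DAInv.encVec_log_le {P : Instance} {s : DAState} (h : DAInv P s) {e : Pt × Pt}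
    (he : e ∈ s.log) : encVec e.1 ≤ 8 * P.size + 12 ∧ encVec e.2 ≤ 8 * P.size + 12 := by
  constructor
  · refine (encVec_le (h.ratHeight_weight_le he)).trans (by omega)
  · refine (encVec_le fun i => ratHeight_of_mem_Y (h.log_mem e he).1 i).trans (by omega)

/-- Correctness of the Dichotomic Approach, with a bound for the number of scalarizations and for
the encoding lengths. -/
theorem da_correct : ∃ (c : ℕ) (q : Polynomial ℕ), ∀ P : BOCO.Instance, P.S.Nonempty →
      (∃ s, DAInit P s) ∧
      ∀ s, DAReach P s →
        s.log.length ≤ c * P.YX.ncard ∧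
        (∀ e ∈ s.log, encVec e.1 ≤ q.eval P.size ∧ encVec e.2 ≤ q.eval P.size) ∧
        (s.queue ≠ [] → ∃ s', DAStep P s s') ∧
        (s.queue = [] → toReal '' daOutput s.found = P.YX) := by
  refine ⟨6, 8 * Polynomial.X + 12, fun P hP => ⟨?_, fun s hs => ⟨hs.inv.log_length_le hP, ?_,
    exists_daStep hP, hs.inv.output_eq⟩⟩⟩
  · obtain ⟨a, ha⟩ := P.exists_isWSOptimal hP ![1, 0]
    obtain ⟨b, hb⟩ := P.exists_isWSOptimal hP ![0, 1]
    exact ⟨_, .mk a b ha hb⟩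
  · intro e he
    simpa using hs.inv.encVec_log_le he

/-! ## Monotonicity of the machine model -/

theorem Exec.mono {wl wl' : ℕ} {sub : List ℤ → List ℤ → ℕ → Prop} {inp : List ℤ} (h : wl ≤ wl')
    {p : Prog} {s s' : RState} {t : ℕ} (he : Exec wl sub inp p s s' t) :
    Exec wl' sub inp p s s' t := by
  induction he with
  | skip s => exact .skip s
  | assign s i r hr => exact .assign s i r (hr.trans h)
  | store s i j => exact .store s i j
  | out s i => exact .out s i
  | call s a k b res u hsub hres => exact .call s a k b res u hsub fun z hz => (hres z hz).trans h
  | seq p q s s' s'' t u _ _ h1 h2 => exact .seq p q s s' s'' t u h1 h2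
  | ifTrue i p q s s' t hi _ h1 => exact .ifTrue i p q s s' t hi h1
  | ifFalse i p q s s' t hi _ h1 => exact .ifFalse i p q s s' t hi h1
  | whileTrue i p s s' s'' t u hi _ _ h1 h2 => exact .whileTrue i p s s' s'' t u hi h1 h2
  | whileFalse i p s hi => exact .whileFalse i p s hi

theorem Runs.mono {wl wl' : ℕ} (h : wl ≤ wl') {W : Prog} {inp res : List ℤ} {t : ℕ}
    (hr : Runs wl W inp res t) : Runs wl' W inp res t := by
  obtain ⟨s, hs, ho⟩ := hr
  exact ⟨s, hs.mono h, ho⟩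

/-! ## Expressions -/

/-- Arithmetic expressions with access to the memory. -/
inductive Ex
  | c (z : ℤ)
  | ld (e : Ex)
  | bin (o : Op) (a b : Ex)

namespace Ex

instance : Add Ex := ⟨bin .add⟩
instance : Sub Ex := ⟨bin .sub⟩
instance : Mul Ex := ⟨bin .mul⟩
instance : Div Ex := ⟨bin .div⟩

/-- The content of a fixed cell. -/
def v (i : ℕ) : Ex := ld (c i)

def eval (m : ℕ → ℤ) : Ex → ℤ
  | c z => z
  | ld e => m (e.eval m).toNat
  | bin o a b => o.eval (a.eval m) (b.eval m)

/-- All addresses that occur in the evaluation are nonnegative. -/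
def Ok (m : ℕ → ℤ) : Ex → Prop
  | c _ => True
  | ld e => 0 ≤ e.eval m ∧ e.Ok m
  | bin _ a b => a.Ok m ∧ b.Ok m

/-- A bound for the evaluation time; the values that occur are at most the power of the memory bound
with this exponent. -/
def sz : Ex → ℕ
  | c z => z.natAbs + 1
  | ld e => e.sz + 6
  | bin _ a b => a.sz + b.sz + 1

/-- The number of auxiliary cells for the evaluation. -/
def depth : Ex → ℕ
  | c _ => 1
  | ld e => max e.depth 2
  | bin _ a b => max a.depth (b.depth + 1)

/-- The first `32` cells are the auxiliary cells of the evaluation of expressions; expressions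
refer to the memory above. The value is written into the cell `d`. -/
def code : ℕ → Ex → Prog
  | d, c z => .assign d (.const z)
  | d, ld e => .seq (code d e) (.seq (.assign (d + 1) (.const 32))
      (.seq (.assign d (.op .add d (d + 1))) (.assign d (.load d))))
  | d, bin o a b => .seq (code d a) (.seq (code (d + 1) b) (.assign d (.op o d (d + 1))))

variable (m : ℕ → ℤ) (a b e : Ex)

@[simp] theorem eval_c (z : ℤ) : (c z).eval m = z := rfl
@[simp] theorem eval_ld : (ld e).eval m = m (e.eval m).toNat := rfl
@[simp] theorem eval_v (i : ℕ) : (v i).eval m = m i := by simp [v, eval]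
@[simp] theorem eval_add : (a + b).eval m = a.eval m + b.eval m := rfl
@[simp] theorem eval_sub : (a - b).eval m = a.eval m - b.eval m := rfl
@[simp] theorem eval_mul : (a * b).eval m = a.eval m * b.eval m := rfl
@[simp] theorem eval_div : (a / b).eval m = (a.eval m).fdiv (b.eval m) := rfl
@[simp] theorem ok_c (z : ℤ) : (c z).Ok m := trivial
@[simp] theorem ok_ld : (ld e).Ok m ↔ 0 ≤ e.eval m ∧ e.Ok m := Iff.rfl
@[simp] theorem ok_v (i : ℕ) : (v i).Ok m := by simp [v]
@[simp] theorem ok_add : (a + b).Ok m ↔ a.Ok m ∧ b.Ok m := Iff.rfl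
@[simp] theorem ok_sub : (a - b).Ok m ↔ a.Ok m ∧ b.Ok m := Iff.rfl
@[simp] theorem ok_mul : (a * b).Ok m ↔ a.Ok m ∧ b.Ok m := Iff.rfl
@[simp] theorem ok_div : (a / b).Ok m ↔ a.Ok m ∧ b.Ok m := Iff.rfl

/-- The indicator of positivity. -/
def pos : Ex := c 0 - (c 0 - e) / (e * e + c 1)

-- The quotient `-x / (x * x + 1)` lies in `[-1, 0)` for `x > 0` and in `[0, 1)` otherwise, so its
-- floor detects the sign.
@[simp] theorem eval_pos : (pos e).eval m = if 0 < e.eval m then 1 else 0 := by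
  simp only [pos, eval_sub, eval_c, eval_div, eval_add, eval_mul]
  generalize e.eval m = x
  have h1 : 0 < x * x + 1 := by nlinarith [mul_self_nonneg x]
  rw [Int.fdiv_eq_ediv_of_nonneg _ h1.le]
  split_ifs with h
  · have : (0 - x) / (x * x + 1) = -1 := by
      rw [Int.ediv_eq_iff_of_pos h1]
      constructor <;> nlinarith
    rw [this]; rfl
  · rw [Int.ediv_eq_zero_of_lt (by linarith) (by nlinarith)]; rfl

@[simp] theorem ok_pos : (pos e).Ok m ↔ e.Ok m := by
  simp [pos]

/-- The absolute value. -/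
def absE : Ex := e * (pos e * c 2 - c 1)

@[simp] theorem eval_absE : (absE e).eval m = |e.eval m| := by
  simp only [absE, eval_sub, eval_c, eval_mul, eval_pos]
  split_ifs with h
  · rw [abs_of_pos h]; ring
  · rw [abs_of_nonpos (not_lt.1 h)]; ring

@[simp] theorem ok_absE : (absE e).Ok m ↔ e.Ok m := by
  simp [absE]

end Ex

/-- All cells hold integers of absolute value less than `2 ^ k`. -/
def Bdd (k : ℕ) (m : ℕ → ℤ) : Prop := ∀ i, (m i).natAbs < 2 ^ k

theorem natAbs_fdiv_le (a b : ℤ) : (a.fdiv b).natAbs ≤ a.natAbs := by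
  rcases lt_trichotomy b 0 with h | h | h
  · obtain ⟨c, rfl⟩ : ∃ c, b = -c := ⟨-b, by ring⟩
    have hc : 0 < c := by linarith
    rw [← neg_neg a, Int.neg_fdiv_neg, Int.fdiv_eq_ediv_of_nonneg _ hc.le, neg_neg]
    have h1 := Int.ediv_mul_le (-a) hc.ne'
    have h2 := Int.lt_ediv_add_one_mul_self (-a) hc
    rcases le_total 0 a with h | h
    · have : -a ≤ -a / c := by
        rw [Int.le_ediv_iff_mul_le hc]; nlinarith
      have : -a / c ≤ 0 := Int.ediv_nonpos_of_nonpos_of_neg (by linarith) hc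
      omega
    · have := Int.ediv_le_self c (a := -a) (by linarith)
      have := Int.ediv_nonneg (a := -a) (by linarith) hc.le
      omega
  · subst h
    simp
  · rw [Int.fdiv_eq_ediv_of_nonneg _ h.le]
    rcases le_total a 0 with h' | h'
    · have : a ≤ a / b := by
        rw [Int.le_ediv_iff_mul_le h]; nlinarith
      have : a / b ≤ 0 := Int.ediv_nonpos_of_nonpos_of_neg h' h
      omega
    · have := Int.ediv_le_self b h'
      have := Int.ediv_nonneg h' h.le
      omega

/-- Exponents add for every operation; exponents of at least `1` make a sum of powers no larger than
their product. -/
theorem Op.natAbs_eval_lt (o : Op) {a b : ℤ} {i j : ℕ} (hi : 1 ≤ i) (hj : 1 ≤ j)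
    (ha : a.natAbs < 2 ^ i) (hb : b.natAbs < 2 ^ j) : (o.eval a b).natAbs < 2 ^ (i + j) := by
  have h2i : 2 ≤ 2 ^ i := by simpa using Nat.pow_le_pow_right (n := 2) (by norm_num) hi
  have h2j : 2 ≤ 2 ^ j := by simpa using Nat.pow_le_pow_right (n := 2) (by norm_num) hj
  have hsum : 2 ^ i + 2 ^ j ≤ 2 ^ (i + j) := by
    rw [pow_add]
    nlinarith
  cases o with
  | add =>
    have := Int.natAbs_add_le a b
    simp only [Op.eval]
    omega
  | sub =>
    have := Int.natAbs_sub_le a b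
    simp only [Op.eval]
    omega
  | mul =>
    simp only [Op.eval]
    rw [Int.natAbs_mul, pow_add]
    exact Nat.mul_lt_mul'' ha hb
  | div =>
    have := natAbs_fdiv_le a b
    simp only [Op.eval]
    have : 2 ^ i ≤ 2 ^ (i + j) := Nat.pow_le_pow_right (by norm_num) (by omega)
    omega

theorem Ex.one_le_sz (e : Ex) : 1 ≤ e.sz := by
  cases e <;> simp only [Ex.sz] <;> omega

theorem Ex.eval_lt {k : ℕ} (hk : 1 ≤ k) {m : ℕ → ℤ} (hm : Bdd k m) (e : Ex) :
    (e.eval m).natAbs < 2 ^ (k * e.sz) := by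
  induction e with
  | c z =>
    have h1 : z.natAbs < 2 ^ z.natAbs := Nat.lt_two_pow_self
    refine h1.trans_le (Nat.pow_le_pow_right (by norm_num) ?_)
    simp only [Ex.sz]
    exact (Nat.le_succ _).trans (Nat.le_mul_of_pos_left _ hk)
  | ld e ih =>
    refine (hm _).trans_le (Nat.pow_le_pow_right (by norm_num) ?_)
    simp only [Ex.sz]
    nlinarith
  | bin o a b iha ihb =>
    refine (Op.natAbs_eval_lt o (Nat.mul_pos hk a.one_le_sz) (Nat.mul_pos hk b.one_le_sz)
      iha ihb).trans_le (Nat.pow_le_pow_right (by norm_num) ?_)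
    simp only [Ex.sz]
    nlinarith

/-! ## Executions on the user memory -/

/-- A word length, a bound `2 ^ k` for the contents of the cells, a bound for the size of expressions,
a subroutine, and an input. -/
structure Machine where
  wl : ℕ
  k : ℕ
  K : ℕ
  sub : List ℤ → List ℤ → ℕ → Prop
  inp : List ℤ
  one_le : 1 ≤ k
  hwl : k * K + 1 ≤ wl

/-- The machine state `s` represents `u`, whose memory starts at cell `32`. -/
def Represents (s u : RState) : Prop :=
  (∀ i, s.mem (i + 32) = u.mem i) ∧ s.out = u.out ∧ s.log = u.log

namespace Machine

variable (M : Machine)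

theorem encInt_le {z : ℤ} {n : ℕ} (h : z.natAbs < 2 ^ (M.k * n)) (hn : n ≤ M.K) :
    encInt z ≤ M.wl :=
  ((encInt_le_iff z _).2 h).trans
    ((Nat.add_le_add_right (Nat.mul_le_mul_left _ hn) 1).trans M.hwl)

theorem natAbs_add_32_lt {z : ℤ} {n : ℕ} (h : z.natAbs < 2 ^ (M.k * n)) :
    (z + 32).natAbs < 2 ^ (M.k * (n + 6)) := by
  have h1 := Int.natAbs_add_le z 32
  have h2 : 1 ≤ 2 ^ (M.k * n) := Nat.one_le_two_pow
  have h3 : 2 ^ (M.k * n + 6) ≤ 2 ^ (M.k * (n + 6)) := by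
    apply Nat.pow_le_pow_right (by norm_num)
    have := M.one_le
    nlinarith
  rw [pow_add] at h3
  have : (32 : ℤ).natAbs = 32 := rfl
  omega

/-- Evaluation follows a stack discipline: cells below `d` are untouched, so the first operand
survives the evaluation of the second at `d + 1`. Loads add `32` because the user memory is shifted
by the auxiliary cells. -/
theorem exec_code {m : ℕ → ℤ} (hm : Bdd M.k m) (e : Ex) :
    ∀ (d : ℕ) (s : RState), e.sz ≤ M.K → d + e.depth ≤ 32 → (∀ i, s.mem (i + 32) = m i) →
      e.Ok m → ∃ mem t, Exec M.wl M.sub M.inp (e.code d) s { s with mem := mem } t ∧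
        mem d = e.eval m ∧ (∀ i, i < d ∨ 32 ≤ i → mem i = s.mem i) ∧ t ≤ e.sz := by
  induction e with
  | c z =>
    intro d s hK hd hs hok
    refine ⟨_, _, .assign s d (.const z) ?_, ?_, ?_, ?_⟩
    · exact M.encInt_le (Ex.eval_lt M.one_le hm (.c z)) hK
    · simp [Rhs.eval]
    · intro i hi
      simp only [Ex.depth] at hd
      rw [Function.update_of_ne (by omega)]
    · simp [Ex.sz]
  | ld e ih =>
    intro d s hK hd hs hok
    simp only [Ex.depth, Ex.sz] at hd hK
    have hev := Ex.eval_lt M.one_le hm e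
    have hev' := M.natAbs_add_32_lt hev
    obtain ⟨mem, t, hx, hv, hf, ht⟩ := ih d s (by omega) (by omega) hs hok.2
    have hx2 := Exec.assign (wl := M.wl) (sub := M.sub) (inp := M.inp) { s with mem := mem }
      (d + 1) (.const 32)
      (M.encInt_le (n := 6) (by
        simp only [Rhs.eval]
        have : 2 ^ 6 ≤ 2 ^ (M.k * 6) := Nat.pow_le_pow_right (by norm_num) (by
          have := M.one_le; omega)
        exact lt_of_lt_of_le (by decide) this) (by have := e.one_le_sz; omega))
    have hx3 := Exec.assign (wl := M.wl) (sub := M.sub) (inp := M.inp) (i := d) (r := .op .add d (d + 1))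
      (s := { s with mem := Function.update mem (d + 1) 32 })
      (h := M.encInt_le (n := e.sz + 6) (by
        simp [Rhs.eval, Op.eval, hv, hev']) hK)
    simp only [Rhs.eval, Op.eval, Function.update_self] at hx3
    rw [Function.update_of_ne (by omega), hv] at hx3
    have hld : Rhs.eval M.inp (Function.update (Function.update mem (d + 1) 32) d
        (e.eval m + 32)) (.load d) = m (e.eval m).toNat := by
      simp only [Rhs.eval, Function.update_self]
      have : (e.eval m + 32).toNat = (e.eval m).toNat + 32 := by
        have := hok.1; omega
      rw [this, Function.update_of_ne (by omega), Function.update_of_ne (by omega),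
        hf _ (by omega), hs]
    have hx4 := Exec.assign (wl := M.wl) (sub := M.sub) (inp := M.inp) (i := d) (r := .load d)
      (s := { s with mem := Function.update (Function.update mem (d + 1) 32) d (e.eval m + 32) })
      (h := M.encInt_le (n := 1) (by
        simp only []
        rw [hld, mul_one]; exact hm _) (by omega))
    simp only [] at hx4
    rw [hld] at hx4
    refine ⟨_, _, .seq _ _ _ _ _ _ _ hx (.seq _ _ _ _ _ _ _ hx2 (.seq _ _ _ _ _ _ _ hx3 hx4)),
      ?_, ?_, ?_⟩
    · simp
    · intro i hi
      rw [Function.update_of_ne (by omega), Function.update_of_ne (by omega),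
        Function.update_of_ne (by omega), hf i hi]
    · simp only [Ex.sz]
      omega
  | bin o a b iha ihb =>
    intro d s hK hd hs hok
    simp only [Ex.depth, Ex.sz] at hd hK
    obtain ⟨mem, t, hx, hv, hf, ht⟩ := iha d s (by omega) (by omega) hs hok.1
    obtain ⟨mem', t', hx', hv', hf', ht'⟩ := ihb (d + 1) { s with mem := mem } (by omega) (by omega)
      (fun i => by rw [← hs i]; exact hf _ (by omega)) hok.2
    have hvd : mem' d = a.eval m := by rw [hf' d (by omega)]; exact hv
    have hres : Rhs.eval M.inp mem' (.op o d (d + 1)) = (Ex.bin o a b).eval m := by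
      simp only [Rhs.eval, hvd, hv']
      rfl
    have hx2 := Exec.assign (wl := M.wl) (sub := M.sub) (inp := M.inp) (i := d) (r := .op o d (d + 1))
      (s := { s with mem := mem' })
      (h := M.encInt_le (n := (Ex.bin o a b).sz) (by
        simp only []
        rw [hres]
        exact Ex.eval_lt M.one_le hm _) hK)
    simp only [] at hx2
    rw [hres] at hx2
    refine ⟨_, _, .seq _ _ _ _ _ _ _ hx (.seq _ _ _ _ _ _ _ hx' hx2), ?_, ?_, ?_⟩
    · simp
    · intro i hi
      rw [Function.update_of_ne (by omega), hf' i (by omega)]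
      exact hf i hi
    · simp only [Ex.sz]
      omega

/-- Started in any representation of `u`, the program halts after at most `T` steps in a
representation of `u'`. -/
def Run (p : Prog) (u u' : RState) (T : ℕ) : Prop :=
  Bdd M.k u.mem → Bdd M.k u'.mem ∧ ∀ s, Represents s u → ∃ s' t,
    Exec M.wl M.sub M.inp p s s' t ∧ Represents s' u' ∧ t ≤ T

variable {M}

theorem Run.mono {p : Prog} {u u' : RState} {T T' : ℕ} (h : M.Run p u u' T) (hT : T ≤ T') :
    M.Run p u u' T' := by
  intro hb
  obtain ⟨h1, h2⟩ := h hb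
  refine ⟨h1, fun s hs => ?_⟩
  obtain ⟨s', t, hx, hr, ht⟩ := h2 s hs
  exact ⟨s', t, hx, hr, ht.trans hT⟩

theorem run_skip (u : RState) : M.Run .skip u u 1 :=
  fun hb => ⟨hb, fun s hs => ⟨s, 1, .skip s, hs, le_rfl⟩⟩

theorem Run.seq {p q : Prog} {u u' u'' : RState} {T T' : ℕ} (h : M.Run p u u' T)
    (h' : M.Run q u' u'' T') : M.Run (.seq p q) u u'' (T + T') := by
  intro hb
  obtain ⟨hb', h⟩ := h hb
  obtain ⟨hb'', h'⟩ := h' hb'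
  refine ⟨hb'', fun s hs => ?_⟩
  obtain ⟨s', t, hx, hr, ht⟩ := h s hs
  obtain ⟨s'', t', hx', hr', ht'⟩ := h' s' hr
  exact ⟨s'', t + t', .seq _ _ _ _ _ _ _ hx hx', hr', Nat.add_le_add ht ht'⟩

end Machine

/-- Writes the value of `e` into the cell with address `a`. -/
def storeP (a e : Ex) : Prog :=
  .seq (e.code 0) (.seq (a.code 1) (.seq (.assign 2 (.const 32))
    (.seq (.assign 1 (.op .add 1 2)) (.store 1 0))))

/-- Writes the value of `e` into the cell `x`. -/
def setP (x : ℕ) (e : Ex) : Prog := storeP (.c x) e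

def outP (e : Ex) : Prog := .seq (e.code 0) (.out 0)

def ifP (e : Ex) (p q : Prog) : Prog := .seq (e.code 0) (.ifPos 0 p q)

def whileP (e : Ex) (p : Prog) : Prog := .seq (e.code 0) (.whilePos 0 (.seq p (e.code 0)))

/-- Calls the subroutine on the four cells from `a` on and writes the result from `b` on. -/
def callP (a b : ℕ) : Prog := .call (a + 32) 4 (b + 32)

/-- The expression fits into the auxiliary memory and into the word length. -/
def Ex.Fits (e : Ex) (K : ℕ) : Prop := e.sz + 6 ≤ K ∧ e.depth ≤ 31

/-! ### Execution rules for the compiled statements -/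

namespace Machine

variable {M : Machine}

/-- A stored value must itself be below `2 ^ k`, although the auxiliary values of its computation
may be larger. This keeps the bound from growing along an execution. -/
theorem run_store {u : RState} {a e : Ex} (ha : a.Fits M.K) (he : e.Fits M.K) (hao : a.Ok u.mem)
    (heo : e.Ok u.mem) (h0 : 0 ≤ a.eval u.mem)
    (hbd : Bdd M.k u.mem → (e.eval u.mem).natAbs < 2 ^ M.k) :
    M.Run (storeP a e) u
      { u with mem := Function.update u.mem (a.eval u.mem).toNat (e.eval u.mem) }
      (e.sz + a.sz + 3) := by
  intro hb
  refine ⟨?_, ?_⟩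
  · intro i
    simp only [Function.update_apply]
    split_ifs
    · exact hbd hb
    · exact hb i
  intro s hs
  obtain ⟨ha1, ha2⟩ := ha
  obtain ⟨he1, he2⟩ := he
  obtain ⟨mem, t, hx, hv, hf, ht⟩ := M.exec_code hb e 0 s (by omega) (by omega) hs.1 heo
  obtain ⟨mem', t', hx', hv', hf', ht'⟩ := M.exec_code hb a 1 { s with mem := mem }
    (by omega) (by omega) (fun i => by rw [← hs.1 i]; exact hf _ (by omega)) hao
  have hx2 := Exec.assign (wl := M.wl) (sub := M.sub) (inp := M.inp) { s with mem := mem' }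
    2 (.const 32)
    (M.encInt_le (n := 6) (by
      simp only [Rhs.eval]
      have : 2 ^ 6 ≤ 2 ^ (M.k * 6) := Nat.pow_le_pow_right (by norm_num) (by
        have := M.one_le; omega)
      exact lt_of_lt_of_le (by decide) this) (by omega))
  have hx3 := Exec.assign (wl := M.wl) (sub := M.sub) (inp := M.inp) (i := 1) (r := .op .add 1 2)
    (s := { s with mem := Function.update mem' 2 32 })
    (h := M.encInt_le (n := a.sz + 6) (by
      have := M.natAbs_add_32_lt (Ex.eval_lt M.one_le hb a)
      simp [Rhs.eval, Op.eval, hv', this]) ha1)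
  have hx4 := Exec.store (wl := M.wl) (sub := M.sub) (inp := M.inp)
    { s with mem := Function.update (Function.update mem' 2 32) 1
              (Rhs.eval M.inp (Function.update mem' 2 32) (.op .add 1 2)) } 1 0
  refine ⟨_, _, .seq _ _ _ _ _ _ _ hx (.seq _ _ _ _ _ _ _ hx' (.seq _ _ _ _ _ _ _ hx2
    (.seq _ _ _ _ _ _ _ hx3 hx4))), ⟨?_, hs.2⟩, by omega⟩
  intro i
  have e1 : mem' 0 = e.eval u.mem := by rw [hf' 0 (by omega)]; exact hv
  have e2 : (a.eval u.mem + 32).toNat = (a.eval u.mem).toNat + 32 := by omega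
  simp only [Rhs.eval, Op.eval, Function.update_self]
  rw [Function.update_of_ne (a := (1 : ℕ)) (a' := 2) (by omega), hv', e2,
    Function.update_of_ne (a := (0 : ℕ)) (by omega), Function.update_of_ne (a := (0 : ℕ)) (by omega),
    e1]
  by_cases hi : i = (a.eval u.mem).toNat
  · subst hi
    rw [Function.update_self, Function.update_self]
  · rw [Function.update_of_ne (by omega), Function.update_of_ne (by omega),
      Function.update_of_ne (by omega), Function.update_of_ne hi, hf' _ (by omega)]
    exact (hf _ (by omega)).trans (hs.1 i)

theorem run_set {u : RState} {x : ℕ} {e : Ex} (hx : x + 7 ≤ M.K) (he : e.Fits M.K)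
    (heo : e.Ok u.mem) (hbd : Bdd M.k u.mem → (e.eval u.mem).natAbs < 2 ^ M.k) :
    M.Run (setP x e) u { u with mem := Function.update u.mem x (e.eval u.mem) }
      (e.sz + x + 4) := by
  have := run_store (M := M) (u := u) (a := .c x) (e := e)
    ⟨by simpa [Ex.sz] using hx, by simp [Ex.depth]⟩ he trivial heo (by simp) hbd
  simpa [setP, Ex.sz, add_assoc] using this

theorem run_out {u : RState} {e : Ex} (he : e.Fits M.K) (heo : e.Ok u.mem) :
    M.Run (outP e) u { u with out := u.out ++ [e.eval u.mem] } (e.sz + 1) := by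
  intro hb
  refine ⟨hb, fun s hs => ?_⟩
  obtain ⟨he1, he2⟩ := he
  obtain ⟨mem, t, hx, hv, hf, ht⟩ := M.exec_code hb e 0 s (by omega) (by omega) hs.1 heo
  refine ⟨_, _, .seq _ _ _ _ _ _ _ hx (.out _ 0), ⟨fun i => ?_, ?_, hs.2.2⟩, by omega⟩
  · exact (hf _ (by omega)).trans (hs.1 i)
  · simp only [hv, hs.2.1]

theorem run_if_pos {u u' : RState} {e : Ex} {p q : Prog} {T : ℕ} (he : e.Fits M.K)
    (heo : e.Ok u.mem) (hpos : 0 < e.eval u.mem) (h : M.Run p u u' T) :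
    M.Run (ifP e p q) u u' (T + e.sz + 1) := by
  intro hb
  obtain ⟨hb', h⟩ := h hb
  refine ⟨hb', fun s hs => ?_⟩
  obtain ⟨he1, he2⟩ := he
  obtain ⟨mem, t, hx, hv, hf, ht⟩ := M.exec_code hb e 0 s (by omega) (by omega) hs.1 heo
  obtain ⟨s', t', hx', hr, ht'⟩ := h { s with mem := mem }
    ⟨fun i => (hf _ (by omega)).trans (hs.1 i), hs.2⟩
  exact ⟨s', _, .seq _ _ _ _ _ _ _ hx (.ifTrue 0 _ _ _ _ _ (by simp only [hv]; exact hpos) hx'), hr,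
    by omega⟩

theorem run_if_neg {u u' : RState} {e : Ex} {p q : Prog} {T : ℕ} (he : e.Fits M.K)
    (heo : e.Ok u.mem) (hneg : ¬ 0 < e.eval u.mem) (h : M.Run q u u' T) :
    M.Run (ifP e p q) u u' (T + e.sz + 1) := by
  intro hb
  obtain ⟨hb', h⟩ := h hb
  refine ⟨hb', fun s hs => ?_⟩
  obtain ⟨he1, he2⟩ := he
  obtain ⟨mem, t, hx, hv, hf, ht⟩ := M.exec_code hb e 0 s (by omega) (by omega) hs.1 heo
  obtain ⟨s', t', hx', hr, ht'⟩ := h { s with mem := mem }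
    ⟨fun i => (hf _ (by omega)).trans (hs.1 i), hs.2⟩
  exact ⟨s', _, .seq _ _ _ _ _ _ _ hx (.ifFalse 0 _ _ _ _ _ (by simp only [hv]; exact hneg) hx'), hr,
    by omega⟩

theorem run_while_neg {u : RState} {e : Ex} {p : Prog} (he : e.Fits M.K)
    (heo : e.Ok u.mem) (hneg : ¬ 0 < e.eval u.mem) : M.Run (whileP e p) u u (e.sz + 1) := by
  intro hb
  refine ⟨hb, fun s hs => ?_⟩
  obtain ⟨he1, he2⟩ := he
  obtain ⟨mem, t, hx, hv, hf, ht⟩ := M.exec_code hb e 0 s (by omega) (by omega) hs.1 heo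
  exact ⟨_, _, .seq _ _ _ _ _ _ _ hx (.whileFalse 0 _ _ (by simp only [hv]; exact hneg)),
    ⟨fun i => (hf _ (by omega)).trans (hs.1 i), hs.2⟩, by omega⟩

theorem run_while_pos {u u' u'' : RState} {e : Ex} {p : Prog} {T T' : ℕ} (he : e.Fits M.K)
    (heo : e.Ok u.mem) (hpos : 0 < e.eval u.mem) (h : M.Run p u u' T)
    (h' : M.Run (whileP e p) u' u'' T') : M.Run (whileP e p) u u'' (T + (e.sz + 1) + T') := by
  intro hb
  obtain ⟨hb', h⟩ := h hb
  obtain ⟨hb'', h'⟩ := h' hb'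
  refine ⟨hb'', fun s hs => ?_⟩
  obtain ⟨he1, he2⟩ := he
  obtain ⟨mem, t, hx, hv, hf, ht⟩ := M.exec_code hb e 0 s (by omega) (by omega) hs.1 heo
  obtain ⟨s', t', hx', hr, ht'⟩ := h { s with mem := mem }
    ⟨fun i => (hf _ (by omega)).trans (hs.1 i), hs.2⟩
  obtain ⟨s'', t'', hx'', hr'', ht''⟩ := h' s' hr
  -- The remaining loop starts by evaluating its test. This evaluation is split off and becomes the
  -- end of the current loop body.
  cases hx'' with
  | seq _ _ _ s3 _ t3 t4 h3 h4 =>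
    exact ⟨s'', _, .seq _ _ _ _ _ _ _ hx (.whileTrue 0 _ _ _ _ _ _ (by simp only [hv]; exact hpos)
      (.seq _ _ _ _ _ _ _ hx' h3) h4), hr'', by omega⟩

/-- Loops whose invariant is indexed by a decreasing number. -/
theorem run_while {e : Ex} {p : Prog} {T : ℕ} (I : ℕ → RState → Prop) (he : e.Fits M.K)
    (heo : ∀ n u, I n u → e.Ok u.mem)
    (hstep : ∀ n u, I n u → 0 < e.eval u.mem → ∃ n' u', n' < n ∧ M.Run p u u' T ∧ I n' u') :
    ∀ n u, I n u → ∃ n' u', M.Run (whileP e p) u u' (n * (T + (e.sz + 1)) + (e.sz + 1)) ∧ I n' u' ∧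
      ¬ 0 < e.eval u'.mem := by
  intro n
  induction n using Nat.strong_induction_on with
  | _ n ih =>
    intro u hu
    by_cases hpos : 0 < e.eval u.mem
    · obtain ⟨n', u', hn, hr, hI⟩ := hstep n u hu hpos
      obtain ⟨n'', u'', hr', hI', hneg⟩ := ih n' hn u' hI
      refine ⟨n'', u'', (run_while_pos he (heo n u hu) hpos hr hr').mono ?_, hI', hneg⟩
      have := Nat.mul_le_mul_right (T + (e.sz + 1)) (Nat.succ_le_of_lt hn)
      rw [Nat.succ_mul] at this
      omega
    · exact ⟨n, u, (run_while_neg he (heo n u hu) hpos).mono (by omega), hu, hpos⟩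

theorem run_call {u : RState} {a b v : ℕ} {res : List ℤ}
    (hsub : M.sub (readBlock u.mem a 4) res v) (hres : ∀ z ∈ res, z.natAbs < 2 ^ M.k)
    (hK : 1 ≤ M.K) :
    M.Run (callP a b) u ⟨writeBlock u.mem b res, u.out, u.log ++ [(readBlock u.mem a 4, res)]⟩
      (v + (4 + M.inp.length) + res.length + 1) := by
  intro hb
  refine ⟨fun i => ?_, fun s hs => ?_⟩
  · simp only [writeBlock]
    split_ifs with h
    · rw [List.getD_eq_getElem _ _ (by omega)]
      exact hres _ (List.getElem_mem _)
    · exact hb i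
  · have hblock : readBlock s.mem (a + 32) 4 = readBlock u.mem a 4 := by
      unfold readBlock
      apply List.map_congr_left
      intro i _
      rw [← hs.1, add_right_comm]
    refine ⟨_, _, .call s (a + 32) 4 (b + 32) res v (hblock ▸ hsub) ?_, ⟨fun i => ?_, hs.2.1, ?_⟩,
      le_rfl⟩
    · intro z hz
      exact M.encInt_le (n := 1) (by rw [mul_one]; exact hres z hz) hK
    · simp only [writeBlock, Nat.add_le_add_iff_right, hs.1, Nat.add_sub_add_right]
      simp only [show b + 32 + res.length = b + res.length + 32 by ring, Nat.add_lt_add_iff_right]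
    · simp only [hblock, hs.2.2]

end Machine

open Ex

theorem Ex.Fits.mono {e : Ex} {K K' : ℕ} (h : e.Fits K) (hK : K ≤ K') : e.Fits K' :=
  ⟨h.1.trans hK, h.2⟩

instance (e : Ex) (K : ℕ) : Decidable (e.Fits K) := inferInstanceAs (Decidable (_ ∧ _))

namespace Ex

@[simp] theorem sz_c (z : ℤ) : (c z).sz = z.natAbs + 1 := rfl
@[simp] theorem sz_v (i : ℕ) : (v i).sz = i + 7 := by simp [v, sz]
@[simp] theorem sz_add (a b : Ex) : (a + b).sz = a.sz + b.sz + 1 := rfl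
@[simp] theorem sz_div (a b : Ex) : (a / b).sz = a.sz + b.sz + 1 := rfl
@[simp] theorem sz_sub (a b : Ex) : (a - b).sz = a.sz + b.sz + 1 := rfl
@[simp] theorem sz_mul (a b : Ex) : (a * b).sz = a.sz + b.sz + 1 := rfl
@[simp] theorem sz_pos (a : Ex) : (pos a).sz = 3 * a.sz + 9 := by simp [pos]; omega
@[simp] theorem sz_absE (a : Ex) : (absE a).sz = 4 * a.sz + 17 := by simp [absE]; omega
@[simp] theorem sz_ld (a : Ex) : (ld a).sz = a.sz + 6 := rfl
@[simp] theorem depth_c (z : ℤ) : (c z).depth = 1 := rfl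
@[simp] theorem depth_ld (a : Ex) : (ld a).depth = max a.depth 2 := rfl
@[simp] theorem depth_v (i : ℕ) : (v i).depth = 2 := rfl
@[simp] theorem depth_add (a b : Ex) : (a + b).depth = max a.depth (b.depth + 1) := rfl
@[simp] theorem depth_div (a b : Ex) : (a / b).depth = max a.depth (b.depth + 1) := rfl
@[simp] theorem depth_sub (a b : Ex) : (a - b).depth = max a.depth (b.depth + 1) := rfl
@[simp] theorem depth_mul (a b : Ex) : (a * b).depth = max a.depth (b.depth + 1) := rfl

end Ex

/-- `u'` differs from `u` at most in the cells with the property `S`. -/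
def Frame (S : ℕ → Prop) (u u' : RState) : Prop :=
  (∀ i, ¬ S i → u'.mem i = u.mem i) ∧ u'.out = u.out ∧ u'.log = u.log

/-! ## Reduction of fractions -/

/-- Euclid's algorithm on the cells `10` and `11`. -/
def gcdP : Prog :=
  whileP (v 11) (.seq (setP 12 (v 10 - v 11 * (v 10 / v 11))) (.seq (setP 10 (v 11)) (setP 11 (v 12))))

/-- Reduces the fraction with numerator in cell `a` and denominator in cell `b`. -/
def reduceP (a b : ℕ) : Prog :=
  .seq (setP 10 (v a + v b)) (.seq (setP 11 (v b)) (.seq gcdP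
    (.seq (setP a (v a / v 10)) (setP b (v b / v 10)))))

namespace Machine

variable {M : Machine}

theorem exists_run_set {u : RState} {x : ℕ} {e : Ex} {z : ℤ} (hx : x + 7 ≤ M.K) (he : e.Fits M.K)
    (heo : e.Ok u.mem) (hz : e.eval u.mem = z) (hbd : Bdd M.k u.mem → z.natAbs < 2 ^ M.k) :
    ∃ u', M.Run (setP x e) u u' (e.sz + x + 4) ∧ u'.mem = Function.update u.mem x z ∧
      u'.out = u.out ∧ u'.log = u.log := by
  subst hz
  exact ⟨_, run_set hx he heo hbd, rfl, rfl, rfl⟩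

theorem run_gcd (hK : 10000 ≤ M.K) (n : ℕ) (u : RState) (x y : ℕ) (hx : u.mem 10 = x)
    (hy : u.mem 11 = y) (hyx : y ≤ x) (hn : x * y < 2 ^ n) :
    ∃ u', M.Run gcdP u u' (1000 * n + 1000) ∧ u'.mem 10 = (Nat.gcd x y : ℕ) ∧
      Frame (fun i => i = 10 ∨ i = 11 ∨ i = 12) u u' := by
  obtain ⟨n', u', hr, ⟨x', y', hx', hy', _, _, hg, hf⟩, hneg⟩ := run_while (M := M) (e := v 11)
    (p := .seq (setP 12 (v 10 - v 11 * (v 10 / v 11))) (.seq (setP 10 (v 11)) (setP 11 (v 12))))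
    (T := 900) (fun n u' => ∃ x' y' : ℕ, u'.mem 10 = x' ∧ u'.mem 11 = y' ∧ y' ≤ x' ∧
      x' * y' < 2 ^ n ∧ Nat.gcd x' y' = Nat.gcd x y ∧
      Frame (fun i => i = 10 ∨ i = 11 ∨ i = 12) u u')
    (Fits.mono (by decide) hK) (fun _ _ _ => by simp) (by
      rintro n u1 ⟨x', y', hx', hy', hle, hlt, hg, hf⟩ hpos
      simp only [eval_v, hy'] at hpos
      have hy0 : 0 < y' := by exact_mod_cast hpos
      have hev : (v 10 - v 11 * (v 10 / v 11)).eval u1.mem = ((x' % y' : ℕ) : ℤ) := by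
        simp only [eval_sub, eval_mul, eval_div, eval_v, hx', hy']
        rw [Int.fdiv_eq_ediv_of_nonneg _ (by positivity), Int.natCast_mod, Int.emod_def]
      have hmod := Nat.mod_lt x' hy0
      obtain ⟨u2, r1, m1, o1, l1⟩ := exists_run_set (M := M) (u := u1) (x := 12) (by omega)
        (Fits.mono (by decide) hK) (by simp) hev (fun hb => by
          rw [Int.natAbs_natCast]
          have := hb 11
          rw [hy', Int.natAbs_natCast] at this
          omega)
      obtain ⟨u3, r2, m2, o2, l2⟩ := exists_run_set (M := M) (u := u2) (x := 10) (e := v 11)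
        (z := y') (by omega) (Fits.mono (by decide) hK) (by simp) (by simp [m1, hy'])
        (fun hb => by have := hb 11; simpa [m1, hy'] using this)
      obtain ⟨u4, r3, m3, o3, l3⟩ := exists_run_set (M := M) (u := u3) (x := 11) (e := v 12)
        (z := (x' % y' : ℕ)) (by omega) (Fits.mono (by decide) hK) (by simp) (by simp [m2, m1])
        (fun hb => by have := hb 12; rw [m2, m1] at this; simpa using this)
      have hn0 : n ≠ 0 := by
        rintro rfl
        have : 0 < x' * y' := Nat.mul_pos (by omega) hy0
        simp at hlt
        omega
      refine ⟨n - 1, u4, by omega, (r1.seq (r2.seq r3)).mono (by decide), y', x' % y', ?_, ?_,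
        hmod.le, ?_, ?_, ?_, ?_, ?_⟩
      · simp [m3, m2]
      · simp [m3]
      · have h1 : 2 * (x' % y') ≤ x' := by
          have h2 := Nat.mod_add_div x' y'
          have h3 : 1 ≤ x' / y' := Nat.div_pos hle hy0
          nlinarith
        obtain ⟨j, rfl⟩ := Nat.exists_eq_succ_of_ne_zero hn0
        rw [Nat.succ_sub_one]
        rw [pow_succ] at hlt
        nlinarith
      · rw [← hg, Nat.gcd_comm, ← Nat.gcd_rec, Nat.gcd_comm]
      · intro i hi
        rw [← hf.1 i hi]
        simp only [not_or] at hi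
        rw [m3, m2, m1, Function.update_of_ne hi.2.1, Function.update_of_ne hi.1,
          Function.update_of_ne hi.2.2]
      · rw [o3, o2, o1, hf.2.1]
      · rw [l3, l2, l1, hf.2.2])
    n u ⟨x, y, hx, hy, hyx, hn, rfl, fun _ _ => rfl, rfl, rfl⟩
  refine ⟨u', hr.mono ?_, ?_, hf⟩
  · rw [show (v 11).sz = 18 by decide]; omega
  · simp only [eval_v, hy'] at hneg
    have : y' = 0 := by omega
    rw [hx', ← hg, this, Nat.gcd_zero_right]

theorem run_reduce (hK : 10000 ≤ M.K) (a b : ℕ) (ha : a < 10) (hb : b < 10) (hab : a ≠ b)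
    (u : RState) (x y : ℕ) (hx : u.mem a = x) (hy : u.mem b = y) (hxy : x + y < 2 ^ M.k) :
    ∃ u', M.Run (reduceP a b) u u' (2000 * M.k + 3000) ∧
      u'.mem a = ((x / Nat.gcd x y : ℕ) : ℤ) ∧ u'.mem b = ((y / Nat.gcd x y : ℕ) : ℤ) ∧
      Frame (fun i => i = a ∨ i = b ∨ i = 10 ∨ i = 11 ∨ i = 12) u u' := by
  obtain ⟨u1, r1, m1, o1, l1⟩ := exists_run_set (M := M) (u := u) (x := 10) (e := v a + v b)
    (z := (x + y : ℕ)) (by omega) ⟨by simp; omega, by simp⟩ (by simp) (by simp [hx, hy])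
    (fun _ => by rw [Int.natAbs_natCast]; exact hxy)
  obtain ⟨u2, r2, m2, o2, l2⟩ := exists_run_set (M := M) (u := u1) (x := 11) (e := v b)
    (z := y) (by omega) ⟨by simp; omega, by simp⟩ (by simp)
    (by rw [eval_v, m1, Function.update_of_ne (by omega), hy])
    (fun _ => by rw [Int.natAbs_natCast]; omega)
  -- Starting from `x + y` and `y` puts the larger number first without changing the gcd; the
  -- product is below `2 ^ (2 * k)`.
  obtain ⟨u3, r3, hg, hf⟩ := run_gcd (M := M) hK (2 * M.k) u2 (x + y) y
    (by rw [m2, m1]; simp) (by rw [m2]; simp) (by omega) (by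
      rw [two_mul, pow_add]
      exact Nat.mul_lt_mul'' hxy (by omega))
  rw [Nat.gcd_add_self_left] at hg
  have fr : ∀ i, i ≠ 10 → i ≠ 11 → i ≠ 12 → u3.mem i = u.mem i := by
    intro i h0 h1 h2
    rw [hf.1 i (by omega), m2, m1, Function.update_of_ne h1, Function.update_of_ne h0]
  obtain ⟨u4, r4, m4, o4, l4⟩ := exists_run_set (M := M) (u := u3) (x := a) (e := v a / v 10)
    (z := (x / Nat.gcd x y : ℕ)) (by omega) ⟨by simp; omega, by simp⟩ (by simp) (by
      simp only [eval_v, eval_div]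
      rw [fr a (by omega) (by omega) (by omega), hx, hg, Int.fdiv_eq_ediv_of_nonneg _ (by positivity)]
      simp)
    (fun _ => by
      rw [Int.natAbs_natCast]
      exact (Nat.div_le_self _ _).trans_lt (by omega))
  obtain ⟨u5, r5, m5, o5, l5⟩ := exists_run_set (M := M) (u := u4) (x := b) (e := v b / v 10)
    (z := (y / Nat.gcd x y : ℕ)) (by omega) ⟨by simp; omega, by simp⟩ (by simp) (by
      simp only [eval_v, eval_div]
      rw [m4, Function.update_of_ne hab.symm, Function.update_of_ne (by omega),
        fr b (by omega) (by omega) (by omega), hy, hg, Int.fdiv_eq_ediv_of_nonneg _ (by positivity)]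
      simp)
    (fun _ => by
      rw [Int.natAbs_natCast]
      exact (Nat.div_le_self _ _).trans_lt (by omega))
  refine ⟨u5, (r1.seq (r2.seq (r3.seq (r4.seq r5)))).mono ?_, ?_, ?_, ?_, ?_, ?_⟩
  · simp
    omega
  · rw [m5, Function.update_of_ne hab, m4, Function.update_self]
  · rw [m5, Function.update_self]
  · intro i hi
    simp only [not_or] at hi
    rw [m5, m4, Function.update_of_ne hi.2.1, Function.update_of_ne hi.1,
      fr i hi.2.2.1 hi.2.2.2.1 hi.2.2.2.2]
  · rw [o5, o4, hf.2.1, o2, o1]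
  · rw [l5, l4, hf.2.2, l2, l1]

end Machine

/-- Identifies the cells after division by the gcd with the normal form in `ℚ`, which `ptCode`
requires. -/
theorem num_den_div (x y : ℕ) (hy : 0 < y) :
    ((x : ℚ) / y).num = ((x / Nat.gcd x y : ℕ) : ℤ) ∧ ((x : ℚ) / y).den = y / Nat.gcd x y := by
  have hg : 0 < Nat.gcd x y := Nat.gcd_pos_of_pos_right x hy
  have hyd : 0 < y / Nat.gcd x y := Nat.div_pos (Nat.le_of_dvd hy (Nat.gcd_dvd_right x y)) hg
  have h : ((x : ℚ) / y) = (((x / Nat.gcd x y : ℕ) : ℤ) : ℚ) / (((y / Nat.gcd x y : ℕ) : ℤ) : ℚ) := by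
    rw [Int.cast_natCast, Int.cast_natCast, Nat.cast_div_div_div_cancel_right]
    · exact Nat.gcd_dvd_right x y
    · exact Nat.gcd_dvd_left x y
  have hc : Nat.Coprime (((x / Nat.gcd x y : ℕ) : ℤ)).natAbs (((y / Nat.gcd x y : ℕ) : ℤ)).natAbs := by
    rw [Int.natAbs_natCast, Int.natAbs_natCast]
    exact Nat.coprime_div_gcd_div_gcd hg
  have hpos : (0 : ℤ) < ((y / Nat.gcd x y : ℕ) : ℤ) := by exact_mod_cast hyd
  constructor
  · rw [h, Rat.num_div_eq_of_coprime hpos hc]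
  · have := Rat.den_div_eq_of_coprime hpos hc
    rw [h]
    exact_mod_cast this

/-! ## Points in the memory -/

/-- The four cells from `a` on hold the point `y`. -/
def HoldsPt (m : ℕ → ℤ) (a : ℕ) (y : Pt) : Prop :=
  m a = (y 0).num ∧ m (a + 1) = (y 0).den ∧ m (a + 2) = (y 1).num ∧ m (a + 3) = (y 1).den

theorem HoldsPt.congr {m m' : ℕ → ℤ} {a b : ℕ} {y : Pt} (h : HoldsPt m a y)
    (hm : ∀ j < 4, m' (b + j) = m (a + j)) : HoldsPt m' b y := by
  have h0 := hm 0 (by omega)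
  exact ⟨h0.trans h.1, (hm 1 (by omega)).trans h.2.1, (hm 2 (by omega)).trans h.2.2.1,
    (hm 3 (by omega)).trans h.2.2.2⟩

theorem HoldsPt.readBlock {m : ℕ → ℤ} {a : ℕ} {y : Pt} (h : HoldsPt m a y) :
    readBlock m a 4 = ptCode y := by
  obtain ⟨h0, h1, h2, h3⟩ := h
  simp [BOCO.readBlock, ptCode, List.range_succ, h0, h1, h2, h3]

theorem holdsPt_writeBlock (m : ℕ → ℤ) (a : ℕ) (y : Pt) :
    HoldsPt (writeBlock m a (ptCode y)) a y := by
  refine ⟨?_, ?_, ?_, ?_⟩ <;> simp [writeBlock, ptCode]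

/-- Copies the first `n` cells from the address in cell `13` to the address in cell `14`. -/
def shiftP : ℕ → Prog
  | 0 => .skip
  | n + 1 => .seq (shiftP n) (storeP (v 14 + c n) (ld (v 13 + c n)))

/-- Copies four cells. -/
def copyP (src dst : Ex) : Prog := .seq (setP 13 src) (.seq (setP 14 dst) (shiftP 4))

namespace Machine

variable {M : Machine}

theorem run_shift (hK : 10000 ≤ M.K) {u : RState} {σ δ : ℕ} (hσ : u.mem 13 = σ)
    (hδ : u.mem 14 = δ) (h15 : 15 ≤ δ) (hdisj : σ + 4 ≤ δ ∨ δ + 4 ≤ σ) :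
    ∀ n ≤ 4, ∃ u', M.Run (shiftP n) u u' (100 * n + 1) ∧
      (∀ i, u'.mem i = if δ ≤ i ∧ i < δ + n then u.mem (σ + (i - δ)) else u.mem i) ∧
      u'.out = u.out ∧ u'.log = u.log := by
  intro n
  induction n with
  | zero =>
    intro _
    refine ⟨u, run_skip u, fun i => ?_, rfl, rfl⟩
    rw [if_neg (by omega)]
  | succ n ih =>
    intro hn
    obtain ⟨u', h, hm, ho, hl⟩ := ih (by omega)
    have a : u'.mem 13 = σ := by rw [hm, if_neg (by omega), hσ]
    have b : u'.mem 14 = δ := by rw [hm, if_neg (by omega), hδ]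
    have e1 : (v 14 + c n).eval u'.mem = ((δ + n : ℕ) : ℤ) := by simp [b]
    have e2 : (ld (v 13 + c n)).eval u'.mem = u.mem (σ + n) := by
      simp only [eval_ld, eval_add, eval_v, a, eval_c]
      rw [← Nat.cast_add, Int.toNat_natCast, hm, if_neg (by omega)]
    have r := run_store (M := M) (u := u') (a := v 14 + c n) (e := ld (v 13 + c n))
      ⟨by simp; omega, by simp⟩ ⟨by simp; omega, by simp⟩
      (by simp) (by simp [a]; omega) (by rw [e1]; positivity)
      (fun hb => by rw [eval_ld]; exact hb _)
    rw [e1, e2, Int.toNat_natCast] at r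
    refine ⟨_, (h.seq r).mono (by simp; omega), fun i => ?_, ho, hl⟩
    simp only [Function.update_apply, hm]
    by_cases hi : i = δ + n
    · rw [if_pos hi, if_pos (by omega), hi]
      congr 1
      omega
    · rw [if_neg hi]
      by_cases h' : δ ≤ i ∧ i < δ + n
      · rw [if_pos h', if_pos (by omega)]
      · rw [if_neg h', if_neg (by omega)]

/-- The destination is evaluated after cell `13` has been overwritten, hence the form of `hd`.
Neither block may overlap the cells `13` and `14` that hold the addresses. -/
theorem run_copy (hK : 10000 ≤ M.K) {u : RState} {se de : Ex} (σ δ : ℕ) (hse : se.Fits M.K)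
    (hde : de.Fits M.K) (hso : se.Ok u.mem) (hdo : ∀ m, de.Ok m)
    (hs : se.eval u.mem = σ) (hd : ∀ z, de.eval (Function.update u.mem 13 z) = δ)
    (hσk : σ < 2 ^ M.k) (hδk : δ < 2 ^ M.k) (hσ : σ + 4 ≤ 13 ∨ 15 ≤ σ) (hδ : 15 ≤ δ)
    (hdisj : σ + 4 ≤ δ ∨ δ + 4 ≤ σ) :
    ∃ u', M.Run (copyP se de) u u' (se.sz + de.sz + 500) ∧
      (∀ j < 4, u'.mem (δ + j) = u.mem (σ + j)) ∧
      Frame (fun i => i = 13 ∨ i = 14 ∨ (δ ≤ i ∧ i < δ + 4)) u u' := by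
  obtain ⟨u1, r1, m1, o1, l1⟩ := exists_run_set (M := M) (u := u) (x := 13) (by omega) hse hso hs
    (fun _ => by rw [Int.natAbs_natCast]; exact hσk)
  obtain ⟨u2, r2, m2, o2, l2⟩ := exists_run_set (M := M) (u := u1) (x := 14) (z := δ) (by omega) hde
    (hdo _) (by rw [m1]; exact hd _)
    (fun _ => by rw [Int.natAbs_natCast]; exact hδk)
  have a2 : u2.mem 13 = σ := by rw [m2, m1]; simp
  have b2 : u2.mem 14 = δ := by rw [m2]; simp
  obtain ⟨u3, r3, m3, o3, l3⟩ := run_shift hK a2 b2 hδ hdisj 4 le_rfl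
  have fr : ∀ i, i ≠ 13 → i ≠ 14 → u2.mem i = u.mem i := fun i h h' => by
    rw [m2, m1, Function.update_of_ne h', Function.update_of_ne h]
  have hr := r1.seq (r2.seq r3)
  refine ⟨u3, hr.mono (by clear * -; omega), ?_, ?_, by rw [o3, o2, o1],
    by rw [l3, l2, l1]⟩
  · intro j hj
    rw [m3, if_pos (by omega), fr _ (by omega) (by omega)]
    congr 1
    omega
  · intro i hi
    rw [m3, if_neg (by omega), fr _ (by omega) (by omega)]

end Machine

/-! ## The weight of a pair -/

/-- Computes the distance of the rational numbers in the cells `a, a + 1` and `b, b + 1`. -/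
def distP (x a b : ℕ) : Prog :=
  .seq (setP x (absE (v a * v (b + 1) - v b * v (a + 1))))
    (.seq (setP (x + 1) (v (a + 1) * v (b + 1))) (reduceP x (x + 1)))

theorem abs_sub_eq_div (q r : ℚ) :
    |q - r| = ((q.num * r.den - r.num * q.den).natAbs : ℚ) / ((q.den * r.den : ℕ) : ℚ) := by
  have h1 : (0 : ℚ) < q.den := by exact_mod_cast q.pos
  have h2 : (0 : ℚ) < r.den := by exact_mod_cast r.pos
  have h : q - r = ((q.num * r.den - r.num * q.den : ℤ) : ℚ) / ((q.den * r.den : ℕ) : ℚ) := by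
    conv_lhs => rw [← Rat.num_div_den q, ← Rat.num_div_den r]
    push_cast
    field_simp
  rw [h, abs_div, abs_of_nonneg (a := ((q.den * r.den : ℕ) : ℚ)) (by positivity)]
  rw [Nat.cast_natAbs, Int.cast_abs]

namespace Machine

variable {M : Machine}

theorem run_dist (hK : 10000 ≤ M.K) {u : RState} {x a b : ℕ} (hx : x ≤ 2) (ha : 20 ≤ a ∧ a < 40)
    (hb : 20 ≤ b ∧ b < 40) {q r : ℚ} (q0 : u.mem a = q.num) (q1 : u.mem (a + 1) = q.den)
    (r0 : u.mem b = r.num) (r1 : u.mem (b + 1) = r.den)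
    (hqr : ratHeight q * ratHeight r < 2 ^ M.k) :
    ∃ u', M.Run (distP x a b) u u' (2000 * M.k + 10000) ∧ u'.mem x = |q - r|.num ∧
      u'.mem (x + 1) = |q - r|.den ∧
      Frame (fun i => i = x ∨ i = x + 1 ∨ i = 10 ∨ i = 11 ∨ i = 12) u u' := by
  have hsum : (q.num * r.den - r.num * q.den).natAbs + q.den * r.den < 2 ^ M.k := by
    have h1 := Int.natAbs_sub_le (q.num * r.den) (r.num * q.den)
    simp only [Int.natAbs_mul, Int.natAbs_natCast] at h1
    unfold ratHeight at hqr
    have := Nat.zero_le (q.num.natAbs * r.num.natAbs)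
    nlinarith
  obtain ⟨u1, h1, m1, o1, l1⟩ := exists_run_set (M := M) (u := u) (x := x)
    (e := absE (v a * v (b + 1) - v b * v (a + 1)))
    (z := ((q.num * r.den - r.num * q.den).natAbs : ℕ)) (by omega)
    ⟨by simp; omega, by simp [absE, pos]⟩
    (by simp) (by simp [q0, q1, r0, r1]) (fun _ => by rw [Int.natAbs_natCast]; omega)
  obtain ⟨u2, h2, m2, o2, l2⟩ := exists_run_set (M := M) (u := u1) (x := x + 1)
    (e := v (a + 1) * v (b + 1)) (z := (q.den * r.den : ℕ)) (by omega)
    ⟨by simp; omega, by simp⟩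
    (by simp) (by simp [m1, Function.update_apply, q1, r1]; omega)
    (fun _ => by rw [Int.natAbs_natCast]; omega)
  obtain ⟨u3, h3, n3, d3, f3⟩ := run_reduce (M := M) hK x (x + 1) (by omega) (by omega) (by omega) u2
    _ _ (by rw [m2, m1, Function.update_of_ne (by omega), Function.update_self])
    (by rw [m2, Function.update_self]) hsum
  obtain ⟨hn, hd⟩ := num_den_div ((q.num * r.den - r.num * q.den).natAbs) (q.den * r.den)
    (Nat.mul_pos q.pos r.pos)
  rw [← abs_sub_eq_div] at hn hd
  refine ⟨u3, (h1.seq (h2.seq h3)).mono ?_, ?_, ?_, ?_, ?_, ?_⟩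
  · simp
    clear * - hx ha hb
    omega
  · rw [n3, hn]
  · rw [d3, hd]
  · intro i hi
    rw [f3.1 i hi, m2, m1, Function.update_of_ne (by omega), Function.update_of_ne (by omega)]
  · rw [f3.2.1, o2, o1]
  · rw [f3.2.2, l2, l1]

end Machine

/-! ### Memory bounds and the interface to the solver -/

/-- There are at most `2 ^ n` solutions. This crude bound serves for addresses and counters, whose
lengths are logarithmic in it. -/
theorem Instance.card_vertices_le (P : Instance) : P.vertices.card ≤ 2 ^ P.size := by
  classical
  let g : (Fin P.n → Bool) → Pt := fun b => P.C.mulVec fun i => if b i then 1 else 0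
  have hsub : P.vertices ⊆ Finset.univ.image g := by
    intro y hy
    obtain ⟨x, hx, rfl⟩ := ((P.mem_vertices y).1 hy).1
    refine Finset.mem_image.2 ⟨fun i => decide (x i = 1), Finset.mem_univ _, ?_⟩
    simp only [g]
    congr 1
    funext i
    rcases P.binary x hx i with h | h <;> simp [h]
  refine (Finset.card_le_card hsub).trans (Finset.card_image_le.trans ?_)
  rw [Finset.card_univ, Fintype.card_fun, Fintype.card_bool, Fintype.card_fin]
  exact Nat.pow_le_pow_right (by norm_num) (Nat.le_add_right _ _)

/-- The subroutine of the machine solves the weighted-sum scalarizations of `P` in time `V`, and the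
memory bound suffices for the Dichotomic Approach. -/
structure Oracle (M : Machine) (P : Instance) (V : ℕ) : Prop where
  solve : ∀ l : Pt, 0 ≤ l → (∀ i, ratHeight (l i) ≤ 2 ^ (2 * P.size + 1)) →
    ∃ y v, P.IsWSOptimal l y ∧ M.sub (ptCode l) (ptCode y) v ∧ v ≤ V
  hk : 2 * P.size + 16 ≤ M.k
  hK : 10000 ≤ M.K

theorem natAbs_lt_of_mem_ptCode {P : Instance} {y : Pt} (hy : y ∈ P.Y) {z : ℤ}
    (hz : z ∈ ptCode y) : z.natAbs ≤ 2 ^ P.size := by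
  have h0 := ratHeight_of_mem_Y hy 0
  have h1 := ratHeight_of_mem_Y hy 1
  unfold ratHeight at h0 h1
  simp only [ptCode, List.mem_cons, List.not_mem_nil, or_false] at hz
  rcases hz with rfl | rfl | rfl | rfl <;> try simp only [Int.natAbs_natCast]
  all_goals omega

namespace Oracle

variable {M : Machine} {P : Instance} {V : ℕ}

/-- The factor `2 ^ 16` leaves room for addresses of up to `24 * 2 ^ size` points and for the up to
`576 * 4 ^ size` pairs of them. -/
theorem pow_le (O : Oracle M P V) : 65536 * (2 ^ P.size * 2 ^ P.size) ≤ 2 ^ M.k := by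
  have := Nat.pow_le_pow_right (n := 2) (by norm_num) O.hk
  rw [pow_add, two_mul, pow_add] at this
  omega

theorem pow_le' (O : Oracle M P V) : 65536 * 2 ^ P.size ≤ 2 ^ M.k := by
  have := O.pow_le
  have h1 : 1 ≤ 2 ^ P.size := Nat.one_le_two_pow
  nlinarith

theorem run_solve (O : Oracle M P V) {u : RState} {l : Pt} (b : ℕ) (hl : HoldsPt u.mem 0 l)
    (h0 : 0 ≤ l) (hh : ∀ i, ratHeight (l i) ≤ 2 ^ (2 * P.size + 1)) :
    ∃ y u', P.IsWSOptimal l y ∧ M.Run (callP 0 b) u u' (V + M.inp.length + 9) ∧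
      HoldsPt u'.mem b y ∧ (∀ i, i < b ∨ b + 4 ≤ i → u'.mem i = u.mem i) ∧ u'.out = u.out ∧
      u'.log = u.log ++ [(ptCode l, ptCode y)] := by
  obtain ⟨y, w, hy, hsub, hw⟩ := O.solve l h0 hh
  have hr := M.run_call (u := u) (a := 0) (b := b) (v := w) (res := ptCode y)
    (by rw [hl.readBlock]; exact hsub)
    (fun z hz => by
      have h1 := natAbs_lt_of_mem_ptCode hy.1 hz
      have h2 := O.pow_le'
      have h3 := Nat.one_le_two_pow (n := P.size)
      omega)
    (by have := O.hK; omega)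
  rw [hl.readBlock] at hr
  refine ⟨y, _, hy, hr.mono ?_, holdsPt_writeBlock _ _ _, fun i hi => ?_, rfl, rfl⟩
  · simp only [ptCode, List.length_cons, List.length_nil]
    omega
  · have hlen : (ptCode y).length = 4 := rfl
    simp only [writeBlock]
    rw [if_neg (by omega)]

end Oracle

/-! ## The main loop -/

/-- Positive if the point in the cells from `4` on has a smaller weighted sum than the point in the
cells from `20` on. -/
def testE : Ex := v 0 * v 3 * (v 20 * v 5 - v 4 * v 21) * (v 23 * v 7)
  + v 2 * v 1 * (v 22 * v 7 - v 6 * v 23) * (v 21 * v 5)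

/-- The integer expression is the difference of the weighted sums, multiplied by the positive
product of all six denominators. -/
theorem testE_pos_iff {m : ℕ → ℤ} {l y a : Pt} (hl : HoldsPt m 0 l) (hy : HoldsPt m 4 y)
    (ha : HoldsPt m 20 a) : 0 < testE.eval m ↔ l ⬝ᵥ y < l ⬝ᵥ a := by
  obtain ⟨l0, l1, l2, l3⟩ := hl
  obtain ⟨y0, y1, y2, y3⟩ := hy
  obtain ⟨a0, a1, a2, a3⟩ := ha
  norm_num at l0 l1 l2 l3 y0 y1 y2 y3 a0 a1 a2 a3
  simp only [testE, eval_add, eval_mul, eval_sub, eval_v, l0, l1, l2, l3, y0, y1, y2, y3, a0, a1,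
    a2, a3]
  have p1 : (0 : ℚ) < (l 0).den := by exact_mod_cast (l 0).pos
  have p2 : (0 : ℚ) < (l 1).den := by exact_mod_cast (l 1).pos
  have p3 : (0 : ℚ) < (y 0).den := by exact_mod_cast (y 0).pos
  have p4 : (0 : ℚ) < (y 1).den := by exact_mod_cast (y 1).pos
  have p5 : (0 : ℚ) < (a 0).den := by exact_mod_cast (a 0).pos
  have p6 : (0 : ℚ) < (a 1).den := by exact_mod_cast (a 1).pos
  have p : (0 : ℚ) < (l 0).den * (l 1).den * (y 0).den * (y 1).den * (a 0).den * (a 1).den := by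
    positivity
  have key : ((l 0).den * (l 1).den * (y 0).den * (y 1).den * (a 0).den * (a 1).den : ℚ)
      * (l 0 * a 0 + l 1 * a 1 - (l 0 * y 0 + l 1 * y 1)) =
      (((l 0).num * (l 1).den * ((a 0).num * (y 0).den - (y 0).num * (a 0).den)
          * ((a 1).den * (y 1).den)
        + (l 1).num * (l 0).den * ((a 1).num * (y 1).den - (y 1).num * (a 1).den)
          * ((a 0).den * (y 0).den) : ℤ) : ℚ) := by
    have num : ∀ q : ℚ, (q.num : ℚ) = q * q.den := fun q => (Rat.mul_den_eq_num q).symm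
    push_cast
    simp only [num]
    ring
  rw [dot_eq, dot_eq, ← sub_pos (b := l 0 * y 0 + l 1 * y 1), ← mul_pos_iff_of_pos_left p, key]
  exact Int.cast_pos.symm

/-- Appends the pairs that a new point forms with the points of the current pair. -/
def pushP : Prog :=
  .seq (copyP (c 4) (v 8 * c 8 + c 40)) (.seq (copyP (c 20) (v 8 * c 8 + c 44))
    (.seq (copyP (c 4) (v 8 * c 8 + c 48)) (.seq (copyP (c 24) (v 8 * c 8 + c 52))
      (setP 8 (v 8 + c 2)))))

/-- Solves the scalarization for the current pair. -/
def probeP : Prog :=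
  .seq (copyP (v 9 * c 8 + c 40) (c 20)) (.seq (copyP (v 9 * c 8 + c 44) (c 24))
    (.seq (distP 0 22 26) (.seq (distP 2 20 24) (callP 0 4))))

/-- One iteration of the Dichotomic Approach. The pair with number `e` occupies the eight cells from
`40 + 8 e` on; the cells `8` and `9` contain the tail and the head of the queue. -/
def iterP : Prog := .seq probeP (.seq (ifP testE pushP .skip) (setP 9 (v 9 + c 1)))

/-- The memory represents a state of the Dichotomic Approach: `t` pairs have been put into the queue,
`h` pairs have been retrieved, and `p (2 e)`, `p (2 e + 1)` are the points of the pair with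
number `e`. -/
structure Sim (P : Instance) (d : DAState) (u : RState) (t h : ℕ) (p : ℕ → Pt) : Prop where
  reach : DAReach P d
  tail : u.mem 8 = t
  head : u.mem 9 = h
  le : h ≤ t
  holds : ∀ q < 2 * t, HoldsPt u.mem (40 + 4 * q) (p q)
  queue : d.queue = (List.range' h (t - h)).map fun e => (p (2 * e), p (2 * e + 1))
  -- Retrieved pairs are not erased, so the queue array also lists, with repetitions, all points
  -- found.
  found : ∀ y, y ∈ d.found ↔ ∃ q < 2 * t, p q = y
  log : u.log = d.log.map fun e => (ptCode e.1, ptCode e.2)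
  out : u.out = []
  tail_le : t ≤ 2 * d.log.length

theorem DAReach.log_length_le {P : Instance} {d : DAState} (h : DAReach P d) :
    d.log.length ≤ 6 * 2 ^ P.size := by
  have h1 := h.inv.bound
  have h2 := P.card_vertices_le
  have h3 := Nat.one_le_two_pow (n := P.size)
  omega

namespace Oracle

variable {M : Machine} {P : Instance} {V : ℕ}

theorem run_probe (O : Oracle M P V) {u : RState} {h : ℕ} {a b : Pt} (ha : a ∈ P.Y) (hb : b ∈ P.Y)
    (hh : u.mem 9 = h) (hlt : h ≤ 24 * 2 ^ P.size) (hA : HoldsPt u.mem (40 + 8 * h) a)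
    (hB : HoldsPt u.mem (44 + 8 * h) b) :
    ∃ y u', P.IsWSOptimal (daWeight a b) y ∧
      M.Run probeP u u' (4000 * M.k + V + M.inp.length + 30000) ∧
      HoldsPt u'.mem 0 (daWeight a b) ∧ HoldsPt u'.mem 4 y ∧ HoldsPt u'.mem 20 a ∧
      HoldsPt u'.mem 24 b ∧ (∀ i, i = 8 ∨ i = 9 ∨ 40 ≤ i → u'.mem i = u.mem i) ∧ u'.out = u.out ∧
      u'.log = u.log ++ [(ptCode (daWeight a b), ptCode y)] := by
  have hk := O.pow_le'
  have hone := Nat.one_le_two_pow (n := P.size)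
  obtain ⟨u1, r1, c1, f1⟩ := Machine.run_copy (M := M) O.hK (u := u) (se := v 9 * c 8 + c 40)
    (de := c 20) (40 + 8 * h) 20 (Fits.mono (by decide) O.hK) (Fits.mono (by decide) O.hK)
    (by simp) (by simp) (by simp [hh]; ring) (by simp) (by omega) (by omega) (by omega) (by omega)
    (by omega)
  obtain ⟨u2, r2, c2, f2⟩ := Machine.run_copy (M := M) O.hK (u := u1) (se := v 9 * c 8 + c 44)
    (de := c 24) (44 + 8 * h) 24 (Fits.mono (by decide) O.hK) (Fits.mono (by decide) O.hK)
    (by simp) (by simp) (by simp [f1.1 9 (by omega), hh]; ring) (by simp) (by omega) (by omega)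
    (by omega) (by omega) (by omega)
  have A1 : HoldsPt u1.mem 20 a := hA.congr c1
  have A2 : HoldsPt u2.mem 20 a := A1.congr fun j hj => f2.1 _ (by omega)
  have B2 : HoldsPt u2.mem 24 b := hB.congr fun j hj => (c2 j hj).trans (f1.1 _ (by omega))
  have bound : ∀ i, ratHeight (a i) * ratHeight (b i) < 2 ^ M.k := by
    intro i
    have h1 := Nat.mul_le_mul (ratHeight_of_mem_Y ha i) (ratHeight_of_mem_Y hb i)
    have h2 := O.pow_le
    have h3 : 0 < 2 ^ P.size * 2 ^ P.size := by positivity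
    omega
  -- The weight exchanges the coordinates: its first entry comes from the second coordinates, in the
  -- cells `22` and `26`.
  obtain ⟨u3, r3, n3, d3, f3⟩ := Machine.run_dist (M := M) O.hK (u := u2) (x := 0) (a := 22)
    (b := 26) (by omega) (by omega) (by omega) A2.2.2.1 A2.2.2.2 B2.2.2.1 B2.2.2.2 (bound 1)
  have A3 : HoldsPt u3.mem 20 a := A2.congr fun j hj => f3.1 _ (by omega)
  have B3 : HoldsPt u3.mem 24 b := B2.congr fun j hj => f3.1 _ (by omega)
  obtain ⟨u4, r4, n4, d4, f4⟩ := Machine.run_dist (M := M) O.hK (u := u3) (x := 2) (a := 20)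
    (b := 24) (by omega) (by omega) (by omega) A3.1 A3.2.1 B3.1 B3.2.1 (bound 0)
  have A4 : HoldsPt u4.mem 20 a := A3.congr fun j hj => f4.1 _ (by omega)
  have B4 : HoldsPt u4.mem 24 b := B3.congr fun j hj => f4.1 _ (by omega)
  have W4 : HoldsPt u4.mem 0 (daWeight a b) :=
    ⟨(f4.1 0 (by omega)).trans n3, (f4.1 1 (by omega)).trans d3, n4, d4⟩
  obtain ⟨y, u5, hy, r5, Y5, f5, o5, l5⟩ := O.run_solve 4 W4 (daWeight_nonneg a b) (fun i =>
    (ratHeight_daWeight ha hb i).trans (Nat.pow_le_pow_right (by norm_num) (by omega)))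
  have hr := r1.seq (r2.seq (r3.seq (r4.seq r5)))
  refine ⟨y, u5, hy, hr.mono ?_, W4.congr fun j hj => f5 _ (by omega), Y5,
    A4.congr fun j hj => f5 _ (by omega), B4.congr fun j hj => f5 _ (by omega), ?_, ?_, ?_⟩
  · clear * -
    simp
    omega
  · intro i hi
    rw [f5 i (by omega), f4.1 i (by omega), f3.1 i (by omega), f2.1 i (by omega),
      f1.1 i (by omega)]
  · rw [o5, f4.2.1, f3.2.1, f2.2.1, f1.2.1]
  · rw [l5, f4.2.2, f3.2.2, f2.2.2, f1.2.2]

theorem run_push (O : Oracle M P V) {u : RState} {t : ℕ} {a b y : Pt}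
    (ht : u.mem 8 = t) (hlt : t ≤ 24 * 2 ^ P.size) (Y0 : HoldsPt u.mem 4 y)
    (A0 : HoldsPt u.mem 20 a) (B0 : HoldsPt u.mem 24 b) :
    ∃ u', M.Run pushP u u' 5000 ∧
      HoldsPt u'.mem (40 + 8 * t) y ∧ HoldsPt u'.mem (44 + 8 * t) a ∧
      HoldsPt u'.mem (48 + 8 * t) y ∧ HoldsPt u'.mem (52 + 8 * t) b ∧
      u'.mem 8 = (t + 2 : ℕ) ∧
      (∀ i, i = 9 ∨ 40 ≤ i ∧ i < 40 + 8 * t → u'.mem i = u.mem i) ∧ u'.out = u.out ∧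
      u'.log = u.log := by
  have hk := O.pow_le'
  have hone := Nat.one_le_two_pow (n := P.size)
  obtain ⟨u1, r1, c1, f1⟩ := Machine.run_copy (M := M) O.hK (u := u) (se := c 4)
    (de := v 8 * c 8 + c 40) 4 (40 + 8 * t) (Fits.mono (by decide) O.hK)
    (Fits.mono (by decide) O.hK) (by simp) (by simp) (by simp)
    (by intro z; simp [ht]; ring) (by omega) (by omega) (by omega) (by omega) (by omega)
  have t1 : u1.mem 8 = t := (f1.1 8 (by omega)).trans ht
  obtain ⟨u2, r2, c2, f2⟩ := Machine.run_copy (M := M) O.hK (u := u1) (se := c 20)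
    (de := v 8 * c 8 + c 44) 20 (44 + 8 * t) (Fits.mono (by decide) O.hK)
    (Fits.mono (by decide) O.hK) (by simp) (by simp) (by simp)
    (by intro z; simp [t1]; ring) (by omega) (by omega) (by omega) (by omega) (by omega)
  have t2 : u2.mem 8 = t := (f2.1 8 (by omega)).trans t1
  obtain ⟨u3, r3, c3, f3⟩ := Machine.run_copy (M := M) O.hK (u := u2) (se := c 4)
    (de := v 8 * c 8 + c 48) 4 (48 + 8 * t) (Fits.mono (by decide) O.hK)
    (Fits.mono (by decide) O.hK) (by simp) (by simp) (by simp)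
    (by intro z; simp [t2]; ring) (by omega) (by omega) (by omega) (by omega) (by omega)
  have t3 : u3.mem 8 = t := (f3.1 8 (by omega)).trans t2
  obtain ⟨u4, r4, c4, f4⟩ := Machine.run_copy (M := M) O.hK (u := u3) (se := c 24)
    (de := v 8 * c 8 + c 52) 24 (52 + 8 * t) (Fits.mono (by decide) O.hK)
    (Fits.mono (by decide) O.hK) (by simp) (by simp) (by simp)
    (by intro z; simp [t3]; ring) (by omega) (by omega) (by omega) (by omega) (by omega)
  have t4 : u4.mem 8 = t := (f4.1 8 (by omega)).trans t3
  obtain ⟨u5, r5, m5, o5, l5⟩ := Machine.exists_run_set (M := M) (u := u4) (x := 8)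
    (e := v 8 + c 2) (z := (t + 2 : ℕ)) (by have := O.hK; omega) (Fits.mono (by decide) O.hK)
    (by simp) (by simp [t4]) (fun _ => by rw [Int.natAbs_natCast]; omega)
  have f5 : ∀ i, i ≠ 8 → u5.mem i = u4.mem i := fun i hi => by
    rw [m5, Function.update_of_ne hi]
  have hr := r1.seq (r2.seq (r3.seq (r4.seq r5)))
  refine ⟨u5, hr.mono (by clear * -; simp), ?_, ?_, ?_, ?_, by rw [m5, Function.update_self], ?_,
    ?_, ?_⟩
  · exact Y0.congr fun j hj => by
      rw [f5 _ (by omega), f4.1 _ (by omega), f3.1 _ (by omega), f2.1 _ (by omega), c1 j hj]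
  · exact A0.congr fun j hj => by
      rw [f5 _ (by omega), f4.1 _ (by omega), f3.1 _ (by omega), c2 j hj, f1.1 _ (by omega)]
  · exact Y0.congr fun j hj => by
      rw [f5 _ (by omega), f4.1 _ (by omega), c3 j hj, f2.1 _ (by omega), f1.1 _ (by omega)]
  · exact B0.congr fun j hj => by
      rw [f5 _ (by omega), c4 j hj, f3.1 _ (by omega), f2.1 _ (by omega), f1.1 _ (by omega)]
  · intro i hi
    rw [f5 i (by omega), f4.1 i (by omega), f3.1 i (by omega), f2.1 i (by omega),
      f1.1 i (by omega)]
  · rw [o5, f4.2.1, f3.2.1, f2.2.1, f1.2.1]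
  · rw [l5, f4.2.2, f3.2.2, f2.2.2, f1.2.2]

theorem run_iter (O : Oracle M P V) {d : DAState} {u : RState} {t h : ℕ} {p : ℕ → Pt}
    (S : Sim P d u t h p) (hlt : h < t) :
    ∃ d' u' t' p', M.Run iterP u u' (4000 * M.k + V + M.inp.length + 40000) ∧
      d'.log.length = d.log.length + 1 ∧ Sim P d' u' t' (h + 1) p' := by
  obtain ⟨Q, A, L⟩ := d
  obtain ⟨hreach, htail, hhead, hle, hholds, hqueue, hfound, hlog, hout, htl⟩ := S
  simp only at hqueue hfound hlog htl
  have hk := O.pow_le'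
  have hone := Nat.one_le_two_pow (n := P.size)
  have hlen : L.length ≤ 6 * 2 ^ P.size := hreach.log_length_le
  rw [show t - h = (t - (h + 1)) + 1 by omega, List.range'_succ, List.map_cons] at hqueue
  subst hqueue
  obtain ⟨a, ha⟩ : ∃ a, a = p (2 * h) := ⟨_, rfl⟩
  obtain ⟨b, hb⟩ : ∃ b, b = p (2 * h + 1) := ⟨_, rfl⟩
  rw [← ha, ← hb] at hreach
  have hpair := hreach.inv.pairs (a, b) (by simp)
  have HA : HoldsPt u.mem (40 + 8 * h) a := by
    have := hholds (2 * h) (by omega)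
    rw [← ha] at this
    rwa [show 40 + 8 * h = 40 + 4 * (2 * h) by ring]
  have HB : HoldsPt u.mem (44 + 8 * h) b := by
    have := hholds (2 * h + 1) (by omega)
    rw [← hb] at this
    rwa [show 44 + 8 * h = 40 + 4 * (2 * h + 1) by ring]
  obtain ⟨y, u1, hy, r1, W1, Y1, A1, B1, f1, o1, l1⟩ :=
    O.run_probe hpair.mem.1 hpair.mem.2 hhead (by omega) HA HB
  -- By `IsPair.test_iff` one strict comparison replaces the two equalities of the algorithm.
  have htest := testE_pos_iff W1 Y1 A1
  by_cases hpos : 0 < testE.eval u1.mem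
  · have hcond := (hpair.test_iff hy).2 (htest.1 hpos)
    obtain ⟨u2, r2, H0, H1, H2, H3, t2, f2, o2, l2⟩ :=
      O.run_push ((f1 8 (by omega)).trans htail) (by omega) Y1 A1 B1
    have r2' := Machine.run_if_pos (M := M) (e := testE) (q := .skip)
      (Fits.mono (by decide) O.hK) (by simp [testE]) hpos r2
    have h2 : u2.mem 9 = h := (f2 9 (by omega)).trans ((f1 9 (by omega)).trans hhead)
    obtain ⟨u3, r3, m3, o3, l3⟩ := Machine.exists_run_set (M := M) (u := u2) (x := 9)
      (e := v 9 + c 1) (z := (h + 1 : ℕ)) (by have := O.hK; omega) (Fits.mono (by decide) O.hK)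
      (by simp) (by simp [h2]) (fun _ => by rw [Int.natAbs_natCast]; omega)
    have f3 : ∀ i, i ≠ 9 → u3.mem i = u2.mem i := fun i hi => by
      rw [m3, Function.update_of_ne hi]
    have hr := r1.seq (r2'.seq r3)
    obtain ⟨p', hp'⟩ : ∃ p' : ℕ → Pt, p' = fun q => if q < 2 * t then p q else
      if q = 2 * t + 1 then a else if q = 2 * t + 3 then b else y := ⟨_, rfl⟩
    have pold : ∀ q < 2 * t, p' q = p q := fun q hq => by rw [hp']; exact if_pos hq
    have p0 : p' (2 * t) = y := by
      rw [hp']; dsimp only; rw [if_neg (by omega), if_neg (by omega), if_neg (by omega)]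
    have p1 : p' (2 * t + 1) = a := by
      rw [hp']; dsimp only; rw [if_neg (by omega), if_pos rfl]
    have p2 : p' (2 * t + 2) = y := by
      rw [hp']; dsimp only; rw [if_neg (by omega), if_neg (by omega), if_neg (by omega)]
    have p3 : p' (2 * t + 3) = b := by
      rw [hp']; dsimp only; rw [if_neg (by omega), if_neg (by omega), if_pos rfl]
    refine ⟨_, u3, t + 2, p', hr.mono ?_, ?_, hreach.step (.discover a b y _ A L hy hcond), ?_, ?_,
      by omega, ?_, ?_, ?_, ?_, ?_, ?_⟩
    · have : testE.sz ≤ 1000 := by decide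
      clear * - this
      simp
      omega
    · simp
    · rw [f3 8 (by omega), t2]
    · rw [m3, Function.update_self]
    · intro q hq
      by_cases hq' : q < 2 * t
      · rw [pold q hq']
        exact (hholds q hq').congr fun j hj => by
          rw [f3 _ (by omega), f2 _ (by omega), f1 _ (by omega)]
      · have : q = 2 * t ∨ q = 2 * t + 1 ∨ q = 2 * t + 2 ∨ q = 2 * t + 3 := by omega
        rcases this with rfl | rfl | rfl | rfl
        · rw [p0, show 40 + 4 * (2 * t) = 40 + 8 * t by ring]
          exact H0.congr fun j hj => f3 _ (by omega)
        · rw [p1, show 40 + 4 * (2 * t + 1) = 44 + 8 * t by ring]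
          exact H1.congr fun j hj => f3 _ (by omega)
        · rw [p2, show 40 + 4 * (2 * t + 2) = 48 + 8 * t by ring]
          exact H2.congr fun j hj => f3 _ (by omega)
        · rw [p3, show 40 + 4 * (2 * t + 3) = 52 + 8 * t by ring]
          exact H3.congr fun j hj => f3 _ (by omega)
    · rw [show t + 2 - (h + 1) = (t - (h + 1)) + 2 by omega, ← List.range'_append, List.map_append]
      dsimp only
      congr 1
      · apply List.map_congr_left
        intro e he
        rw [List.mem_range'_1] at he
        rw [pold _ (by omega), pold _ (by omega)]
      · rw [show h + 1 + 1 * (t - (h + 1)) = t by omega]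
        simp only [List.range'_succ, List.range'_zero, List.map_cons, List.map_nil]
        rw [p0, p1, show 2 * (t + 1) = 2 * t + 2 by ring, p2, p3]
    · intro z
      simp only [Finset.mem_insert, hfound]
      constructor
      · rintro (rfl | ⟨q, hq, rfl⟩)
        · exact ⟨2 * t, by omega, p0⟩
        · exact ⟨q, by omega, pold q hq⟩
      · rintro ⟨q, hq, rfl⟩
        by_cases hq' : q < 2 * t
        · exact Or.inr ⟨q, hq', (pold q hq').symm⟩
        · have : q = 2 * t ∨ q = 2 * t + 1 ∨ q = 2 * t + 2 ∨ q = 2 * t + 3 := by omega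
          rcases this with rfl | rfl | rfl | rfl
          · exact Or.inl p0
          · exact Or.inr ⟨2 * h, by omega, by rw [p1, ha]⟩
          · exact Or.inl p2
          · exact Or.inr ⟨2 * h + 1, by omega, by rw [p3, hb]⟩
    · rw [l3, l2, l1, hlog]
      simp
    · rw [o3, o2, o1, hout]
    · simp only [List.length_append, List.length_singleton]
      omega
  · have hcond := not_not.1 (fun hc => hpos (htest.2 ((hpair.test_iff hy).1 hc)))
    have r2' := Machine.run_if_neg (M := M) (e := testE) (p := pushP)
      (Fits.mono (by decide) O.hK) (by simp [testE]) hpos (Machine.run_skip u1)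
    have h2 : u1.mem 9 = h := (f1 9 (by omega)).trans hhead
    obtain ⟨u3, r3, m3, o3, l3⟩ := Machine.exists_run_set (M := M) (u := u1) (x := 9)
      (e := v 9 + c 1) (z := (h + 1 : ℕ)) (by have := O.hK; omega) (Fits.mono (by decide) O.hK)
      (by simp) (by simp [h2]) (fun _ => by rw [Int.natAbs_natCast]; omega)
    have f3 : ∀ i, i ≠ 9 → u3.mem i = u1.mem i := fun i hi => by
      rw [m3, Function.update_of_ne hi]
    have hr := r1.seq (r2'.seq r3)
    refine ⟨_, u3, t, p, hr.mono ?_, ?_, hreach.step (.neglect a b y _ A L hy hcond), ?_, ?_,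
      by omega, ?_, ?_, ?_, ?_, ?_, ?_⟩
    · have : testE.sz ≤ 1000 := by decide
      clear * - this
      simp
      omega
    · simp
    · rw [f3 8 (by omega), f1 8 (by omega), htail]
    · rw [m3, Function.update_self]
    · intro q hq
      exact (hholds q hq).congr fun j hj => by rw [f3 _ (by omega), f1 _ (by omega)]
    · rfl
    · exact hfound
    · rw [l3, l1, hlog]
      simp
    · rw [o3, o1, hout]
    · simp only [List.length_append, List.length_singleton]
      omega

/-- The loop over the queue. -/
theorem run_loop (O : Oracle M P V) (hP : P.S.Nonempty) {d : DAState} {u : RState} {t h : ℕ}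
    {p : ℕ → Pt} (S : Sim P d u t h p) :
    ∃ d' u' t' p', M.Run (whileP (v 8 - v 9) iterP) u u'
        (6 * P.YX.ncard * (4000 * M.k + V + M.inp.length + 40100) + 100) ∧
      d'.queue = [] ∧ Sim P d' u' t' t' p' := by
  obtain ⟨n', u', hr, ⟨d', t', h', p', hn', S'⟩, hneg⟩ := Machine.run_while (M := M)
    (e := v 8 - v 9) (p := iterP) (T := 4000 * M.k + V + M.inp.length + 40000)
    -- The decreasing index is the number of scalarizations that the bound `6 |YX|` still permits.
    (fun n u => ∃ d t h p, n = 6 * P.YX.ncard - d.log.length ∧ Sim P d u t h p)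
    (Fits.mono (by decide) O.hK) (fun _ _ _ => by simp) (by
      rintro n u ⟨d, t, h, p, hn, S⟩ hpos
      simp only [eval_sub, eval_v, S.tail, S.head] at hpos
      obtain ⟨d', u', t', p', hr, hl, S'⟩ := O.run_iter S (by omega)
      have := S'.reach.inv.log_length_le hP
      exact ⟨_, u', by omega, hr, d', t', h + 1, p', rfl, S'⟩)
    _ u ⟨d, t, h, p, rfl, S⟩
  simp only [eval_sub, eval_v, S'.tail, S'.head] at hneg
  have heq : h' = t' := by
    have := S'.le
    omega
  subst heq
  refine ⟨d', u', h', p', hr.mono ?_, ?_, S'⟩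
  · rw [show (v 8 - v 9).sz = 32 by decide]
    have : (6 * P.YX.ncard - d.log.length) * (4000 * M.k + V + M.inp.length + 40000 + (32 + 1)) ≤
        6 * P.YX.ncard * (4000 * M.k + V + M.inp.length + 40100) :=
      Nat.mul_le_mul (Nat.sub_le _ _) (by clear * -; omega)
    exact Nat.add_le_add this (by norm_num)
  · rw [S'.queue]
    simp

end Oracle

/-! ## Initialization -/

/-- Positive if the four cells from `a` on agree with those from `b` on. -/
def eqE (a b : ℕ) : Ex :=
  c 1 - ((v a - v b) * (v a - v b) + (v (a + 1) - v (b + 1)) * (v (a + 1) - v (b + 1))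
    + (v (a + 2) - v (b + 2)) * (v (a + 2) - v (b + 2))
    + (v (a + 3) - v (b + 3)) * (v (a + 3) - v (b + 3)))

/-- Reduced fractions represent points uniquely, and `1` minus a sum of integer squares is positive
only if all squares vanish. -/
theorem eqE_pos_iff {m : ℕ → ℤ} {a b : ℕ} {x y : Pt} (hx : HoldsPt m a x) (hy : HoldsPt m b y) :
    0 < (eqE a b).eval m ↔ x = y := by
  obtain ⟨x0, x1, x2, x3⟩ := hx
  obtain ⟨y0, y1, y2, y3⟩ := hy
  simp only [eqE, eval_sub, eval_c, eval_add, eval_mul, eval_v, x0, x1, x2, x3, y0, y1, y2, y3]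
  constructor
  · intro h
    have s0 := mul_self_nonneg ((x 0).num - (y 0).num)
    have s1 := mul_self_nonneg (((x 0).den : ℤ) - (y 0).den)
    have s2 := mul_self_nonneg ((x 1).num - (y 1).num)
    have s3 := mul_self_nonneg (((x 1).den : ℤ) - (y 1).den)
    have e0 := mul_self_eq_zero.1 (le_antisymm (by omega) s0)
    have e1 := mul_self_eq_zero.1 (le_antisymm (by omega) s1)
    have e2 := mul_self_eq_zero.1 (le_antisymm (by omega) s2)
    have e3 := mul_self_eq_zero.1 (le_antisymm (by omega) s3)
    exact (pt_ext_iff x y).2 ⟨Rat.ext (by omega) (by omega), Rat.ext (by omega) (by omega)⟩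
  · rintro rfl
    simp

/-- Writes the weight `(x, y)` into the first four cells. -/
def weightP (x y : ℤ) : Prog :=
  .seq (setP 0 (c x)) (.seq (setP 1 (c 1)) (.seq (setP 2 (c y)) (setP 3 (c 1))))

/-- The first two scalarizations. The pair of the two points gets the number `0`; it counts as retrieved
if the points are equal. -/
def initP : Prog :=
  .seq (weightP 1 0) (.seq (callP 0 40) (.seq (weightP 0 1) (.seq (callP 0 44)
    (.seq (setP 8 (c 1)) (setP 9 (pos (eqE 40 44)))))))

namespace Oracle

variable {M : Machine} {P : Instance} {V : ℕ}

theorem run_weight (O : Oracle M P V) (u : RState) (x y : ℕ) (hx : x ≤ 1) (hy : y ≤ 1) :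
    ∃ u', M.Run (weightP x y) u u' 100 ∧ HoldsPt u'.mem 0 ![(x : ℚ), (y : ℚ)] ∧
      (∀ i, 4 ≤ i → u'.mem i = u.mem i) ∧ u'.out = u.out ∧ u'.log = u.log := by
  have hK := O.hK
  have hk := O.pow_le'
  have hone := Nat.one_le_two_pow (n := P.size)
  obtain ⟨u1, r1, m1, o1, l1⟩ := Machine.exists_run_set (M := M) (u := u) (x := 0) (e := c x)
    (z := x) (by omega) ⟨by simp; omega, by simp⟩ (by simp) (by simp)
    (fun _ => by rw [Int.natAbs_natCast]; omega)
  obtain ⟨u2, r2, m2, o2, l2⟩ := Machine.exists_run_set (M := M) (u := u1) (x := 1) (e := c 1)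
    (z := 1) (by omega) ⟨by simp; omega, by simp⟩ (by simp) (by simp)
    (fun _ => by simp; have := O.hk; omega)
  obtain ⟨u3, r3, m3, o3, l3⟩ := Machine.exists_run_set (M := M) (u := u2) (x := 2) (e := c y)
    (z := y) (by omega) ⟨by simp; omega, by simp⟩ (by simp) (by simp)
    (fun _ => by rw [Int.natAbs_natCast]; omega)
  obtain ⟨u4, r4, m4, o4, l4⟩ := Machine.exists_run_set (M := M) (u := u3) (x := 3) (e := c 1)
    (z := 1) (by omega) ⟨by simp; omega, by simp⟩ (by simp) (by simp)
    (fun _ => by simp; have := O.hk; omega)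
  have hr := r1.seq (r2.seq (r3.seq r4))
  refine ⟨u4, hr.mono (by clear * - hx hy; simp; omega), ⟨?_, ?_, ?_, ?_⟩, ?_,
    by rw [o4, o3, o2, o1], by rw [l4, l3, l2, l1]⟩
  · simp [m4, m3, m2, m1]
  · simp [m4, m3, m2, m1]
  · simp [m4, m3, m2, m1]
  · simp [m4, m3, m2, m1]
  · intro i hi
    rw [m4, m3, m2, m1, Function.update_of_ne (by omega), Function.update_of_ne (by omega),
      Function.update_of_ne (by omega), Function.update_of_ne (by omega)]

theorem run_init (O : Oracle M P V) (u : RState) (ho : u.out = []) (hl : u.log = []) :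
    ∃ d u' h p, M.Run initP u u' (2 * (V + M.inp.length) + 4000) ∧ Sim P d u' 1 h p := by
  have hK := O.hK
  have hk := O.pow_le'
  have hone := Nat.one_le_two_pow (n := P.size)
  have hhalf : 2 ≤ 2 ^ (2 * P.size + 1) := by
    rw [pow_succ]
    have := Nat.one_le_two_pow (n := 2 * P.size)
    omega
  obtain ⟨u1, r1, w1, f1, o1, l1⟩ := O.run_weight u 1 0 le_rfl (by omega)
  simp only [Nat.cast_one, Nat.cast_zero] at w1 r1
  obtain ⟨y0, u2, hy0, r2, h2, f2, o2, l2⟩ := O.run_solve 40 w1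
    (by intro i; fin_cases i <;> simp) (by intro i; fin_cases i <;> simpa [ratHeight] using by omega)
  obtain ⟨u3, r3, w3, f3, o3, l3⟩ := O.run_weight u2 0 1 (by omega) le_rfl
  simp only [Nat.cast_one, Nat.cast_zero] at w3 r3
  obtain ⟨y1, u4, hy1, r4, h4, f4, o4, l4⟩ := O.run_solve 44 w3
    (by intro i; fin_cases i <;> simp) (by intro i; fin_cases i <;> simpa [ratHeight] using by omega)
  obtain ⟨u5, r5, m5, o5, l5⟩ := Machine.exists_run_set (M := M) (u := u4) (x := 8) (e := c 1)
    (z := 1) (by omega) ⟨by simp; omega, by simp⟩ (by simp) (by simp)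
    (fun _ => by simp; have := O.hk; omega)
  have H0 : HoldsPt u5.mem 40 y0 := h2.congr fun j hj => by
    rw [m5, Function.update_of_ne (by omega), f4 _ (by omega), f3 _ (by omega)]
  have H1 : HoldsPt u5.mem 44 y1 := h4.congr fun j hj => by
    rw [m5, Function.update_of_ne (by omega)]
  obtain ⟨u6, r6, m6, o6, l6⟩ := Machine.exists_run_set (M := M) (u := u5) (x := 9)
    (e := pos (eqE 40 44)) (z := ((if y0 = y1 then 1 else 0 : ℕ) : ℤ)) (by omega)
    (Fits.mono (by decide) hK) (by simp [eqE])
    (by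
      rw [eval_pos]
      by_cases h : y0 = y1
      · rw [if_pos ((eqE_pos_iff H0 H1).2 h), if_pos h]; rfl
      · rw [if_neg (fun h' => h ((eqE_pos_iff H0 H1).1 h')), if_neg h]; rfl)
    (fun _ => by
      rw [Int.natAbs_natCast]
      split_ifs <;> omega)
  have hr := r1.seq (r2.seq (r3.seq (r4.seq (r5.seq r6))))
  refine ⟨_, u6, if y0 = y1 then 1 else 0, fun q => if q = 0 then y0 else y1, hr.mono ?_,
    ⟨_, .mk y0 y1 hy0 hy1, .refl⟩, ?_, ?_, ?_, ?_, ?_, ?_, ?_, ?_, ?_⟩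
  · have : (pos (eqE 40 44)).sz ≤ 3000 := by decide
    clear * - this
    simp only [sz_c, sz_pos] at this ⊢
    norm_num
    omega
  · rw [m6, Function.update_of_ne (by omega), m5, Function.update_self]; rfl
  · rw [m6, Function.update_self]
  · split_ifs <;> omega
  · intro q hq
    have : q = 0 ∨ q = 1 := by omega
    rcases this with rfl | rfl
    · exact H0.congr fun j hj => by rw [m6, Function.update_of_ne (by omega)]
    · exact H1.congr fun j hj => by rw [m6, Function.update_of_ne (by omega)]
  · by_cases h : y0 = y1
    · simp [h]
    · simp [h]
  · intro z
    simp only [Finset.mem_insert, Finset.mem_singleton]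
    constructor
    · rintro (rfl | rfl)
      · exact ⟨0, by omega, rfl⟩
      · exact ⟨1, by omega, rfl⟩
    · rintro ⟨q, hq, rfl⟩
      split_ifs
      · exact Or.inl rfl
      · exact Or.inr rfl
  · rw [l6, l5, l4, l3, l2, l1, hl]
    rfl
  · rw [o6, o5, o4, o3, o2, o1, ho]
  · simp

end Oracle

/-! ## Selection of the extreme points -/

/-- The point with number `i` is dominated by the point with number `j` or by a convex combination of
the points with numbers `j` and `k`, or it is equal to the preceding point with number `j`. -/
def Bad (p : ℕ → Pt) (i j k : ℕ) : Prop :=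
  (p j ≤ p i ∧ p j ≠ p i) ∨
  (p j 0 < p i 0 ∧ p k 1 < p i 1 ∧
    (p j 1 - p i 1) * (p k 0 - p i 0) ≤ (p j 0 - p i 0) * (p k 1 - p i 1)) ∨
  (j < i ∧ p j = p i)

/-- The point with number `i` is output. -/
def Keep (p : ℕ → Pt) (N i : ℕ) : Prop := ∀ j < N, ∀ k < N, ¬ Bad p i j k

/-- The first two clauses of `Bad` negate the vertex conditions; the third keeps only the first
occurrence of each point, which `Nat.find` supplies. -/
theorem keep_iff {A : Finset Pt} {N : ℕ} {p : ℕ → Pt} (hA : ∀ y, y ∈ A ↔ ∃ q < N, p q = y) (y : Pt) :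
    (∃ i < N, Keep p N i ∧ p i = y) ↔ y ∈ daOutput A := by
  rw [daOutput_eq]
  constructor
  · rintro ⟨i, hi, hk, rfl⟩
    refine ⟨(hA _).2 ⟨i, hi, rfl⟩, fun g hg hle => ?_, fun g hg h hh h0 h1 => ?_⟩
    · obtain ⟨j, hj, rfl⟩ := (hA g).1 hg
      by_contra hne
      exact hk j hj j hj (Or.inl ⟨hle, hne⟩)
    · obtain ⟨j, hj, rfl⟩ := (hA g).1 hg
      obtain ⟨k, hkN, rfl⟩ := (hA h).1 hh
      by_contra hlt
      exact hk j hj k hkN (Or.inr (Or.inl ⟨h0, h1, not_lt.1 hlt⟩))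
  · rintro ⟨hy, h1, h2⟩
    classical
    have hex := (hA y).1 hy
    obtain ⟨hi, hpi⟩ := Nat.find_spec hex
    refine ⟨Nat.find hex, hi, fun j hj k hk => ?_, hpi⟩
    rintro (⟨hle, hne⟩ | ⟨h3, h4, h5⟩ | ⟨hlt, he⟩)
    · rw [hpi] at hle hne
      exact hne (h1 _ ((hA _).2 ⟨j, hj, rfl⟩) hle)
    · rw [hpi] at h3 h4 h5
      exact absurd (h2 _ ((hA _).2 ⟨j, hj, rfl⟩) _ ((hA _).2 ⟨k, hk, rfl⟩) h3 h4) (not_lt.2 h5)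
    · exact Nat.find_min hex hlt ⟨hj, he.trans hpi⟩

theorem Keep.injOn {p : ℕ → Pt} {N i j : ℕ} (hi : i < N) (hj : j < N) (ki : Keep p N i)
    (kj : Keep p N j) (h : p i = p j) : i = j := by
  rcases lt_trichotomy i j with hlt | heq | hlt
  · exact absurd (Or.inr (Or.inr ⟨hlt, h⟩)) (kj i hi i hi)
  · exact heq
  · exact absurd (Or.inr (Or.inr ⟨hlt, h.symm⟩)) (ki j hj j hj)

/-- Positive if the point in the cells from `20` on, with number in cell `16`, is bad with respect to
the points in the cells from `24` and from `28` on. -/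
def badE : Ex :=
  pos (c 1 - (v 24 * v 21 - v 20 * v 25)) * pos (c 1 - (v 26 * v 23 - v 22 * v 27))
      * pos (c 1 - pos (eqE 24 20))
    + pos (v 20 * v 25 - v 24 * v 21) * pos (v 22 * v 31 - v 30 * v 23)
      * pos (c 1 + ((v 24 * v 21 - v 20 * v 25) * (v 30 * v 23 - v 22 * v 31) * (v 27 * v 29)
        - (v 26 * v 23 - v 22 * v 27) * (v 28 * v 21 - v 20 * v 29) * (v 25 * v 31)))
    + pos (v 16 - v 18 / v 15) * pos (eqE 24 20)

/-- Products of indicators serve as conjunctions in `badE`, sums as disjunctions. -/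
theorem ite_mul_ite_one (p q : Prop) [Decidable p] [Decidable q] :
    (if p then (1 : ℤ) else 0) * (if q then 1 else 0) = if p ∧ q then 1 else 0 := by
  by_cases hp : p <;> by_cases hq : q <;> simp [hp, hq]

theorem ite_add_pos_iff (p q r : Prop) [Decidable p] [Decidable q] [Decidable r] :
    0 < (if p then (1 : ℤ) else 0) + (if q then 1 else 0) + (if r then 1 else 0) ↔ p ∨ q ∨ r := by
  by_cases hp : p <;> by_cases hq : q <;> by_cases hr : r <;> simp [hp, hq, hr]

theorem cross_pos_iff (q r : ℚ) : 0 < q.num * r.den - r.num * q.den ↔ r < q := by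
  rw [Rat.lt_iff, sub_pos]

theorem one_sub_cross_pos_iff (q r : ℚ) : 0 < 1 - (q.num * r.den - r.num * q.den) ↔ q ≤ r := by
  rw [Rat.le_iff]
  omega

/-- After clearing denominators the weak inequality is one of integers, where `0 ≤ z` can be tested
as `0 < 1 + z`. -/
theorem comb_pos_iff (y0 y1 g0 g1 h0 h1 : ℚ) :
    0 < 1 + ((g0.num * y0.den - y0.num * g0.den) * (h1.num * y1.den - y1.num * h1.den)
          * (g1.den * h0.den)
        - (g1.num * y1.den - y1.num * g1.den) * (h0.num * y0.den - y0.num * h0.den)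
          * (g0.den * h1.den)) ↔
      (g1 - y1) * (h0 - y0) ≤ (g0 - y0) * (h1 - y1) := by
  have p1 : (0 : ℚ) < y0.den := by exact_mod_cast y0.pos
  have p2 : (0 : ℚ) < y1.den := by exact_mod_cast y1.pos
  have p3 : (0 : ℚ) < g0.den := by exact_mod_cast g0.pos
  have p4 : (0 : ℚ) < g1.den := by exact_mod_cast g1.pos
  have p5 : (0 : ℚ) < h0.den := by exact_mod_cast h0.pos
  have p6 : (0 : ℚ) < h1.den := by exact_mod_cast h1.pos
  have p : (0 : ℚ) < y0.den * y1.den * g0.den * g1.den * h0.den * h1.den := by positivity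
  have key : (y0.den * y1.den * g0.den * g1.den * h0.den * h1.den : ℚ)
      * ((g0 - y0) * (h1 - y1) - (g1 - y1) * (h0 - y0)) =
      (((g0.num * y0.den - y0.num * g0.den) * (h1.num * y1.den - y1.num * h1.den)
          * (g1.den * h0.den)
        - (g1.num * y1.den - y1.num * g1.den) * (h0.num * y0.den - y0.num * h0.den)
          * (g0.den * h1.den) : ℤ) : ℚ) := by
    have num : ∀ q : ℚ, (q.num : ℚ) = q * q.den := fun q => (Rat.mul_den_eq_num q).symm
    push_cast
    simp only [num]
    ring
  rw [← sub_nonneg (b := (g1 - y1) * (h0 - y0)), ← mul_nonneg_iff_of_pos_left p, key,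
    Int.cast_nonneg_iff]
  omega

theorem badE_pos_iff {m : ℕ → ℤ} {p : ℕ → Pt} {i j k : ℕ} (hi : HoldsPt m 20 (p i))
    (hj : HoldsPt m 24 (p j)) (hk : HoldsPt m 28 (p k)) (h16 : m 16 = i)
    (hdiv : (m 18).fdiv (m 15) = j) : 0 < badE.eval m ↔ Bad p i j k := by
  have heq := eqE_pos_iff hj hi
  obtain ⟨y0, y1, y2, y3⟩ := hi
  obtain ⟨g0, g1, g2, g3⟩ := hj
  obtain ⟨h0, h1, h2, h3⟩ := hk
  norm_num at y0 y1 y2 y3 g0 g1 g2 g3 h0 h1 h2 h3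
  have hne : ∀ (q : Prop) [Decidable q], 0 < 1 - (if q then (1 : ℤ) else 0) ↔ ¬ q := by
    intro q _
    by_cases hq : q <;> simp [hq]
  have hij : 0 < (i : ℤ) - j ↔ j < i := by omega
  simp only [badE, eval_add, eval_mul, eval_pos, eval_sub, eval_c, eval_v, eval_div, ite_mul_ite_one,
    ite_add_pos_iff, hne, heq, hdiv, h16, y0, y1, y2, y3, g0, g1, g2, g3, h0, h1, h2, h3,
    one_sub_cross_pos_iff, comb_pos_iff, cross_pos_iff, hij, Bad, pt_le_iff, ne_eq, and_assoc]

/-- Tests the point with number in cell `16` with respect to the pair of points that is encoded in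
cell `18`. -/
def checkP : Prog :=
  .seq (copyP (v 16 * c 4 + c 40) (c 20)) (.seq (copyP (v 18 / v 15 * c 4 + c 40) (c 24))
    (.seq (copyP ((v 18 - v 15 * (v 18 / v 15)) * c 4 + c 40) (c 28))
      (.seq (ifP badE (setP 17 (c 1)) .skip) (setP 18 (v 18 + c 1)))))

/-- Outputs the point with number in cell `16`. -/
def printP : Prog :=
  .seq (outP (ld (v 16 * c 4 + c 40))) (.seq (outP (ld (v 16 * c 4 + c 41)))
    (.seq (outP (ld (v 16 * c 4 + c 42))) (outP (ld (v 16 * c 4 + c 43)))))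

/-- Outputs the point with number in cell `16` if it has to be kept. -/
def filterP : Prog :=
  .seq (setP 17 (c 0)) (.seq (setP 18 (c 0)) (.seq (whileP (v 15 * v 15 - v 18) checkP)
    (.seq (ifP (c 1 - v 17) printP .skip) (setP 16 (v 16 + c 1)))))

/-- Outputs the extreme points among the points that have been found. -/
def selectP : Prog :=
  .seq (setP 15 (v 8 * c 2)) (.seq (setP 16 (c 0)) (whileP (v 15 - v 16) filterP))

/-- The Dichotomic Approach. -/
def daP : Prog := .seq initP (.seq (whileP (v 8 - v 9) iterP) selectP)

/-- The cells from `40` on hold the points with numbers less than `N`. -/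
def HoldsPts (m : ℕ → ℤ) (N : ℕ) (p : ℕ → Pt) : Prop :=
  ∀ q < N, HoldsPt m (40 + 4 * q) (p q)

theorem HoldsPts.congr {m m' : ℕ → ℤ} {N : ℕ} {p : ℕ → Pt} (h : HoldsPts m N p)
    (hm : ∀ i, 40 ≤ i → m' i = m i) : HoldsPts m' N p :=
  fun q hq => (h q hq).congr fun j _ => hm _ (by omega)

open Classical in
/-- The output after the first `n` points have been considered. -/
noncomputable def kept (p : ℕ → Pt) (N n : ℕ) : List ℕ :=
  (List.range n).filter fun i => decide (Keep p N i)

namespace Oracle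

variable {M : Machine} {P : Instance} {V : ℕ}

/-- The pair of numbers `(j, k)` is encoded as `x = j * N + k`, so one counter replaces two nested
loops. -/
theorem run_check (O : Oracle M P V) {u : RState} {N i x : ℕ} {p : ℕ → Pt}
    (hN : N ≤ 24 * 2 ^ P.size) (hH : HoldsPts u.mem N p) (h15 : u.mem 15 = N) (h16 : u.mem 16 = i)
    (h18 : u.mem 18 = x) (hi : i < N) (hx : x < N * N) :
    ∃ u', M.Run checkP u u' 12000 ∧
      ((Bad p i (x / N) (x % N) ∧ u'.mem 17 = 1) ∨
        (¬ Bad p i (x / N) (x % N) ∧ u'.mem 17 = u.mem 17)) ∧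
      u'.mem 18 = (x + 1 : ℕ) ∧
      (∀ a, a = 8 ∨ a = 15 ∨ a = 16 ∨ 40 ≤ a → u'.mem a = u.mem a) ∧
      u'.out = u.out ∧ u'.log = u.log := by
  have hK := O.hK
  have hk := O.pow_le'
  have hk2 := O.pow_le
  have hone := Nat.one_le_two_pow (n := P.size)
  have hN0 : 0 < N := by omega
  have hj : x / N < N := Nat.div_lt_of_lt_mul hx
  have hl : x % N < N := Nat.mod_lt _ hN0
  have hNN : N * N ≤ 576 * (2 ^ P.size * 2 ^ P.size) := by
    have := Nat.mul_le_mul hN hN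
    linarith
  have hpp : 0 < 2 ^ P.size * 2 ^ P.size := by positivity
  have hdiv : ((x : ℤ).fdiv N) = ((x / N : ℕ) : ℤ) := by
    rw [Int.fdiv_eq_ediv_of_nonneg _ (by positivity)]
    simp
  have hmod : (x : ℤ) - N * ((x / N : ℕ) : ℤ) = ((x % N : ℕ) : ℤ) := by
    have := Nat.div_add_mod x N
    have h2 : ((N * (x / N) + x % N : ℕ) : ℤ) = x := by rw [this]
    push_cast at h2 ⊢
    linarith
  obtain ⟨u1, r1, c1, f1⟩ := Machine.run_copy (M := M) hK (u := u) (se := v 16 * c 4 + c 40)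
    (de := c 20) (40 + 4 * i) 20 (Fits.mono (by decide) hK) (Fits.mono (by decide) hK)
    (by simp) (by simp) (by simp [h16]; ring) (by simp) (by omega) (by omega) (by omega) (by omega)
    (by omega)
  obtain ⟨u2, r2, c2, f2⟩ := Machine.run_copy (M := M) hK (u := u1)
    (se := v 18 / v 15 * c 4 + c 40) (de := c 24) (40 + 4 * (x / N)) 24
    (Fits.mono (by decide) hK) (Fits.mono (by decide) hK) (by simp) (by simp)
    (by
      simp only [eval_add, eval_mul, eval_div, eval_v, eval_c]
      rw [f1.1 15 (by omega), f1.1 18 (by omega), h15, h18, hdiv]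
      push_cast
      ring) (by simp) (by omega) (by omega) (by omega) (by omega) (by omega)
  obtain ⟨u3, r3, c3, f3⟩ := Machine.run_copy (M := M) hK (u := u2)
    (se := (v 18 - v 15 * (v 18 / v 15)) * c 4 + c 40) (de := c 28) (40 + 4 * (x % N)) 28
    (Fits.mono (by decide) hK) (Fits.mono (by decide) hK) (by simp) (by simp)
    (by
      simp only [eval_add, eval_mul, eval_div, eval_sub, eval_v, eval_c]
      rw [f2.1 15 (by omega), f2.1 18 (by omega), f1.1 15 (by omega), f1.1 18 (by omega), h15, h18,
        hdiv, hmod]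
      push_cast
      ring) (by simp) (by omega) (by omega) (by omega) (by omega) (by omega)
  have g3 : ∀ a, a = 8 ∨ a = 15 ∨ a = 16 ∨ a = 17 ∨ a = 18 ∨ 40 ≤ a → u3.mem a = u.mem a :=
    fun a ha => by rw [f3.1 a (by omega), f2.1 a (by omega), f1.1 a (by omega)]
  have A : HoldsPt u3.mem 20 (p i) := (hH i hi).congr fun j hj => by
    rw [f3.1 _ (by omega), f2.1 _ (by omega), c1 j hj]
  have B : HoldsPt u3.mem 24 (p (x / N)) := (hH _ hj).congr fun j hj => by
    rw [f3.1 _ (by omega), c2 j hj, f1.1 _ (by omega)]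
  have C : HoldsPt u3.mem 28 (p (x % N)) := (hH _ hl).congr fun j hj => by
    rw [c3 j hj, f2.1 _ (by omega), f1.1 _ (by omega)]
  have hbad := badE_pos_iff A B C (by rw [g3 16 (by omega), h16])
    (by rw [g3 15 (by omega), g3 18 (by omega), h15, h18, hdiv])
  have hsz : badE.sz ≤ 9950 := by decide
  have hif : ∃ u4, M.Run (ifP badE (setP 17 (c 1)) .skip) u3 u4 (badE.sz + 30) ∧
      ((Bad p i (x / N) (x % N) ∧ u4.mem 17 = 1) ∨
        (¬ Bad p i (x / N) (x % N) ∧ u4.mem 17 = u3.mem 17)) ∧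
      (∀ a, a ≠ 17 → u4.mem a = u3.mem a) ∧ u4.out = u3.out ∧ u4.log = u3.log := by
    by_cases hb : 0 < badE.eval u3.mem
    · obtain ⟨u4, r4, m4, o4, l4⟩ := Machine.exists_run_set (M := M) (u := u3) (x := 17)
        (e := c 1) (z := 1) (by omega) (Fits.mono (by decide) hK) (by simp) (by simp)
        (fun _ => by simp; have := O.hk; omega)
      refine ⟨u4, (Machine.run_if_pos (Fits.mono (by decide) hK) (by simp [badE, eqE]) hb r4).mono
        (by clear * -; simp; omega), Or.inl ⟨hbad.1 hb, by rw [m4, Function.update_self]⟩,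
        fun a ha => by rw [m4, Function.update_of_ne ha], o4, l4⟩
    · exact ⟨u3, (Machine.run_if_neg (Fits.mono (by decide) hK) (by simp [badE, eqE]) hb
        (Machine.run_skip u3)).mono (by clear * -; omega), Or.inr ⟨fun h => hb (hbad.2 h), rfl⟩,
        fun _ _ => rfl, rfl, rfl⟩
  obtain ⟨u4, r4, h17, f4, o4, l4⟩ := hif
  obtain ⟨u5, r5, m5, o5, l5⟩ := Machine.exists_run_set (M := M) (u := u4) (x := 18)
    (e := v 18 + c 1) (z := (x + 1 : ℕ)) (by omega) (Fits.mono (by decide) hK)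
    (by simp) (by simp [f4 18 (by omega), g3 18 (by omega), h18])
    (fun _ => by rw [Int.natAbs_natCast]; omega)
  have f5 : ∀ a, a ≠ 18 → u5.mem a = u4.mem a := fun a ha => by rw [m5, Function.update_of_ne ha]
  have hr := r1.seq (r2.seq (r3.seq (r4.seq r5)))
  refine ⟨u5, hr.mono ?_, ?_, by rw [m5, Function.update_self], ?_, ?_, ?_⟩
  · clear * - hsz
    generalize badE.sz = B at *
    simp only [sz_add, sz_mul, sz_v, sz_c, sz_sub, sz_div]
    norm_num
    omega
  · rw [f5 17 (by omega), ← g3 17 (by omega)]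
    exact h17
  · intro a ha
    rw [f5 a (by omega), f4 a (by omega), g3 a (by omega)]
  · rw [o5, o4, f3.2.1, f2.2.1, f1.2.1]
  · rw [l5, l4, f3.2.2, f2.2.2, f1.2.2]

theorem run_checks (O : Oracle M P V) {u : RState} {N i : ℕ} {p : ℕ → Pt}
    (hN : N ≤ 24 * 2 ^ P.size) (hH : HoldsPts u.mem N p) (h15 : u.mem 15 = N) (h16 : u.mem 16 = i)
    (h17 : u.mem 17 = 0) (h18 : u.mem 18 = 0) (hi : i < N) :
    ∃ u', M.Run (whileP (v 15 * v 15 - v 18) checkP) u u' (13000 * (N * N) + 200) ∧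
      (0 < 1 - u'.mem 17 ↔ Keep p N i) ∧
      (∀ a, a = 8 ∨ a = 15 ∨ a = 16 ∨ 40 ≤ a → u'.mem a = u.mem a) ∧
      u'.out = u.out ∧ u'.log = u.log := by
  have hK := O.hK
  obtain ⟨n', u', hr, ⟨x, hx, hn', hx18, hval, hflag, hf, ho, hl⟩, hneg⟩ :=
    Machine.run_while (M := M) (e := v 15 * v 15 - v 18) (p := checkP) (T := 12000)
    -- Cell `17` is a flag that records whether one of the first `x` pairs rules out the point.
    (fun n u' => ∃ x ≤ N * N, n = N * N - x ∧ u'.mem 18 = (x : ℕ) ∧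
      (u'.mem 17 = 0 ∨ u'.mem 17 = 1) ∧
      (u'.mem 17 = 1 ↔ ∃ x' < x, Bad p i (x' / N) (x' % N)) ∧
      (∀ a, a = 8 ∨ a = 15 ∨ a = 16 ∨ 40 ≤ a → u'.mem a = u.mem a) ∧
      u'.out = u.out ∧ u'.log = u.log)
    (Fits.mono (by decide) hK) (fun _ _ _ => by simp) (by
      rintro n u1 ⟨x, hx, hn, hx18, hval, hflag, hf, ho, hl⟩ hpos
      simp only [eval_sub, eval_mul, eval_v, hf 15 (by omega), h15, hx18] at hpos
      have hlt : x < N * N := by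
        have : (x : ℤ) < ((N * N : ℕ) : ℤ) := by push_cast; linarith
        exact_mod_cast this
      obtain ⟨u2, r2, hcase, h2, f2, o2, l2⟩ := O.run_check hN
        (hH.congr fun a ha => hf a (by omega)) ((hf 15 (by omega)).trans h15)
        ((hf 16 (by omega)).trans h16) hx18 hi hlt
      refine ⟨N * N - (x + 1), u2, by rw [hn]; clear * - hlt; omega, r2, x + 1, hlt, rfl, h2, ?_, ?_, fun a ha =>
        (f2 a ha).trans (hf a ha), o2.trans ho, l2.trans hl⟩
      · rcases hcase with ⟨_, h⟩ | ⟨_, h⟩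
        · exact Or.inr h
        · rw [h]; exact hval
      · rcases hcase with ⟨hb, h⟩ | ⟨hb, h⟩
        · exact ⟨fun _ => ⟨x, Nat.lt_succ_self x, hb⟩, fun _ => h⟩
        · rw [h, hflag]
          constructor
          · rintro ⟨x', hx', hb'⟩
            exact ⟨x', by omega, hb'⟩
          · rintro ⟨x', hx', hb'⟩
            refine ⟨x', ?_, hb'⟩
            by_contra hge
            have hxx : x' = x := by clear * - hx' hge; omega
            exact hb (hxx ▸ hb'))
    (N * N) u ⟨0, by omega, rfl, h18, Or.inl h17, by simp [h17], fun _ _ => rfl, rfl, rfl⟩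
  have hxeq : x = N * N := by
    simp only [eval_sub, eval_mul, eval_v, hf 15 (by omega), h15, hx18] at hneg
    have : ((N * N : ℕ) : ℤ) ≤ x := by push_cast; linarith
    have : N * N ≤ x := by exact_mod_cast this
    omega
  refine ⟨u', hr.mono ?_, ?_, hf, ho, hl⟩
  · rw [show (v 15 * v 15 - v 18).sz = 71 by decide]
    clear * -
    nlinarith [Nat.zero_le (N * N)]
  · have h1 : 0 < 1 - u'.mem 17 ↔ ¬ u'.mem 17 = 1 := by
      rcases hval with h | h <;> rw [h] <;> simp
    rw [h1, hflag, hxeq]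
    constructor
    · intro h j hj k hk hb
      refine h ⟨j * N + k, ?_, ?_⟩
      · have := Nat.mul_le_mul_right N (Nat.succ_le_of_lt hj)
        rw [Nat.succ_mul] at this
        omega
      · rw [Nat.add_comm, Nat.add_mul_div_right _ _ (by omega), Nat.div_eq_of_lt hk, zero_add,
          Nat.add_mul_mod_self_right, Nat.mod_eq_of_lt hk]
        exact hb
    · rintro h ⟨x', hx', hb⟩
      exact h _ (Nat.div_lt_of_lt_mul hx') _ (Nat.mod_lt _ (by omega)) hb

theorem run_print (O : Oracle M P V) {u : RState} {i : ℕ} {y : Pt} (h16 : u.mem 16 = i)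
    (hy : HoldsPt u.mem (40 + 4 * i) y) :
    M.Run printP u { u with out := u.out ++ ptCode y } 500 := by
  have hK := O.hK
  have key : ∀ (o : List ℤ) (j : ℕ), j ≤ 3 → M.Run (outP (ld (v 16 * c 4 + c (40 + j))))
      { u with out := o } { u with out := o ++ [u.mem (40 + 4 * i + j)] } 120 := by
    intro o j hj
    have := Machine.run_out (M := M) (u := { u with out := o }) (e := ld (v 16 * c 4 + c (40 + j)))
      ⟨by simp; omega, by simp⟩ (by simp [h16]; omega)
    have hev : (ld (v 16 * c 4 + c (40 + j))).eval u.mem = u.mem (40 + 4 * i + j) := by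
      simp only [eval_ld, eval_add, eval_mul, eval_v, eval_c, h16]
      congr 1
      omega
    simp only [hev] at this
    refine this.mono ?_
    clear * - hj
    simp
    omega
  have k0 := key u.out 0 (by omega)
  have k1 := key (u.out ++ [u.mem (40 + 4 * i + 0)]) 1 (by omega)
  have k2 := key (u.out ++ [u.mem (40 + 4 * i + 0)] ++ [u.mem (40 + 4 * i + 1)]) 2 (by omega)
  have k3 := key (u.out ++ [u.mem (40 + 4 * i + 0)] ++ [u.mem (40 + 4 * i + 1)] ++
    [u.mem (40 + 4 * i + 2)]) 3 (by omega)
  have hr := k0.seq (k1.seq (k2.seq k3))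
  obtain ⟨y0, y1, y2, y3⟩ := hy
  simp only [add_zero, y0, y1, y2, y3, List.append_assoc, List.singleton_append] at hr
  exact hr.mono (by norm_num)

theorem run_filter (O : Oracle M P V) {u : RState} {N i : ℕ} {p : ℕ → Pt}
    (hN : N ≤ 24 * 2 ^ P.size) (hH : HoldsPts u.mem N p) (h15 : u.mem 15 = N) (h16 : u.mem 16 = i)
    (hi : i < N) (hout : u.out = (kept p N i).flatMap fun i => ptCode (p i)) :
    ∃ u', M.Run filterP u u' (13000 * (N * N) + 2000) ∧
      u'.out = ((kept p N (i + 1)).flatMap fun i => ptCode (p i)) ∧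
      u'.mem 15 = N ∧ u'.mem 16 = (i + 1 : ℕ) ∧ (∀ a, 40 ≤ a → u'.mem a = u.mem a) ∧
      u'.log = u.log := by
  have hK := O.hK
  have hk := O.pow_le'
  have hone := Nat.one_le_two_pow (n := P.size)
  obtain ⟨u1, r1, m1, o1, l1⟩ := Machine.exists_run_set (M := M) (u := u) (x := 17) (e := c 0)
    (z := 0) (by omega) (Fits.mono (by decide) hK) (by simp) (by simp) (fun _ => by simp)
  obtain ⟨u2, r2, m2, o2, l2⟩ := Machine.exists_run_set (M := M) (u := u1) (x := 18) (e := c 0)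
    (z := 0) (by omega) (Fits.mono (by decide) hK) (by simp) (by simp) (fun _ => by simp)
  have f2 : ∀ a, a ≠ 17 → a ≠ 18 → u2.mem a = u.mem a := fun a h h' => by
    rw [m2, m1, Function.update_of_ne h', Function.update_of_ne h]
  obtain ⟨u3, r3, hkeep, f3, o3, l3⟩ := O.run_checks (u := u2) hN
    (hH.congr fun a ha => f2 a (by omega) (by omega)) ((f2 15 (by omega) (by omega)).trans h15)
    ((f2 16 (by omega) (by omega)).trans h16) (by rw [m2, m1]; simp) (by rw [m2]; simp) hi
  have g3 : ∀ a, a = 15 ∨ a = 16 ∨ 40 ≤ a → u3.mem a = u.mem a := fun a ha => by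
    rw [f3 a (by omega), f2 a (by omega) (by omega)]
  have ho3 : u3.out = (kept p N i).flatMap fun i => ptCode (p i) := by rw [o3, o2, o1, hout]
  have hif : ∃ u4, M.Run (ifP (c 1 - v 17) printP .skip) u3 u4 600 ∧ u4.mem = u3.mem ∧
      u4.out = ((kept p N (i + 1)).flatMap fun i => ptCode (p i)) ∧ u4.log = u3.log := by
    by_cases hb : 0 < (c 1 - v 17).eval u3.mem
    · have hkp : Keep p N i := hkeep.1 (by simpa using hb)
      have r4 := O.run_print (u := u3) ((g3 16 (by omega)).trans h16)
        ((hH.congr fun a ha => g3 a (by omega)) i hi)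
      refine ⟨_, (Machine.run_if_pos (Fits.mono (by decide) hK) (by simp) hb r4).mono
        (by clear * -; simp), rfl, ?_, rfl⟩
      simp [ho3, kept, List.range_succ, hkp]
    · have hkp : ¬ Keep p N i := fun h => hb (by simpa using hkeep.2 h)
      refine ⟨u3, (Machine.run_if_neg (Fits.mono (by decide) hK) (by simp) hb
        (Machine.run_skip u3)).mono (by clear * -; simp), rfl, ?_, rfl⟩
      simp [ho3, kept, List.range_succ, hkp]
  obtain ⟨u4, r4, m4, o4, l4⟩ := hif
  obtain ⟨u5, r5, m5, o5, l5⟩ := Machine.exists_run_set (M := M) (u := u4) (x := 16)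
    (e := v 16 + c 1) (z := (i + 1 : ℕ)) (by omega) (Fits.mono (by decide) hK)
    (by simp) (by simp [m4, g3 16 (by omega), h16])
    (fun _ => by rw [Int.natAbs_natCast]; omega)
  have hr := r1.seq (r2.seq (r3.seq (r4.seq r5)))
  refine ⟨u5, hr.mono ?_, by rw [o5, o4], ?_, by rw [m5, Function.update_self], ?_, ?_⟩
  · clear * -
    simp only [sz_add, sz_v, sz_c]
    norm_num
    omega
  · rw [m5, Function.update_of_ne (by omega), m4, g3 15 (by omega), h15]
  · intro a ha
    rw [m5, Function.update_of_ne (by omega), m4, g3 a (by omega)]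
  · rw [l5, l4, l3, l2, l1]

theorem run_select (O : Oracle M P V) {u : RState} {t : ℕ} {p : ℕ → Pt}
    (ht : t ≤ 12 * 2 ^ P.size) (hH : HoldsPts u.mem (2 * t) p) (h8 : u.mem 8 = t)
    (hout : u.out = []) :
    ∃ u', M.Run selectP u u' (2 * t * (13000 * (2 * t * (2 * t)) + 2100) + 300) ∧
      u'.out = ((kept p (2 * t) (2 * t)).flatMap fun i => ptCode (p i)) ∧ u'.log = u.log := by
  have hK := O.hK
  have hk := O.pow_le'
  have hone := Nat.one_le_two_pow (n := P.size)
  obtain ⟨N, hN⟩ : ∃ N, N = 2 * t := ⟨_, rfl⟩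
  rw [← hN] at hH ⊢
  obtain ⟨u1, r1, m1, o1, l1⟩ := Machine.exists_run_set (M := M) (u := u) (x := 15) (e := v 8 * c 2)
    (z := N) (by omega) (Fits.mono (by decide) hK) (by simp) (by simp [h8, hN]; ring)
    (fun _ => by rw [Int.natAbs_natCast]; omega)
  obtain ⟨u2, r2, m2, o2, l2⟩ := Machine.exists_run_set (M := M) (u := u1) (x := 16) (e := c 0)
    (z := 0) (by omega) (Fits.mono (by decide) hK) (by simp) (by simp) (fun _ => by simp)
  obtain ⟨n', u', hr, ⟨i, hi, hn', h15, h16, hH', ho, hl⟩, hneg⟩ :=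
    Machine.run_while (M := M) (e := v 15 - v 16) (p := filterP) (T := 13000 * (N * N) + 2000)
    (fun n u' => ∃ i ≤ N, n = N - i ∧ u'.mem 15 = N ∧ u'.mem 16 = (i : ℕ) ∧
      HoldsPts u'.mem N p ∧ u'.out = ((kept p N i).flatMap fun i => ptCode (p i)) ∧ u'.log = u.log)
    (Fits.mono (by decide) hK) (fun _ _ _ => by simp) (by
      rintro n u1 ⟨i, hi, hn, h15, h16, hH', ho, hl⟩ hpos
      simp only [eval_sub, eval_v, h15, h16] at hpos
      have hlt : i < N := by omega
      obtain ⟨u2, r2, o2, g15, g16, g2, l2⟩ := O.run_filter (by omega) hH' h15 h16 hlt ho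
      exact ⟨N - (i + 1), u2, by omega, r2, i + 1, hlt, rfl, g15, g16, hH'.congr g2, o2,
        l2.trans hl⟩)
    N u2 ⟨0, by omega, rfl, by rw [m2, m1]; simp, by rw [m2]; simp,
      hH.congr fun a ha => by
        rw [m2, m1, Function.update_of_ne (by omega), Function.update_of_ne (by omega)],
      by rw [o2, o1, hout]; simp [kept], by rw [l2, l1]⟩
  have hiN : i = N := by
    simp only [eval_sub, eval_v, h15, h16] at hneg
    omega
  subst hiN
  have hrun := r1.seq (r2.seq hr)
  refine ⟨u', hrun.mono ?_, ho, hl⟩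
  rw [show (v 15 - v 16).sz = 46 by decide]
  clear * -
  simp only [sz_mul, sz_v, sz_c]
  norm_num
  nlinarith [Nat.zero_le i]

/-- The complete program. -/
theorem run_da (O : Oracle M P V) (hP : P.S.Nonempty) :
    ∃ (s : RState) (t : ℕ) (ys : List Pt), Exec M.wl M.sub M.inp daP .init s t ∧
      t ≤ 2 * (V + M.inp.length) + 4000 +
        (6 * P.YX.ncard * (4000 * M.k + V + M.inp.length + 40100) + 100 +
        (24 * P.YX.ncard * (13000 * (24 * P.YX.ncard * (24 * P.YX.ncard)) + 2100) + 300)) ∧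
      RealizesDA P s ys ∧ toReal '' {y | y ∈ ys} = P.YX := by
  obtain ⟨d1, u1, h1, p1, r1, S1⟩ := O.run_init .init rfl rfl
  obtain ⟨d, u2, t2, p, r2, hq, S⟩ := O.run_loop hP S1
  have hlen := S.tail_le
  have hlog := S.reach.log_length_le
  have hcard := S.reach.inv.log_length_le hP
  obtain ⟨u3, r3, ho, hl⟩ := O.run_select (p := p) (by omega) S.holds S.tail S.out
  obtain ⟨_, hx⟩ := (r1.seq (r2.seq r3)) (fun i => by simp [RState.init])
  obtain ⟨s, t, hx, ⟨_, hso, hsl⟩, ht⟩ := hx .init ⟨fun _ => rfl, rfl, rfl⟩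
  have hys : {y | y ∈ (kept p (2 * t2) (2 * t2)).map p} = daOutput d.found := by
    ext y
    rw [← keep_iff S.found y]
    simp [kept, and_assoc]
  refine ⟨s, t, (kept p (2 * t2) (2 * t2)).map p, hx, ht.trans ?_, ⟨d, S.reach, hq, ?_, ?_, ?_, hys⟩,
    ?_⟩
  · have h24 : 2 * t2 ≤ 24 * P.YX.ncard := by omega
    gcongr
  · rw [hsl, hl, S.log]
  · rw [hso, ho, List.flatMap_map]
  · refine List.Nodup.map_on ?_ (List.nodup_range.filter _)
    intro i hi j hj hij
    simp only [kept, List.mem_filter, List.mem_range, decide_eq_true_eq] at hi hj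
    exact Keep.injOn hi.1 hj.1 hi.2 hj.2 hij
  · rw [hys]
    exact S.reach.inv.output_eq hq

end Oracle

/-! ### Polynomial bounds for the implementation -/

theorem polynomial_eval_mono (p : Polynomial ℕ) {x y : ℕ} (h : x ≤ y) : p.eval x ≤ p.eval y := by
  rw [Polynomial.eval_eq_sum_range, Polynomial.eval_eq_sum_range]
  gcongr

/-- The Dichotomic Approach is output-sensitive. -/
theorem da_implementation : ∃ D : Prog, ∀ (P : Problem) (W : Prog), SolvesWSInPolyTime P W →
      ∃ p : Polynomial ℕ, ∀ w ∈ P.I, (P.inst w).S.Nonempty →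
        ∃ (s : RState) (t : ℕ) (ys : List Pt),
          RunsWith (p.eval (P.inst w).size) W D w s t ∧
          t ≤ p.eval ((P.inst w).size + (P.inst w).YX.ncard) ∧
          RealizesDA (P.inst w) s ys ∧
          toReal '' {y | y ∈ ys} = (P.inst w).YX := by
  refine ⟨daP, fun P W ⟨q, hW⟩ => ?_⟩
  obtain ⟨a, ha⟩ := P.length_le
  -- Weights of height at most `2 ^ (2 size + 1)` have length at most `8 size + 12`; adding the
  -- input size gives `9 size + 12`.
  let V : Polynomial ℕ := q.comp (9 * .X + 12)
  let L : Polynomial ℕ := .C a * (.X + 1)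
  -- This is `k * K + 1` with `k = 2 size + 16`; `K = 10000` exceeds the size of every expression in
  -- the program.
  let wl : Polynomial ℕ := (2 * .X + 16) * 10000 + 1
  let T : Polynomial ℕ := 2 * (V + L) + 4000 +
        (6 * .X * (4000 * (2 * .X + 16) + V + L + 40100) + 100 +
        (24 * .X * (13000 * (24 * .X * (24 * .X)) + 2100) + 300))
  -- One polynomial has to bound the word length of the program, that of the subroutine, and the
  -- running time.
  refine ⟨wl + V + T, fun w hw hS => ?_⟩
  obtain ⟨σ, hσ⟩ : ∃ σ, σ = (P.inst w).size := ⟨_, rfl⟩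
  obtain ⟨ω, hω⟩ : ∃ ω, ω = (wl + V + T).eval σ := ⟨_, rfl⟩
  have hω1 : (2 * σ + 16) * 10000 + 1 ≤ ω := by
    rw [hω, Polynomial.eval_add, Polynomial.eval_add]
    simp only [wl, Polynomial.eval_add, Polynomial.eval_mul, Polynomial.eval_ofNat,
      Polynomial.eval_X, Polynomial.eval_one]
    omega
  have hω2 : V.eval σ ≤ ω := by
    rw [hω, Polynomial.eval_add, Polynomial.eval_add]
    omega
  have hV : ∀ x, V.eval x = q.eval (9 * x + 12) := fun x => by
    simp [V, Polynomial.eval_comp]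
  let M : Machine :=
    { wl := ω, k := 2 * σ + 16, K := 10000,
      sub := fun args res u => Runs ω W (args ++ wordCode w) res u, inp := wordCode w,
      one_le := by omega, hwl := hω1 }
  have O : Oracle M (P.inst w) (V.eval σ) :=
    { solve := fun l hl hh => by
        obtain ⟨y, t, hy, hr, ht⟩ := hW w hw hS l hl
        have hq : q.eval ((P.inst w).size + encVec l) ≤ V.eval σ := by
          rw [hV]
          apply polynomial_eval_mono
          have := encVec_le hh
          omega
        exact ⟨y, t, hy, hr.mono (hq.trans hω2), ht.trans hq⟩
      hk := by rw [← hσ]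
      hK := le_rfl }
  obtain ⟨s, t, ys, hx, ht, hR, hY⟩ := O.run_da hS
  rw [← hσ]
  refine ⟨s, t, ys, ?_, ht.trans ?_, hR, hY⟩
  · rw [← hω]
    exact hx
  · obtain ⟨z, hz⟩ : ∃ z, z = σ + (P.inst w).YX.ncard := ⟨_, rfl⟩
    have h1 : V.eval σ ≤ V.eval z := polynomial_eval_mono V (by omega)
    have h2 : M.inp.length ≤ L.eval z := by
      have h3 : M.inp.length = w.length := List.length_map _
      have h4 : L.eval z = a * (z + 1) := by simp [L]
      rw [h3, h4]
      exact (ha w hw).trans (Nat.mul_le_mul_left _ (by omega))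
    have h3 : (P.inst w).YX.ncard ≤ z := by omega
    have h4 : M.k ≤ 2 * z + 16 := by
      change 2 * σ + 16 ≤ 2 * z + 16
      omega
    have h5 : T.eval z ≤ (wl + V + T).eval z :=
      (Nat.le_add_left _ _).trans_eq Polynomial.eval_add.symm
    rw [← hz]
    refine le_trans ?_ h5
    simp only [T, Polynomial.eval_add, Polynomial.eval_mul, Polynomial.eval_ofNat,
      Polynomial.eval_X]
    gcongr

end BOCO

theorem theoremt :
    -- Correctness, the number of scalarizations, and the encoding lengths.
    (∃ (c : ℕ) (q : Polynomial ℕ), ∀ P : BOCO.Instance, P.S.Nonempty →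
      (∃ s, DAInit P s) ∧
      ∀ s, DAReach P s →
        s.log.length ≤ c * P.YX.ncard ∧
        (∀ e ∈ s.log, encVec e.1 ≤ q.eval P.size ∧ encVec e.2 ≤ q.eval P.size) ∧
        (s.queue ≠ [] → ∃ s', DAStep P s s') ∧
        (s.queue = [] → toReal '' daOutput s.found = P.YX)) ∧
    -- Output-sensitivity of an implementation on the random access machine.
    (∃ D : Prog, ∀ (P : Problem) (W : Prog), SolvesWSInPolyTime P W →
      ∃ p : Polynomial ℕ, ∀ w ∈ P.I, (P.inst w).S.Nonempty →
        ∃ (s : RState) (t : ℕ) (ys : List Pt),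
          RunsWith (p.eval (P.inst w).size) W D w s t ∧
          t ≤ p.eval ((P.inst w).size + (P.inst w).YX.ncard) ∧
          RealizesDA (P.inst w) s ys ∧
          toReal '' {y | y ∈ ys} = (P.inst w).YX) := by
  exact ⟨da_correct, da_implementation⟩
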